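/- For positive integers $l,m,n$ let $\Delta(l,m,n)=\langle A,B,C\mid A^l=B^m=C^n=ABC=1\rangle$, and call this triangle group hyperbolic if $\frac1l+\frac1m+\frac1n<1$. A finite group $G$ is a Beauville group (of unmixed type) if there are two hyperbolic triangle groups $\Delta_i=\Delta(l_i,m_i,n_i)$ and epimorphisms $\Delta_i\to G$ ($i=1,2$), mapping the canonical generators of $\Delta_i$ to elements $a_i,b_i,c_i$ of orders exactly $l_i,m_i,n_i$, such that $\Sigma_1\cap\Sigma_2=\{1\}$, where $\Sigma_i$ is the set of conjugates in $G$ of powers of $a_i,b_i,c_i$. A group is a $2$-generator group if it is generated by two elements. For a finite group $H$ let $d_2(H)$ be the number of orbits of $\mathrm{Aut}\,H$ on ordered pairs $(x,y)$ of elements generating $H$. **Theorem 1.1.** Let $G=H^k$, where $k\ge 1$ and $H=L_2(q)=SL_2(q)/\{\pm I\}$ for a prime power $q\ge 4$. Then the following are equivalent: (a) $G$ is a Beauville group; (b) $G$ is a $2$-generator group not isomorphic to $A_5$; (c) $k\le d_2(H)$, and if $q\le 5$ then $k>1$. -/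

import Mathlib

/-- The triangle group `Δ(l, m, n) = ⟨A, B, C ∣ A ^ l = B ^ m = C ^ n = A * B * C = 1⟩`. -/
abbrev TriangleGroup (l m n : ℕ) : Type :=
  PresentedGroup ({FreeGroup.of 0 ^ l, FreeGroup.of 1 ^ m, FreeGroup.of 2 ^ n,
    FreeGroup.of 0 * FreeGroup.of 1 * FreeGroup.of 2} : Set (FreeGroup (Fin 3)))

namespace TriangleGroup

/-- The canonical generator `A` of `Δ(l, m, n)`. -/
def genA (l m n : ℕ) : TriangleGroup l m n := PresentedGroup.of 0

/-- The canonical generator `B` of `Δ(l, m, n)`. -/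
def genB (l m n : ℕ) : TriangleGroup l m n := PresentedGroup.of 1

/-- The canonical generator `C` of `Δ(l, m, n)`. -/
def genC (l m n : ℕ) : TriangleGroup l m n := PresentedGroup.of 2

/-- `Δ(l, m, n)` is a hyperbolic triangle group: `l, m, n` are positive and
`1 / l + 1 / m + 1 / n < 1`. -/
def IsHyperbolic (l m n : ℕ) : Prop :=
  0 < l ∧ 0 < m ∧ 0 < n ∧ (l : ℚ)⁻¹ + (m : ℚ)⁻¹ + (n : ℚ)⁻¹ < 1

/-- `f` exhibits `G` as a smooth quotient of `Δ(l, m, n)`: it is an epimorphism and the images of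
the canonical generators have orders exactly `l`, `m` and `n`. -/
def IsSmoothQuotient {G : Type*} [Group G] {l m n : ℕ} (f : TriangleGroup l m n →* G) : Prop :=
  Function.Surjective f ∧ orderOf (f (genA l m n)) = l ∧ orderOf (f (genB l m n)) = m ∧
    orderOf (f (genC l m n)) = n

/-- The set of all conjugates in `G` of powers of the images of the canonical generators. -/
def sigma {G : Type*} [Group G] {l m n : ℕ} (f : TriangleGroup l m n →* G) : Set G :=
  {g | ∃ d : G, (d = f (genA l m n) ∨ d = f (genB l m n) ∨ d = f (genC l m n)) ∧
    ∃ r : ℤ, IsConj (d ^ r) g}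

end TriangleGroup

/-- A finite group `G` is a Beauville group (of unmixed type) if it is a smooth quotient of two
hyperbolic triangle groups in such a way that the two sets of conjugates of powers of the images
of the canonical generators meet only in the identity. -/
def IsBeauvilleGroup (G : Type*) [Group G] : Prop :=
  Finite G ∧
  ∃ (l₁ m₁ n₁ l₂ m₂ n₂ : ℕ) (f₁ : TriangleGroup l₁ m₁ n₁ →* G) (f₂ : TriangleGroup l₂ m₂ n₂ →* G),
    TriangleGroup.IsHyperbolic l₁ m₁ n₁ ∧ TriangleGroup.IsHyperbolic l₂ m₂ n₂ ∧
    TriangleGroup.IsSmoothQuotient f₁ ∧ TriangleGroup.IsSmoothQuotient f₂ ∧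
    TriangleGroup.sigma f₁ ∩ TriangleGroup.sigma f₂ = {1}

/-- `x` and `y` generate the group `G`. -/
def IsGeneratingPair {G : Type*} [Group G] (x y : G) : Prop :=
  Subgroup.closure {x, y} = ⊤

/-- `G` is a 2-generator group: it is generated by two (not necessarily distinct) elements. -/
def IsTwoGenerator (G : Type*) [Group G] : Prop :=
  ∃ x y : G, IsGeneratingPair x y

/-- Equivalence of ordered generating pairs of `H` under the action of `Aut H`. -/
def autSetoid (H : Type*) [Group H] : Setoid {p : H × H // IsGeneratingPair p.1 p.2} where
  r p s := ∃ φ : MulAut H, φ p.1.1 = s.1.1 ∧ φ p.1.2 = s.1.2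
  iseqv :=
    { refl := fun _ => ⟨1, rfl, rfl⟩
      symm := by
        rintro p s ⟨φ, h1, h2⟩
        exact ⟨φ⁻¹, by rw [← h1, MulAut.inv_apply_self], by rw [← h2, MulAut.inv_apply_self]⟩
      trans := by
        rintro p s t ⟨φ, h1, h2⟩ ⟨ψ, h3, h4⟩
        exact ⟨ψ * φ, by rw [MulAut.mul_apply, h1, h3], by rw [MulAut.mul_apply, h2, h4]⟩ }

/-- `d₂(H)`: the number of orbits of `Aut H` on ordered pairs of generators of the finite
group `H`. -/
noncomputable def dTwo (H : Type*) [Group H] : ℕ :=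
  Nat.card (Quotient (autSetoid H))

/-! ### Generating pairs of powers of a simple group. -/

section Hall

variable {H : Type*} [Group H]

/-! Write `H` for the simple group `L₂(q)`. A pair in `H ^ k` generates exactly when its coordinates
are generating pairs of `H` in distinct `Aut H`-orbits: the only proper subgroups of `H ^ k`
projecting onto every factor are those where an automorphism links two coordinates
(`Subgroup.eq_top_of_forall_not_linked`). So a 2-generator power has `k ≤ d₂(H)`, and the work is to
find two lists of `k` inequivalent generating triples whose sets `Σ` meet trivially.

Every element of `H` has order dividing one of three pairwise coprime numbers: the orders of the
nonsplit and split tori and the characteristic (`PSL2.pow_eq_one`). Call the index of such a number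
a type. A power of prime order of `x ∈ H ^ k` is governed by one type `j`: its support contains the
coordinates where `x` has order `n j` and avoids those where `x` has order `n j'` with `j' ≠ j`
(`exists_support_type`). Conjugate elements have equal supports, so it is enough to prescribe the
types of a few coordinates so that supports never match, a finite check (`TypesSeparated`).
Automorphisms preserve orders, so triples of different types are inequivalent for free, and the
remaining coordinates may be filled arbitrarily (`isBeauvilleGroup_pi_of_realizes`). Six coordinates
carrying all orderings of the three types suffice when `k ≥ 6`; smaller powers also use triples such
as `(0, 0, 2)` and `(1, 1, 1)`.

The triples come from traces: the trace of a non-scalar matrix determines its order modulo the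
center, and the traces of `x`, `y`, `x * y` can be prescribed. Generation is proved by counting,
without a classification of subgroups: `SL2.eq_top_of_dg_mem` for subgroups containing the split
torus, `SL2.eq_top_of_companion_mem` for those containing a nonsplit torus and a transvection. The
fields with 7, 9 and 11 elements are treated by explicit matrices.

For `q = 4, 5` the group is `A₅`. There a hyperbolic triple always contains an element of order 5,
and Sylow's theorem makes any two such elements conjugate up to powers, so `k = 1` fails; for `k ≥
2` the method of types works with orders 2, 3, 5. -/

/-- A subgroup of a power of a finite nonabelian simple group which projects onto every coordinate
and links no two coordinates by an automorphism is the whole power. -/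
theorem Subgroup.eq_top_of_forall_not_linked [Finite H] [IsSimpleGroup H]
    (hH : ∃ a b : H, a * b ≠ b * a) {ι : Type*} [Fintype ι] [DecidableEq ι]
    (K : Subgroup (ι → H)) (hsurj : ∀ (i : ι) (h : H), ∃ g ∈ K, g i = h)
    (hlink : ∀ i j : ι, i ≠ j → ¬ ∃ φ : MulAut H, ∀ g ∈ K, φ (g i) = g j) : K = ⊤ := by
  -- `M i S` consists of the values at `i` of the elements of `K` trivial on `S`
  let M (i : ι) (S : Finset ι) : Subgroup H :=
    (K ⊓ ⨅ j ∈ S, (Pi.evalMonoidHom (fun _ : ι => H) j).ker).map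
      (Pi.evalMonoidHom (fun _ : ι => H) i)
  have hM : ∀ i S h, h ∈ M i S ↔ ∃ g ∈ K, (∀ j ∈ S, g j = 1) ∧ g i = h := by
    intro i S h
    simp only [M, Subgroup.mem_map, Subgroup.mem_inf, Subgroup.mem_iInf, MonoidHom.mem_ker,
      Pi.evalMonoidHom_apply, and_assoc]
  have hnormal : ∀ i S, (M i S).Normal := by
    intro i S
    refine ⟨fun h hh c => ?_⟩
    obtain ⟨g, hg, hgS, rfl⟩ := (hM _ _ _).1 hh
    obtain ⟨t, ht, rfl⟩ := hsurj i c
    refine (hM _ _ _).2 ⟨t * g * t⁻¹, K.mul_mem (K.mul_mem ht hg) (K.inv_mem ht), ?_, rfl⟩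
    intro j hj
    simp [hgS j hj]
  -- If no nontrivial value at `i` is compatible with triviality at `j`, then the `j` coordinate
  -- determines the `i` coordinate on `K`. The resulting surjective endomorphism of the finite group
  -- `H` is an automorphism linking `j` to `i`.
  have hpair : ∀ i j, i ≠ j → M i {j} = ⊤ := by
    intro i j hij
    refine ((hnormal i {j}).eq_bot_or_eq_top).resolve_left fun hbot => ?_
    have key : ∀ g ∈ K, g j = 1 → g i = 1 := by
      intro g hg hgj
      have : g i ∈ M i {j} := (hM _ _ _).2 ⟨g, hg, by simpa using hgj, rfl⟩
      rwa [hbot, Subgroup.mem_bot] at this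
    choose s hsK hs using hsurj j
    have hwd : ∀ g ∈ K, s (g j) i = g i := by
      intro g hg
      have := key (s (g j) * g⁻¹) (K.mul_mem (hsK _) (K.inv_mem hg)) (by simp [hs])
      simpa [mul_inv_eq_one] using this
    let φ : H →* H := MonoidHom.mk' (fun h => s h i) (by
      intro a b
      have := hwd (s a * s b) (K.mul_mem (hsK _) (hsK _))
      simpa [hs] using this)
    have hφ : Function.Surjective φ := by
      intro h
      obtain ⟨g, hg, rfl⟩ := hsurj i h
      exact ⟨g j, hwd g hg⟩
    have hbij : Function.Bijective φ := Function.Surjective.bijective_of_finite hφ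
    exact hlink j i hij.symm ⟨MulEquiv.ofBijective φ hbij, fun g hg => hwd g hg⟩
  have hall : ∀ i S, i ∉ S → M i S = ⊤ := by
    intro i S
    induction S using Finset.induction_on with
    | empty =>
      intro _
      refine (Subgroup.eq_top_iff' _).2 fun h => ?_
      obtain ⟨g, hg, rfl⟩ := hsurj i h
      exact (hM _ _ _).2 ⟨g, hg, by simp, rfl⟩
    | insert j S hjS ih =>
      intro hi
      rw [Finset.mem_insert, not_or] at hi
      have h1 := ih hi.2
      have h2 := hpair i j hi.1
      refine ((hnormal i (insert j S)).eq_bot_or_eq_top).resolve_left fun hbot => ?_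
      -- The commutator of an element trivial on `S` with one trivial at `j` is trivial on both,
      -- while its value at `i` is the nontrivial commutator of `a` and `b`.
      obtain ⟨a, b, hab⟩ := hH
      obtain ⟨g, hg, hgS, rfl⟩ := (hM i S a).1 (h1 ▸ Subgroup.mem_top a)
      obtain ⟨g', hg', hgj, rfl⟩ := (hM i {j} b).1 (h2 ▸ Subgroup.mem_top b)
      have : g i * g' i * (g i)⁻¹ * (g' i)⁻¹ ∈ M i (insert j S) := by
        refine (hM _ _ _).2 ⟨g * g' * g⁻¹ * g'⁻¹, K.mul_mem (K.mul_mem (K.mul_mem hg hg')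
          (K.inv_mem hg)) (K.inv_mem hg'), ?_, rfl⟩
        intro l hl
        rcases Finset.mem_insert.1 hl with rfl | hl
        · simp [hgj l (by simp)]
        · simp [hgS l hl]
      rw [hbot, Subgroup.mem_bot, mul_inv_eq_one, mul_inv_eq_iff_eq_mul] at this
      exact hab this
  refine (Subgroup.eq_top_iff' _).2 fun x => ?_
  have hsingle : ∀ i, Pi.mulSingle i (x i) ∈ K := by
    intro i
    obtain ⟨g, hg, hgS, hgi⟩ := (hM i (Finset.univ.erase i) (x i)).1
      (by rw [hall i _ (Finset.notMem_erase i _)]; exact Subgroup.mem_top _)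
    convert hg using 1
    funext j
    by_cases hj : j = i
    · rw [hj, Pi.mulSingle_eq_same, hgi]
    · rw [Pi.mulSingle_eq_of_ne hj, hgS j (by simp [hj])]
  have := Subgroup.noncommProd_mem K (t := Finset.univ) (f := fun i => Pi.mulSingle i (x i))
    (fun i _ j _ _ => Pi.mulSingle_apply_commute x i j) (fun i _ => hsingle i)
  rwa [Finset.noncommProd_mulSingle] at this

theorem IsGeneratingPair.map {G : Type*} [Group G] {x y : H} (h : IsGeneratingPair x y)
    (f : H →* G) (hf : Function.Surjective f) : IsGeneratingPair (f x) (f y) := by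
  unfold IsGeneratingPair at *
  rw [← Set.image_pair, ← MonoidHom.map_closure, h, Subgroup.map_top_of_surjective f hf]

/-- Pairwise inequivalent generating pairs of a finite nonabelian simple group generate its power. -/
theorem isGeneratingPair_pi [Finite H] [IsSimpleGroup H] (hH : ∃ a b : H, a * b ≠ b * a)
    {k : ℕ} (u : Fin k → H × H) (hgen : ∀ i, IsGeneratingPair (u i).1 (u i).2)
    (hne : ∀ i j, i ≠ j → ¬ ∃ φ : MulAut H, φ (u i).1 = (u j).1 ∧ φ (u i).2 = (u j).2) :
    IsGeneratingPair (fun i => (u i).1) (fun i => (u i).2) := by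
  refine Subgroup.eq_top_of_forall_not_linked hH _ (fun i h => ?_) (fun i j hij => ?_)
  · have h1 : (Subgroup.closure {fun i => (u i).1, fun i => (u i).2}).map
        (Pi.evalMonoidHom (fun _ : Fin k => H) i) = ⊤ := by
      rw [MonoidHom.map_closure, Set.image_pair]
      exact hgen i
    exact Subgroup.mem_map.1 (h1 ▸ Subgroup.mem_top h)
  · rintro ⟨φ, hφ⟩
    exact hne i j hij ⟨φ, hφ _ (Subgroup.subset_closure (Or.inl rfl)),
      hφ _ (Subgroup.subset_closure (Or.inr rfl))⟩

/-- A linking automorphism confines the generated subgroup to an equalizer, which misses the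
elements supported at `j` alone. -/
theorem IsGeneratingPair.inequivalent_of_pi {k : ℕ} {x y : Fin k → H}
    (h : IsGeneratingPair x y) (hH : Nontrivial H) {i j : Fin k} (hij : i ≠ j) (φ : MulAut H)
    (h1 : φ (x i) = x j) (h2 : φ (y i) = y j) : False := by
  have hle : Subgroup.closure {x, y} ≤
      MonoidHom.eqLocus (φ.toMonoidHom.comp (Pi.evalMonoidHom (fun _ : Fin k => H) i))
        (Pi.evalMonoidHom (fun _ : Fin k => H) j) := by
    rw [Subgroup.closure_le]
    rintro g (rfl | rfl)
    · exact h1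
    · exact h2
  rw [IsGeneratingPair] at h
  rw [h] at hle
  obtain ⟨a, ha⟩ := exists_ne (1 : H)
  have := hle (Subgroup.mem_top (Pi.mulSingle j a))
  have h3 : φ (Pi.mulSingle (M := fun _ : Fin k => H) j a i) =
    Pi.mulSingle (M := fun _ : Fin k => H) j a j := this
  rw [Pi.mulSingle_eq_of_ne hij, map_one, Pi.mulSingle_eq_same] at h3
  exact ha h3.symm

theorem le_dTwo_of_isTwoGenerator_pi [Finite H] [Nontrivial H] {k : ℕ}
    (h : IsTwoGenerator (Fin k → H)) : k ≤ dTwo H := by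
  obtain ⟨x, y, hxy⟩ := h
  let e : Fin k → Quotient (autSetoid H) := fun i =>
    Quotient.mk _ ⟨(x i, y i), hxy.map (Pi.evalMonoidHom (fun _ : Fin k => H) i)
      (Function.surjective_eval i)⟩
  have he : Function.Injective e := by
    intro i j hij
    by_contra hne
    obtain ⟨φ, h1, h2⟩ := Quotient.exact hij
    exact hxy.inequivalent_of_pi inferInstance hne φ h1 h2
  simpa [dTwo] using Nat.card_le_card_of_injective e he

/-- There are inequivalent generating pairs extending a given family of inequivalent ones. -/
theorem exists_generatingPairs_extending [Finite H] {s m : ℕ}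
    (u₀ : Fin s → {p : H × H // IsGeneratingPair p.1 p.2})
    (h₀ : ∀ i j, i ≠ j → ¬ (autSetoid H).r (u₀ i) (u₀ j)) (hk : s + m ≤ dTwo H) :
    ∃ u : Fin (s + m) → {p : H × H // IsGeneratingPair p.1 p.2},
      (∀ i j, i ≠ j → ¬ (autSetoid H).r (u i) (u j)) ∧ ∀ i, u (Fin.castAdd m i) = u₀ i := by
  classical
  let Q := Quotient (autSetoid H)
  let e₀ : Fin s → Q := fun i => Quotient.mk _ (u₀ i)
  have he₀ : Function.Injective e₀ := fun i j hij => by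
    by_contra hne
    exact h₀ i j hne (Quotient.exact hij)
  have : Fintype Q := Fintype.ofFinite Q
  have hcard : m ≤ Fintype.card {c : Q // c ∉ Set.range e₀} := by
    have h1 : Fintype.card {c : Q // c ∈ Set.range e₀} = s := by
      exact (Set.card_range_of_injective he₀).trans (Fintype.card_fin s)
    rw [Fintype.card_subtype_compl, h1]
    have : dTwo H = Fintype.card Q := Nat.card_eq_fintype_card
    omega
  obtain ⟨e₁⟩ : Nonempty (Fin m ↪ {c : Q // c ∉ Set.range e₀}) :=
    Function.Embedding.nonempty_of_card_le (by simpa using hcard)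
  refine ⟨Fin.append u₀ (fun i => (e₁ i).1.out), ?_, fun i => by simp⟩
  have hinj : Function.Injective (Fin.append e₀ (fun i => (e₁ i).1)) := by
    rw [Fin.append_injective_iff]
    refine ⟨he₀, Subtype.val_injective.comp e₁.injective, fun i j h => (e₁ j).2 ⟨i, h⟩⟩
  have hmk : ∀ i, Quotient.mk (autSetoid H) (Fin.append u₀ (fun i => (e₁ i).1.out) i) =
      Fin.append e₀ (fun i => (e₁ i).1) i := by
    intro i
    refine Fin.addCases (fun i => ?_) (fun i => ?_) i
    · simp [e₀]
    · simp
  intro i j hij h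
  apply hij
  apply hinj
  rw [← hmk, ← hmk]
  exact Quotient.sound h

end Hall

/-! ### Beauville structures from pairs, and the support criterion. -/

section Criterion

/-- The homomorphism from a triangle group sending the canonical generators to `x`, `y` and
`(x * y)⁻¹`. -/
noncomputable def TriangleGroup.lift {G : Type*} [Group G] (x y : G) {l m n : ℕ} (hx : x ^ l = 1)
    (hy : y ^ m = 1) (hxy : (x * y)⁻¹ ^ n = 1) : TriangleGroup l m n →* G :=
  PresentedGroup.toGroup (f := ![x, y, (x * y)⁻¹]) (by
    rintro r (rfl | rfl | rfl | rfl) <;> simp_all)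

theorem TriangleGroup.closure_eq_range {G : Type*} [Group G] {l m n : ℕ}
    (f : TriangleGroup l m n →* G) :
    Subgroup.closure {f (genA l m n), f (genB l m n)} = f.range := by
  apply le_antisymm
  · rw [Subgroup.closure_le]
    rintro _ (rfl | rfl)
    · exact ⟨_, rfl⟩
    · exact ⟨_, rfl⟩
  · rw [MonoidHom.range_eq_map, ← PresentedGroup.closure_range_of, MonoidHom.map_closure,
      Subgroup.closure_le]
    rintro _ ⟨_, ⟨i, rfl⟩, rfl⟩
    have hA : f (genA l m n) ∈ Subgroup.closure {f (genA l m n), f (genB l m n)} :=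
      Subgroup.subset_closure (Or.inl rfl)
    have hB : f (genB l m n) ∈ Subgroup.closure {f (genA l m n), f (genB l m n)} :=
      Subgroup.subset_closure (Or.inr rfl)
    fin_cases i
    · exact hA
    · exact hB
    · have h : genA l m n * genB l m n * genC l m n = 1 :=
        PresentedGroup.one_of_mem (rels := {FreeGroup.of 0 ^ l, FreeGroup.of 1 ^ m,
          FreeGroup.of 2 ^ n, FreeGroup.of 0 * FreeGroup.of 1 * FreeGroup.of 2})
          (x := FreeGroup.of 0 * FreeGroup.of 1 * FreeGroup.of 2) (by simp)
      have h2 : f (genC l m n) = (f (genA l m n) * f (genB l m n))⁻¹ := by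
        rw [← map_mul, ← map_inv, ← inv_eq_of_mul_eq_one_right h]
      change f (genC l m n) ∈ _
      rw [h2]
      exact Subgroup.inv_mem _ (Subgroup.mul_mem _ hA hB)

theorem TriangleGroup.isGeneratingPair {G : Type*} [Group G] {l m n : ℕ}
    {f : TriangleGroup l m n →* G} (hf : Function.Surjective f) :
    IsGeneratingPair (f (genA l m n)) (f (genB l m n)) := by
  rw [IsGeneratingPair, closure_eq_range, MonoidHom.range_eq_top.2 hf]

/-- The triple with product `1` determined by a pair. -/
def tripleOf {G : Type*} [Group G] (p : G × G) : Fin 3 → G := ![p.1, p.2, (p.1 * p.2)⁻¹]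

/-- Taking the actual orders as periods makes the induced map smooth. One conjugating element
suffices in `hdisj`, since conjugators on both sides can be merged. -/
theorem isBeauvilleGroup_of_pairs {G : Type*} [Group G] [Finite G] (p₁ p₂ : G × G)
    (hp₁ : IsGeneratingPair p₁.1 p₁.2) (hp₂ : IsGeneratingPair p₂.1 p₂.2)
    (hyp₁ : TriangleGroup.IsHyperbolic (orderOf p₁.1) (orderOf p₁.2) (orderOf (p₁.1 * p₁.2)⁻¹))
    (hyp₂ : TriangleGroup.IsHyperbolic (orderOf p₂.1) (orderOf p₂.2) (orderOf (p₂.1 * p₂.2)⁻¹))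
    (hdisj : ∀ (a b : Fin 3) (r s : ℤ) (c : G),
      c * tripleOf p₁ a ^ r * c⁻¹ = tripleOf p₂ b ^ s → tripleOf p₁ a ^ r = 1) :
    IsBeauvilleGroup G := by
  let f (p : G × G) : TriangleGroup (orderOf p.1) (orderOf p.2) (orderOf (p.1 * p.2)⁻¹) →* G :=
    TriangleGroup.lift p.1 p.2 (pow_orderOf_eq_one _) (pow_orderOf_eq_one _) (pow_orderOf_eq_one _)
  have hA : ∀ p, f p (TriangleGroup.genA _ _ _) = p.1 := fun p => PresentedGroup.toGroup.of _
  have hB : ∀ p, f p (TriangleGroup.genB _ _ _) = p.2 := fun p => PresentedGroup.toGroup.of _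
  have hC : ∀ p, f p (TriangleGroup.genC _ _ _) = (p.1 * p.2)⁻¹ :=
    fun p => PresentedGroup.toGroup.of _
  have hs : ∀ p : G × G, IsGeneratingPair p.1 p.2 → TriangleGroup.IsSmoothQuotient (f p) := by
    intro p hp
    refine ⟨?_, by rw [hA], by rw [hB], by rw [hC]⟩
    rw [← MonoidHom.range_eq_top, ← TriangleGroup.closure_eq_range, hA, hB]
    exact hp
  have hsig : ∀ p g, g ∈ TriangleGroup.sigma (f p) ↔
      ∃ (a : Fin 3) (r : ℤ) (c : G), c * tripleOf p a ^ r * c⁻¹ = g := by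
    intro p g
    simp only [TriangleGroup.sigma, hA, hB, hC, Set.mem_ofPred_eq, isConj_iff]
    constructor
    · rintro ⟨d, rfl | rfl | rfl, r, c, h⟩
      · exact ⟨0, r, c, h⟩
      · exact ⟨1, r, c, h⟩
      · exact ⟨2, r, c, h⟩
    · rintro ⟨a, r, c, h⟩
      refine ⟨tripleOf p a, ?_, r, c, h⟩
      fin_cases a <;> simp [tripleOf]
  refine ⟨inferInstance, _, _, _, _, _, _, f p₁, f p₂, hyp₁, hyp₂, hs _ hp₁, hs _ hp₂, ?_⟩
  ext g
  rw [Set.mem_inter_iff, hsig, hsig, Set.mem_singleton_iff]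
  constructor
  · rintro ⟨⟨a, r, c, h⟩, b, s, c', h'⟩
    have := hdisj a b r s (c'⁻¹ * c) (by
      rw [← h'] at h
      have h2 : c * tripleOf p₁ a ^ r * c⁻¹ = c' * tripleOf p₂ b ^ s * c'⁻¹ := h
      calc c'⁻¹ * c * tripleOf p₁ a ^ r * (c'⁻¹ * c)⁻¹
          = c'⁻¹ * (c * tripleOf p₁ a ^ r * c⁻¹) * c' := by group
        _ = _ := by rw [h2]; group)
    rw [← h, this]
    simp
  · rintro rfl
    exact ⟨⟨0, 0, 1, by simp⟩, 0, 0, 1, by simp⟩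

theorem tripleOf_pi {H : Type*} [Group H] {k : ℕ} (u : Fin k → H × H) (a : Fin 3) (i : Fin k) :
    tripleOf (fun i => (u i).1, fun i => (u i).2) a i = tripleOf (u i) a := by
  fin_cases a <;> rfl

/-- Let every element of `H` have order dividing one of the pairwise coprime numbers `n j`. If `z`
is a power of prime order of an element `x` of a power of `H`, then for some `j` the support of `z`
contains the coordinates where `x` has order `n j`, and none where `x` has an order `n j'` with
`j' ≠ j`. -/
theorem exists_support_type {H : Type*} [Group H] {k : ℕ} {n : Fin 3 → ℕ}
    (hn : ∀ i j, i ≠ j → (n i).Coprime (n j)) (hcov : ∀ h : H, ∃ j, h ^ n j = 1)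
    {r : ℕ} (hr : r.Prime) {z : Fin k → H} (hz : z ≠ 1) (hzr : z ^ r = 1) :
    ∃ j, r ∣ n j ∧ ∀ (x : Fin k → H) (m : ℤ), z = x ^ m →
      (∀ i, orderOf (x i) = n j → z i ≠ 1) ∧
      (∀ i j', j' ≠ j → orderOf (x i) = n j' → z i = 1) ∧ ∃ i, ∀ j' ≠ j, orderOf (x i) ≠ n j' := by
  have hzi : ∀ i, z i ^ r = 1 := fun i => by rw [← Pi.pow_apply, hzr]; rfl
  have hone : ∀ i N, r.Coprime N → z i ^ N = 1 → z i = 1 := by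
    intro i N hN h
    rw [← orderOf_eq_one_iff]
    exact Nat.eq_one_of_dvd_coprimes hN (orderOf_dvd_of_pow_eq_one (hzi i))
      (orderOf_dvd_of_pow_eq_one h)
  obtain ⟨i₀, hi₀⟩ : ∃ i, z i ≠ 1 := by
    by_contra! h
    exact hz (funext h)
  have hr_dvd : ∀ {N}, ¬ r.Coprime N → r ∣ N := fun h => by
    by_contra h'
    exact h ((Nat.Prime.coprime_iff_not_dvd hr).2 h')
  obtain ⟨j, hj⟩ := hcov (z i₀)
  have hrj : r ∣ n j := hr_dvd fun h => hi₀ (hone _ _ h hj)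
  have hcop : ∀ j', j' ≠ j → r.Coprime (n j') := fun j' h =>
    Nat.Coprime.coprime_dvd_left hrj (hn j j' h.symm)
  refine ⟨j, hrj, fun x m hxm => ?_⟩
  have hpow : ∀ i N, x i ^ N = 1 → z i ^ N = 1 := by
    intro i N h
    rw [hxm, Pi.pow_apply, ← zpow_natCast, zpow_comm, zpow_natCast, h, one_zpow]
  have h2 : ∀ i j', j' ≠ j → orderOf (x i) = n j' → z i = 1 := fun i j' h h' =>
    hone i _ (hcop j' h) (hpow i _ (by rw [← h', pow_orderOf_eq_one]))
  -- If `z` were trivial where `x` has full order `n j`, then `n j` would divide the exponent `m`.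
  -- This kills `z` at every coordinate of `x` annihilated by `n j`; the other coordinates vanish
  -- because `r` is coprime to their exponents. Hence `z` would be `1`.
  refine ⟨fun i hi h1 => hz (funext fun i' => ?_), h2, i₀, fun j' h h' => hi₀ (h2 _ _ h h')⟩
  obtain ⟨j', hj'⟩ := hcov (x i')
  by_cases hjj : j' = j
  · subst hjj
    have hdvd : (n j' : ℤ) ∣ m := by
      rw [← hi, orderOf_dvd_iff_zpow_eq_one, ← Pi.pow_apply, ← hxm, h1]
    obtain ⟨c, rfl⟩ := hdvd
    rw [hxm, Pi.pow_apply, zpow_mul, zpow_natCast, hj', one_zpow]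
    rfl
  · exact hone i' _ (hcop j' hjj) (hpow i' _ hj')

/-- The combinatorial condition on two families of types making the supports of elements of prime
order different. -/
def TypesSeparated {s : ℕ} (full : Prop) (t₁ t₂ : Fin s → Fin 3 → Fin 3) : Prop :=
  ∀ j a b : Fin 3, (∃ i, ¬ (t₁ i a = j ↔ t₂ i b = j)) ∨ (full ∧ ∀ i, t₁ i a ≠ j)

instance {s : ℕ} (full : Prop) [Decidable full] (t₁ t₂ : Fin s → Fin 3 → Fin 3) :
    Decidable (TypesSeparated full t₁ t₂) := by unfold TypesSeparated; infer_instance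

/-- A common nontrivial element of the two sets `Σ` would have a power of prime order, conjugate to
a power of a member of each triple. Both powers have the same support and the same governing type,
which the separation of types forbids. -/
theorem isBeauvilleGroup_pi_of_types {H : Type*} [Group H] [Finite H] [IsSimpleGroup H]
    (hH : ∃ a b : H, a * b ≠ b * a) {n : Fin 3 → ℕ} (hn : ∀ i j, i ≠ j → (n i).Coprime (n j))
    (hcov : ∀ h : H, ∃ j, h ^ n j = 1) {k s : ℕ}
    (u₁ u₂ : Fin k → {p : H × H // IsGeneratingPair p.1 p.2})
    (h₁ : ∀ i j, i ≠ j → ¬ (autSetoid H).r (u₁ i) (u₁ j))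
    (h₂ : ∀ i j, i ≠ j → ¬ (autSetoid H).r (u₂ i) (u₂ j))
    (ι : Fin s → Fin k) (t₁ t₂ : Fin s → Fin 3 → Fin 3)
    (ht₁ : ∀ i a, orderOf (tripleOf (u₁ (ι i)).1 a) = n (t₁ i a))
    (ht₂ : ∀ i a, orderOf (tripleOf (u₂ (ι i)).1 a) = n (t₂ i a))
    (hsep : TypesSeparated (Function.Surjective ι) t₁ t₂)
    (hyp₁ : TriangleGroup.IsHyperbolic (orderOf fun i => (u₁ i).1.1) (orderOf fun i => (u₁ i).1.2)
      (orderOf ((fun i => (u₁ i).1.1) * fun i => (u₁ i).1.2)⁻¹))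
    (hyp₂ : TriangleGroup.IsHyperbolic (orderOf fun i => (u₂ i).1.1) (orderOf fun i => (u₂ i).1.2)
      (orderOf ((fun i => (u₂ i).1.1) * fun i => (u₂ i).1.2)⁻¹)) :
    IsBeauvilleGroup (Fin k → H) := by
  refine isBeauvilleGroup_of_pairs (fun i => (u₁ i).1.1, fun i => (u₁ i).1.2)
    (fun i => (u₂ i).1.1, fun i => (u₂ i).1.2)
    (isGeneratingPair_pi hH (fun i => (u₁ i).1) (fun i => (u₁ i).2) h₁)
    (isGeneratingPair_pi hH (fun i => (u₂ i).1) (fun i => (u₂ i).2) h₂) hyp₁ hyp₂ ?_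
  set x₁ := tripleOf (fun i => (u₁ i).1.1, fun i => (u₁ i).1.2) with hx₁
  set x₂ := tripleOf (fun i => (u₂ i).1.1, fun i => (u₂ i).1.2) with hx₂
  have e₁ : ∀ a i, x₁ a i = tripleOf (u₁ i).1 a := fun a i => tripleOf_pi (fun i => (u₁ i).1) a i
  have e₂ : ∀ a i, x₂ a i = tripleOf (u₂ i).1 a := fun a i => tripleOf_pi (fun i => (u₂ i).1) a i
  intro a b r' s' c hc
  by_contra hne
  obtain ⟨r, hr, hrd⟩ := Nat.exists_prime_and_dvd (mt orderOf_eq_one_iff.1 hne)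
  obtain ⟨m, hm⟩ := hrd
  have hz : (x₁ a ^ r') ^ m ≠ 1 := by
    intro h
    have h1 := orderOf_dvd_of_pow_eq_one h
    have h0 : 0 < orderOf (x₁ a ^ r') := orderOf_pos _
    have h2 : 0 < m := Nat.pos_of_ne_zero fun h => by rw [h, mul_zero] at hm; omega
    have h3 := Nat.le_of_dvd h2 h1
    have h4 := hr.two_le
    nlinarith
  have hzr : ((x₁ a ^ r') ^ m) ^ r = 1 := by rw [← pow_mul, mul_comm, ← hm, pow_orderOf_eq_one]
  have hw : (x₂ b ^ s') ^ m = c * (x₁ a ^ r') ^ m * c⁻¹ := by rw [← hc, conj_pow]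
  obtain ⟨j, hrj, hj⟩ := exists_support_type hn hcov hr hz hzr
  have hwne : (x₂ b ^ s') ^ m ≠ 1 := by
    rw [hw]
    intro h
    exact hz (by rwa [conj_eq_one_iff] at h)
  have hwr : ((x₂ b ^ s') ^ m) ^ r = 1 := by rw [hw, conj_pow, hzr]; simp
  obtain ⟨j₂, hrj₂, hj₂⟩ := exists_support_type hn hcov hr hwne hwr
  have hsupp : ∀ i, ((x₁ a ^ r') ^ m) i = 1 ↔ ((x₂ b ^ s') ^ m) i = 1 := by
    intro i
    rw [hw, Pi.mul_apply, Pi.mul_apply, Pi.inv_apply, conj_eq_one_iff]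
  -- The prime `r` divides both `n j₂` and `n j`, which are coprime unless the types agree.
  obtain rfl : j₂ = j := by
    by_contra h
    exact hr.one_lt.ne' (Nat.eq_one_of_dvd_coprimes (hn _ _ h) hrj₂ hrj)
  obtain ⟨p1, p2, i₀, p3⟩ := hj (x₁ a) (r' * m) (by rw [zpow_mul, zpow_natCast])
  obtain ⟨q1, q2, -⟩ := hj₂ (x₂ b) (s' * m) (by rw [zpow_mul, zpow_natCast])
  -- Either a listed coordinate lies in exactly one of the two supports, or every coordinate is
  -- listed and none has type `j₂` in the first triple, so that no coordinate is left for `i₀`.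
  rcases hsep j₂ a b with ⟨i, hi⟩ | ⟨hfull, hall⟩
  · have o₁ := (congrArg orderOf (e₁ a (ι i))).trans (ht₁ i a)
    have o₂ := (congrArg orderOf (e₂ b (ι i))).trans (ht₂ i b)
    have hs := hsupp (ι i)
    by_cases h1 : t₁ i a = j₂
    · have h2 : t₂ i b ≠ j₂ := fun h => hi (by simp [h1, h])
      exact p1 _ (by rw [o₁, h1]) (hs.2 (q2 _ _ h2 o₂))
    · have h2 : t₂ i b = j₂ := by
        by_contra h
        exact hi (by simp [h1, h])
      exact q1 _ (by rw [o₂, h2]) (hs.1 (p2 _ _ h1 o₁))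
  · obtain ⟨i, rfl⟩ := hfull i₀
    exact p3 _ (hall i) ((congrArg orderOf (e₁ a (ι i))).trans (ht₁ i a))

end Criterion

/-! ### Lists of types whose supports are always different. -/

section Designs

/-- Some generating pair of `H` gives a triple of elements with orders `n (t 0)`, `n (t 1)`,
`n (t 2)`. -/
def Realizes (H : Type*) [Group H] (n : Fin 3 → ℕ) (t : Fin 3 → Fin 3) : Prop :=
  ∃ p : {p : H × H // IsGeneratingPair p.1 p.2}, ∀ a, orderOf (tripleOf p.1 a) = n (t a)

variable {H : Type*} [Group H] {n : Fin 3 → ℕ}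

theorem Realizes.of_pair {x y : H} (h : IsGeneratingPair x y) {t₀ t₁ t₂ : Fin 3}
    (h₀ : orderOf x = n t₀) (h₁ : orderOf y = n t₁) (h₂ : orderOf (x * y) = n t₂) :
    Realizes H n ![t₀, t₁, t₂] := by
  refine ⟨⟨(x, y), h⟩, fun a => ?_⟩
  fin_cases a
  · exact h₀
  · exact h₁
  · exact (orderOf_inv _).trans h₂

/-- Triples with product `1` are stable under cyclic shifts: the product of `y` and `(x * y)⁻¹` is
conjugation-free equal to `x⁻¹`. -/
theorem Realizes.rotate {t₀ t₁ t₂ : Fin 3} (h : Realizes H n ![t₀, t₁, t₂]) :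
    Realizes H n ![t₁, t₂, t₀] := by
  obtain ⟨⟨⟨x, y⟩, hg⟩, h⟩ := h
  refine Realizes.of_pair (x := y) (y := (x * y)⁻¹) ?_ (h 1) (h 2) ?_
  · rw [IsGeneratingPair, eq_top_iff]
    refine le_trans (le_of_eq (Eq.symm hg)) ?_
    rw [Subgroup.closure_le]
    have hy : y ∈ Subgroup.closure {y, (x * y)⁻¹} := Subgroup.subset_closure (Or.inl rfl)
    have hz : (x * y)⁻¹ ∈ Subgroup.closure {y, (x * y)⁻¹} := Subgroup.subset_closure (Or.inr rfl)
    rintro _ (rfl | rfl)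
    · have := Subgroup.inv_mem _ (Subgroup.mul_mem _ hy hz)
      simpa using this
    · exact hy
  · rw [mul_inv_rev, mul_inv_cancel_left, orderOf_inv]
    exact h 0

theorem Realizes.map {G : Type*} [Group G] {t : Fin 3 → Fin 3} (h : Realizes H n t)
    (e : H ≃* G) : Realizes G n t := by
  obtain ⟨⟨⟨x, y⟩, hg⟩, h⟩ := h
  refine ⟨⟨(e x, e y), hg.map e.toMonoidHom e.surjective⟩, fun a => ?_⟩
  have : tripleOf (e x, e y) a = e (tripleOf (x, y) a) := by
    fin_cases a <;> simp [tripleOf]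
  rw [this, MulEquiv.orderOf_eq]
  exact h a

theorem TriangleGroup.IsHyperbolic.mono {l m n l' m' n' : ℕ} (h : IsHyperbolic l m n)
    (hl : l ≤ l') (hm : m ≤ m') (hn : n ≤ n') : IsHyperbolic l' m' n' := by
  obtain ⟨h1, h2, h3, h⟩ := h
  refine ⟨by omega, by omega, by omega, lt_of_le_of_lt ?_ h⟩
  gcongr

/-- The `s` prescribed coordinates are inequivalent because their types differ; the other `m` are
filled with arbitrary unused orbits. The argument `m = 0` of `TypesSeparated` reflects that absence
of a type is known only when nothing is filled in. Orders in the power are at least the orders in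
any coordinate, so hyperbolicity may be read off from a coordinate `f a` chosen separately for each
position `a`. -/
theorem isBeauvilleGroup_pi_of_realizes [Finite H] [IsSimpleGroup H]
    (hH : ∃ a b : H, a * b ≠ b * a) (hn : ∀ i j, i ≠ j → (n i).Coprime (n j))
    (hn1 : ∀ j, n j ≠ 1) (hcov : ∀ h : H, ∃ j, h ^ n j = 1) {s m : ℕ} (hk : s + m ≤ dTwo H)
    (t₁ t₂ : Fin s → Fin 3 → Fin 3) (hinj₁ : Function.Injective t₁) (hinj₂ : Function.Injective t₂)
    (ht₁ : ∀ i, Realizes H n (t₁ i)) (ht₂ : ∀ i, Realizes H n (t₂ i))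
    (hsep : TypesSeparated (m = 0) t₁ t₂)
    (hyp₁ : ∃ f : Fin 3 → Fin s,
      TriangleGroup.IsHyperbolic (n (t₁ (f 0) 0)) (n (t₁ (f 1) 1)) (n (t₁ (f 2) 2)))
    (hyp₂ : ∃ f : Fin 3 → Fin s,
      TriangleGroup.IsHyperbolic (n (t₂ (f 0) 0)) (n (t₂ (f 1) 1)) (n (t₂ (f 2) 2))) :
    IsBeauvilleGroup (Fin (s + m) → H) := by
  have ninj : Function.Injective n := by
    intro i j hij
    by_contra hne
    have := hn i j hne
    rw [hij, Nat.coprime_self] at this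
    exact hn1 _ this
  have key : ∀ t : Fin s → Fin 3 → Fin 3, Function.Injective t → (∀ i, Realizes H n (t i)) →
      (∃ f : Fin 3 → Fin s,
        TriangleGroup.IsHyperbolic (n (t (f 0) 0)) (n (t (f 1) 1)) (n (t (f 2) 2))) →
      ∃ u : Fin (s + m) → {p : H × H // IsGeneratingPair p.1 p.2},
        (∀ i j, i ≠ j → ¬ (autSetoid H).r (u i) (u j)) ∧
        (∀ i a, orderOf (tripleOf (u (Fin.castAdd m i)).1 a) = n (t i a)) ∧
        TriangleGroup.IsHyperbolic (orderOf fun i => (u i).1.1) (orderOf fun i => (u i).1.2)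
          (orderOf ((fun i => (u i).1.1) * fun i => (u i).1.2)⁻¹) := by
    intro t hinj ht hyp
    choose u₀ hu₀ using ht
    obtain ⟨u, hu, hext⟩ := exists_generatingPairs_extending u₀ (fun i j hij h => by
      obtain ⟨φ, h1, h2⟩ := h
      apply hij
      apply hinj
      funext a
      apply ninj
      rw [← hu₀, ← hu₀]
      have : tripleOf (u₀ j).1 a = φ (tripleOf (u₀ i).1 a) := by
        fin_cases a
        · exact h1.symm
        · exact h2.symm
        · simp [tripleOf, ← h1, ← h2]
      rw [this, MulEquiv.orderOf_eq]) hk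
    have hty : ∀ i a, orderOf (tripleOf (u (Fin.castAdd m i)).1 a) = n (t i a) := fun i a => by
      rw [hext, hu₀]
    refine ⟨u, hu, hty, ?_⟩
    obtain ⟨f, hf⟩ := hyp
    have hle : ∀ (x : Fin (s + m) → H) (a : Fin 3),
        (∀ i, x i = tripleOf (u i).1 a) → n (t (f a) a) ≤ orderOf x := by
      intro x a hx
      rw [← hty, ← hx]
      exact Nat.le_of_dvd (orderOf_pos _)
        (orderOf_map_dvd (Pi.evalMonoidHom (fun _ : Fin (s + m) => H) (Fin.castAdd m (f a))) x)
    exact hf.mono (hle _ 0 fun _ => rfl) (hle _ 1 fun _ => rfl) (hle _ 2 fun _ => rfl)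
  obtain ⟨u₁, h₁, o₁, y₁⟩ := key t₁ hinj₁ ht₁ hyp₁
  obtain ⟨u₂, h₂, o₂, y₂⟩ := key t₂ hinj₂ ht₂ hyp₂
  refine isBeauvilleGroup_pi_of_types hH hn hcov u₁ u₂ h₁ h₂ (Fin.castAdd m) t₁ t₂ o₁ o₂ ?_ y₁ y₂
  intro j a b
  refine (hsep j a b).imp_right fun h => ⟨?_, h.2⟩
  obtain rfl := h.1
  exact fun i => ⟨i, rfl⟩

/-- The six orderings of three types. -/
def latinTypes : Fin 6 → Fin 3 → Fin 3 :=
  ![![0, 1, 2], ![2, 0, 1], ![1, 2, 0], ![1, 0, 2], ![2, 1, 0], ![0, 2, 1]]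

/-- Another list of the six orderings of three types, matched with `latinTypes`. -/
def latinTypes' : Fin 6 → Fin 3 → Fin 3 :=
  ![![0, 1, 2], ![2, 0, 1], ![1, 2, 0], ![0, 2, 1], ![1, 0, 2], ![2, 1, 0]]

theorem TriangleGroup.isHyperbolic_of_four_le {l m n : ℕ} (hl : 4 ≤ l) (hm : 4 ≤ m) (hn : 4 ≤ n) :
    IsHyperbolic l m n :=
  IsHyperbolic.mono (l := 4) (m := 4) (n := 4) ⟨by norm_num, by norm_num, by norm_num, by norm_num⟩
    hl hm hn

theorem realizes_permutations (h₁ : Realizes H n ![0, 1, 2]) (h₂ : Realizes H n ![1, 0, 2]) :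
    (∀ i, Realizes H n (latinTypes i)) ∧ ∀ i, Realizes H n (latinTypes' i) := by
  constructor <;> intro i <;> fin_cases i <;>
  first
  | exact h₁ | exact h₁.rotate | exact h₁.rotate.rotate
  | exact h₂ | exact h₂.rotate | exact h₂.rotate.rotate

/-- Powers with at least six factors. -/
theorem isBeauvilleGroup_pi_of_six_le [Finite H] [IsSimpleGroup H]
    (hH : ∃ a b : H, a * b ≠ b * a) (hn : ∀ i j, i ≠ j → (n i).Coprime (n j))
    (hn1 : ∀ j, n j ≠ 1) (hcov : ∀ h : H, ∃ j, h ^ n j = 1) {j₀ : Fin 3} (hj₀ : 4 ≤ n j₀)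
    (h₁ : Realizes H n ![0, 1, 2]) (h₂ : Realizes H n ![1, 0, 2])
    {k : ℕ} (hk : k ≤ dTwo H) (hk6 : 6 ≤ k) : IsBeauvilleGroup (Fin k → H) := by
  obtain ⟨m, rfl⟩ := Nat.exists_eq_add_of_le hk6
  have hyp : ∀ t : Fin 6 → Fin 3 → Fin 3, (∀ a : Fin 3, ∃ i, t i a = j₀) → ∃ f : Fin 3 → Fin 6,
      TriangleGroup.IsHyperbolic (n (t (f 0) 0)) (n (t (f 1) 1)) (n (t (f 2) 2)) := by
    intro t ht
    choose f hf using ht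
    exact ⟨f, by rw [hf, hf, hf]; exact TriangleGroup.isHyperbolic_of_four_le hj₀ hj₀ hj₀⟩
  -- In either list each type occupies, in each column, a pair of rows, and no pair arising from the
  -- first list recurs for the same type in the second. As `False` is used, the filler coordinates
  -- do not matter.
  have hsep : TypesSeparated False latinTypes latinTypes' := by decide
  refine isBeauvilleGroup_pi_of_realizes hH hn hn1 hcov hk latinTypes latinTypes' (by decide)
    (by decide) (realizes_permutations h₁ h₂).1 (realizes_permutations h₁ h₂).2
    (fun j a b => (hsep j a b).imp_right fun h => h.1.elim) (hyp _ ?_) (hyp _ ?_)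
  · clear hyp hj₀
    revert j₀
    decide
  · clear hyp hj₀
    revert j₀
    decide

/-- All powers, when there are triples of the types `(0, 0, 2)` and `(1, 1, 1)`. -/
theorem isBeauvilleGroup_pi_of_main_types [Finite H] [IsSimpleGroup H]
    (hH : ∃ a b : H, a * b ≠ b * a) (hn : ∀ i j, i ≠ j → (n i).Coprime (n j))
    (hn1 : ∀ j, n j ≠ 1) (hcov : ∀ h : H, ∃ j, h ^ n j = 1) (hn4 : 4 ≤ n 1)
    (hyp : TriangleGroup.IsHyperbolic (n 0) (n 0) (n 2))
    (h₁ : Realizes H n ![0, 1, 2]) (h₂ : Realizes H n ![1, 0, 2])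
    (h₃ : Realizes H n ![0, 0, 2]) (h₄ : Realizes H n ![1, 1, 1])
    {k : ℕ} (hk : k ≤ dTwo H) (hk1 : 1 ≤ k) : IsBeauvilleGroup (Fin k → H) := by
  rcases le_or_gt 6 k with hk6 | hk6
  · exact isBeauvilleGroup_pi_of_six_le hH hn hn1 hcov hn4 h₁ h₂ hk hk6
  have h444 := TriangleGroup.isHyperbolic_of_four_le hn4 hn4 hn4
  have h₅ := h₃.rotate
  have h₆ := h₅.rotate
  have hyp' : TriangleGroup.IsHyperbolic (n 0) (n 2) (n 0) := by
    obtain ⟨a, b, c, h⟩ := hyp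
    exact ⟨a, c, b, by linarith⟩
  -- For fewer than six factors there is no filler (`m = 0`), so a type may also be separated by its
  -- complete absence from a column of the first list.
  interval_cases k
  · exact isBeauvilleGroup_pi_of_realizes (m := 0) hH hn hn1 hcov hk ![![0, 0, 2]] ![![1, 1, 1]]
      (by decide) (by decide) (by simpa using h₃) (by simpa using h₄) (by decide)
      ⟨![0, 0, 0], hyp⟩ ⟨![0, 0, 0], h444⟩
  · exact isBeauvilleGroup_pi_of_realizes (m := 0) hH hn hn1 hcov hk ![![0, 0, 2], ![1, 1, 1]]
      ![![1, 1, 1], ![0, 0, 2]] (by decide) (by decide)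
      (by simpa [Fin.forall_fin_succ] using ⟨h₃, h₄⟩)
      (by simpa [Fin.forall_fin_succ] using ⟨h₄, h₃⟩) (by decide)
      ⟨![0, 0, 0], hyp⟩ ⟨![0, 0, 0], h444⟩
  · exact isBeauvilleGroup_pi_of_realizes (m := 0) hH hn hn1 hcov hk
      ![![0, 0, 2], ![1, 1, 1], ![0, 1, 2]]
      ![![1, 1, 1], ![0, 0, 2], ![0, 1, 2]] (by decide) (by decide)
      (by simpa [Fin.forall_fin_succ] using ⟨h₃, h₄, h₁⟩)
      (by simpa [Fin.forall_fin_succ] using ⟨h₄, h₃, h₁⟩) (by decide)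
      ⟨![0, 0, 0], hyp⟩ ⟨![0, 0, 0], h444⟩
  · exact isBeauvilleGroup_pi_of_realizes (m := 0) hH hn hn1 hcov hk
      ![![0, 0, 2], ![0, 2, 0], ![2, 0, 0], ![0, 1, 2]]
      ![![0, 2, 0], ![0, 0, 2], ![0, 1, 2], ![2, 0, 0]] (by decide) (by decide)
      (by simpa [Fin.forall_fin_succ] using ⟨h₃, h₅, h₆, h₁⟩)
      (by simpa [Fin.forall_fin_succ] using ⟨h₅, h₃, h₁, h₆⟩) (by decide)
      ⟨![0, 0, 0], hyp⟩ ⟨![0, 0, 0], hyp'⟩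
  · exact isBeauvilleGroup_pi_of_realizes (m := 0) hH hn hn1 hcov hk
      ![![0, 0, 2], ![0, 2, 0], ![2, 0, 0], ![1, 1, 1], ![0, 1, 2]]
      ![![0, 0, 2], ![1, 1, 1], ![0, 1, 2], ![0, 2, 0], ![2, 0, 0]] (by decide) (by decide)
      (by simpa [Fin.forall_fin_succ] using ⟨h₃, h₅, h₆, h₄, h₁⟩)
      (by simpa [Fin.forall_fin_succ] using ⟨h₃, h₄, h₁, h₅, h₆⟩) (by decide)
      ⟨![0, 0, 0], hyp⟩ ⟨![0, 0, 0], hyp⟩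

end Designs

/-! ### The alternating group of degree five and its powers. -/

section AlternatingFive

local notation "A₅" => alternatingGroup (Fin 5)

set_option maxRecDepth 100000 in
theorem alternatingGroup_five_pow_eq_one : ∀ h : A₅, h ^ 2 = 1 ∨ h ^ 3 = 1 ∨ h ^ 5 = 1 := by
  decide

theorem natCard_alternatingGroup_five : Nat.card A₅ = 60 := by
  rw [nat_card_alternatingGroup]
  simp [Nat.factorial]

theorem isSimpleGroup_alternatingGroup_five : IsSimpleGroup A₅ :=
  alternatingGroup.isSimpleGroup (by simp)

/-- The order of `K` is divisible by 30, so its index is 1 or 2, and a simple group of order 60 has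
no subgroup of index 2. -/
theorem alternatingGroup_five_eq_top {K : Subgroup A₅} {a b c : A₅} (ha : a ∈ K) (hb : b ∈ K)
    (hc : c ∈ K) (ha2 : orderOf a = 2) (hb3 : orderOf b = 3) (hc5 : orderOf c = 5) : K = ⊤ := by
  have := isSimpleGroup_alternatingGroup_five
  have h2 := ha2 ▸ K.orderOf_dvd_natCard ha
  have h3 := hb3 ▸ K.orderOf_dvd_natCard hb
  have h5 := hc5 ▸ K.orderOf_dvd_natCard hc
  have h6 := Nat.Coprime.mul_dvd_of_dvd_of_dvd (by norm_num) h2 h3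
  obtain ⟨m, hm⟩ := Nat.Coprime.mul_dvd_of_dvd_of_dvd (by norm_num) h6 h5
  have hidx := K.card_mul_index
  rw [natCard_alternatingGroup_five, hm] at hidx
  have h2 : m * K.index = 2 := by linarith
  have hK : K.index ∣ 2 := ⟨m, by linarith⟩
  rcases (Nat.dvd_prime Nat.prime_two).1 hK with h | h
  · exact Subgroup.index_eq_one.1 h
  · have hn := Subgroup.normal_of_index_eq_two h
    rcases hn.eq_bot_or_eq_top with h' | h'
    · rw [h', Subgroup.index_bot, natCard_alternatingGroup_five] at h
      omega
    · exact h'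

theorem isGeneratingPair_alternatingGroup_five {x y a b c : A₅}
    (ha : a ∈ Subgroup.closure {x, y}) (hb : b ∈ Subgroup.closure {x, y})
    (hc : c ∈ Subgroup.closure {x, y}) (ha2 : a ^ 2 = 1) (hb3 : b ^ 3 = 1) (hc5 : c ^ 5 = 1)
    (ha1 : a ≠ 1) (hb1 : b ≠ 1) (hc1 : c ≠ 1) : IsGeneratingPair x y :=
  alternatingGroup_five_eq_top ha hb hc (orderOf_eq_prime ha2 ha1) (orderOf_eq_prime hb3 hb1)
    (have := Fact.mk Nat.prime_five; orderOf_eq_prime hc5 hc1)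

/-- The elements `a`, `b`, `c` are words in `x` and `y` whose orders certify generation; everything
else is left to `decide`. -/
theorem Realizes.alternatingGroup_five {x y a b c : A₅}
    (ha : a ∈ Subgroup.closure {x, y}) (hb : b ∈ Subgroup.closure {x, y})
    (hc : c ∈ Subgroup.closure {x, y}) (habc : a ^ 2 = 1 ∧ b ^ 3 = 1 ∧ c ^ 5 = 1 ∧
      a ≠ 1 ∧ b ≠ 1 ∧ c ≠ 1) {t₀ t₁ t₂ : Fin 3}
    (ht : (x ^ (![2, 3, 5] t₀) = 1 ∧ y ^ (![2, 3, 5] t₁) = 1 ∧ (x * y) ^ (![2, 3, 5] t₂) = 1) ∧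
      x ≠ 1 ∧ y ≠ 1 ∧ x * y ≠ 1) : Realizes A₅ ![2, 3, 5] ![t₀, t₁, t₂] := by
  have hp : ∀ t : Fin 3, (![2, 3, 5] t).Prime := by
    intro t; fin_cases t <;> norm_num
  have ho : ∀ (t : Fin 3) (g : A₅), g ^ (![2, 3, 5] t) = 1 → g ≠ 1 → orderOf g = ![2, 3, 5] t :=
    fun t g h h1 => have := Fact.mk (hp t); orderOf_eq_prime h h1
  exact .of_pair (isGeneratingPair_alternatingGroup_five ha hb hc habc.1 habc.2.1 habc.2.2.1
    habc.2.2.2.1 habc.2.2.2.2.1 habc.2.2.2.2.2) (ho _ _ ht.1.1 ht.2.1) (ho _ _ ht.1.2.1 ht.2.2.1)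
    (ho _ _ ht.1.2.2 ht.2.2.2)

open Equiv in
set_option maxRecDepth 10000 in
theorem realizes_alternatingGroup_five :
    Realizes A₅ ![2, 3, 5] ![0, 1, 2] ∧ Realizes A₅ ![2, 3, 5] ![1, 0, 2] ∧
    Realizes A₅ ![2, 3, 5] ![0, 2, 2] ∧ Realizes A₅ ![2, 3, 5] ![1, 2, 2] ∧
    Realizes A₅ ![2, 3, 5] ![1, 1, 2] := by
  let v : A₅ := ⟨swap 1 2 * swap 3 4, Equiv.Perm.mem_alternatingGroup.2 (by decide)⟩
  let t : A₅ := ⟨swap 2 3 * swap 3 4, Equiv.Perm.mem_alternatingGroup.2 (by decide)⟩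
  refine ⟨?_, ?_, ?_, ?_, ?_⟩
  · let y : A₅ := ⟨swap 0 1 * swap 1 3, Equiv.Perm.mem_alternatingGroup.2 (by decide)⟩
    have hx : v ∈ Subgroup.closure {v, y} := Subgroup.subset_closure (by simp)
    have hy : y ∈ Subgroup.closure {v, y} := Subgroup.subset_closure (by simp)
    exact .alternatingGroup_five hx hy (mul_mem hx hy) (by decide) (by decide)
  · let y : A₅ := ⟨swap 0 2 * swap 1 3, Equiv.Perm.mem_alternatingGroup.2 (by decide)⟩
    have hx : t ∈ Subgroup.closure {t, y} := Subgroup.subset_closure (by simp)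
    have hy : y ∈ Subgroup.closure {t, y} := Subgroup.subset_closure (by simp)
    exact .alternatingGroup_five hy hx (mul_mem hx hy) (by decide) (by decide)
  · let y : A₅ := ⟨swap 0 1 * swap 1 3 * swap 3 2 * swap 2 4, Equiv.Perm.mem_alternatingGroup.2 (by decide)⟩
    have hx : v ∈ Subgroup.closure {v, y} := Subgroup.subset_closure (by simp)
    have hy : y ∈ Subgroup.closure {v, y} := Subgroup.subset_closure (by simp)
    exact .alternatingGroup_five hx (mul_mem (mul_mem hx hy) hy) hy (by decide) (by decide)
  · let y : A₅ := ⟨swap 0 1 * swap 1 2 * swap 2 3 * swap 3 4, Equiv.Perm.mem_alternatingGroup.2 (by decide)⟩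
    have hx : t ∈ Subgroup.closure {t, y} := Subgroup.subset_closure (by simp)
    have hy : y ∈ Subgroup.closure {t, y} := Subgroup.subset_closure (by simp)
    exact .alternatingGroup_five (mul_mem (mul_mem hx hy) hy) hx hy (by decide) (by decide)
  · let y : A₅ := ⟨swap 0 1 * swap 1 2, Equiv.Perm.mem_alternatingGroup.2 (by decide)⟩
    have hx : t ∈ Subgroup.closure {t, y} := Subgroup.subset_closure (by simp)
    have hy : y ∈ Subgroup.closure {t, y} := Subgroup.subset_closure (by simp)
    exact .alternatingGroup_five (mul_mem (mul_mem (mul_mem (mul_mem hx hx) hy) hx) hy) hx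
      (mul_mem hx hy) (by decide) (by decide)

/-- The proper powers of `A₅` with two generators are Beauville groups. -/
theorem isBeauvilleGroup_pi_alternatingGroup_five {H : Type*} [Group H] (e : A₅ ≃* H)
    {k : ℕ} (hk : k ≤ dTwo H) (hk2 : 2 ≤ k) : IsBeauvilleGroup (Fin k → H) := by
  have := isSimpleGroup_alternatingGroup_five
  have : IsSimpleGroup H := e.symm.isSimpleGroup
  have : Finite H := Finite.of_equiv _ e.toEquiv
  have hH : ∃ a b : H, a * b ≠ b * a := by
    let a : A₅ := ⟨Equiv.swap 0 1 * Equiv.swap 1 2, Equiv.Perm.mem_alternatingGroup.2 (by decide)⟩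
    let b : A₅ := ⟨Equiv.swap 1 2 * Equiv.swap 2 3, Equiv.Perm.mem_alternatingGroup.2 (by decide)⟩
    refine ⟨e a, e b, ?_⟩
    rw [← map_mul, ← map_mul, e.injective.ne_iff]
    decide
  have hn : ∀ i j : Fin 3, i ≠ j → (![2, 3, 5] i).Coprime (![2, 3, 5] j) := by decide
  have hn1 : ∀ j : Fin 3, ![2, 3, 5] j ≠ 1 := by decide
  have hcov : ∀ h : H, ∃ j : Fin 3, h ^ ![2, 3, 5] j = 1 := by
    intro h
    have hpow : ∀ m : ℕ, e.symm h ^ m = 1 → h ^ m = 1 := fun m hm => by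
      rw [← map_pow] at hm
      exact (map_eq_one_iff _ e.symm.injective).1 hm
    rcases alternatingGroup_five_pow_eq_one (e.symm h) with h' | h' | h'
    · exact ⟨0, hpow _ h'⟩
    · exact ⟨1, hpow _ h'⟩
    · exact ⟨2, hpow _ h'⟩
  obtain ⟨h₁, h₂, h₃, h₄, h₅⟩ := realizes_alternatingGroup_five
  replace h₁ := h₁.map e
  replace h₂ := h₂.map e
  replace h₃ := h₃.map e
  replace h₄ := h₄.map e
  replace h₅ := h₅.map e
  rcases le_or_gt 6 k with hk6 | hk6
  · exact isBeauvilleGroup_pi_of_six_le hH hn hn1 hcov (j₀ := 2) (by decide) h₁ h₂ hk hk6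
  have hyp355 : TriangleGroup.IsHyperbolic 3 5 5 :=
    ⟨by norm_num, by norm_num, by norm_num, by norm_num⟩
  have hyp535 : TriangleGroup.IsHyperbolic 5 3 5 :=
    ⟨by norm_num, by norm_num, by norm_num, by norm_num⟩
  -- Each list extends the two coordinates of the case `k = 2` by types common to both lists.
  -- Hyperbolicity uses `(3, 5, 5)` and `(5, 3, 5)`, collected from two different coordinates.
  interval_cases k
  · exact isBeauvilleGroup_pi_of_realizes (m := 0) hH hn hn1 hcov hk
      ![![0, 2, 2], ![1, 2, 2]] ![![1, 1, 2], ![2, 1, 0]] (by decide) (by decide)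
      (by simpa [Fin.forall_fin_succ] using ⟨h₃, h₄⟩)
      (by simpa [Fin.forall_fin_succ] using ⟨h₅, h₂.rotate.rotate.map (.refl _)⟩) (by decide)
      ⟨![1, 0, 0], hyp355⟩ ⟨![1, 0, 0], hyp535⟩
  · exact isBeauvilleGroup_pi_of_realizes (m := 0) hH hn hn1 hcov hk
      ![![0, 2, 2], ![1, 2, 2], ![0, 1, 2]] ![![1, 1, 2], ![2, 1, 0], ![0, 1, 2]]
      (by decide) (by decide)
      (by simpa [Fin.forall_fin_succ] using ⟨h₃, h₄, h₁⟩)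
      (by simpa [Fin.forall_fin_succ] using ⟨h₅, h₂.rotate.rotate, h₁⟩) (by decide)
      ⟨![1, 0, 0], hyp355⟩ ⟨![1, 0, 0], hyp535⟩
  · exact isBeauvilleGroup_pi_of_realizes (m := 0) hH hn hn1 hcov hk
      ![![0, 2, 2], ![1, 2, 2], ![0, 1, 2], ![1, 2, 0]]
      ![![1, 1, 2], ![2, 1, 0], ![0, 1, 2], ![1, 2, 0]]
      (by decide) (by decide)
      (by simpa [Fin.forall_fin_succ] using ⟨h₃, h₄, h₁, h₁.rotate⟩)
      (by simpa [Fin.forall_fin_succ] using ⟨h₅, h₂.rotate.rotate, h₁, h₁.rotate⟩) (by decide)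
      ⟨![1, 0, 0], hyp355⟩ ⟨![1, 0, 0], hyp535⟩
  · exact isBeauvilleGroup_pi_of_realizes (m := 0) hH hn hn1 hcov hk
      ![![0, 2, 2], ![1, 2, 2], ![0, 1, 2], ![1, 2, 0], ![2, 1, 2]]
      ![![1, 1, 2], ![2, 1, 0], ![0, 1, 2], ![1, 2, 0], ![2, 1, 2]]
      (by decide) (by decide)
      (by simpa [Fin.forall_fin_succ] using ⟨h₃, h₄, h₁, h₁.rotate, h₄.rotate.rotate⟩)
      (by simpa [Fin.forall_fin_succ] using ⟨h₅, h₂.rotate.rotate, h₁, h₁.rotate, h₄.rotate.rotate⟩)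
      (by decide) ⟨![1, 0, 0], hyp355⟩ ⟨![1, 0, 0], hyp535⟩

/-- Element orders other than 5 are at most 3, and `(3, 3, 3)` already has reciprocal sum 1. -/
theorem TriangleGroup.IsHyperbolic.exists_five {G : Type*} [Group G] (e : G ≃* A₅) {x y z : G} {l m n : ℕ}
    (h : IsHyperbolic l m n) (hl : orderOf x = l) (hm : orderOf y = m) (hn : orderOf z = n) :
    ∃ d, (d = x ∨ d = y ∨ d = z) ∧ orderOf d = 5 := by
  subst hl hm hn
  have key : ∀ d : G, orderOf d = 5 ∨ orderOf d ≤ 3 := by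
    intro d
    rcases alternatingGroup_five_pow_eq_one (e d) with h' | h' | h'
    · rw [← MulEquiv.orderOf_eq e]
      exact Or.inr ((orderOf_le_of_pow_eq_one (by norm_num) h').trans (by norm_num))
    · rw [← MulEquiv.orderOf_eq e]
      exact Or.inr (orderOf_le_of_pow_eq_one (by norm_num) h')
    · rw [← MulEquiv.orderOf_eq e]
      rcases (Nat.dvd_prime Nat.prime_five).1 (orderOf_dvd_of_pow_eq_one h') with h | h <;> omega
  rcases key x with hx | hx
  · exact ⟨x, by simp, hx⟩
  rcases key y with hy | hy
  · exact ⟨y, by simp, hy⟩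
  rcases key z with hz | hz
  · exact ⟨z, by simp, hz⟩
  obtain ⟨-, -, -, h⟩ := h.mono hx hy hz
  norm_num at h

/-- As 5 divides 60 exactly once, the two cyclic groups are Sylow 5-subgroups, hence conjugate. -/
theorem exists_conj_eq_zpow_of_orderOf_eq_five {G : Type*} [Group G] (hG : Nat.card G = 60)
    {g g' : G} (hg : orderOf g = 5) (hg' : orderOf g' = 5) :
    ∃ (c : G) (s : ℤ), c * g * c⁻¹ = g' ^ s := by
  have : Finite G := Nat.finite_of_card_ne_zero (by omega)
  have : Fact (Nat.Prime 5) := ⟨Nat.prime_five⟩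
  have hfac : 5 ^ (Nat.card G).factorization 5 = 5 := by
    rw [hG, Nat.factorization_def _ Nat.prime_five,
      show (60 : ℕ) = 5 ^ 1 * 12 by norm_num, padicValNat.mul (by norm_num) (by norm_num),
      padicValNat.prime_pow, padicValNat.eq_zero_of_not_dvd (by norm_num)]
    norm_num
  let P : Sylow 5 G := Sylow.ofCard (Subgroup.zpowers g) (by rw [Nat.card_zpowers, hg, hfac])
  let P' : Sylow 5 G := Sylow.ofCard (Subgroup.zpowers g') (by rw [Nat.card_zpowers, hg', hfac])
  obtain ⟨c, hc⟩ := MulAction.exists_smul_eq G P P'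
  have h1 : c * g * c⁻¹ ∈ (c • P : Sylow 5 G) := by
    rw [← SetLike.mem_coe, Sylow.coe_smul, ← MulAut.conj_apply, ← MulAut.smul_def]
    exact Set.smul_mem_smul_set (Subgroup.mem_zpowers g)
  rw [hc] at h1
  obtain ⟨s, hs⟩ := Subgroup.mem_zpowers_iff.1 (show c * g * c⁻¹ ∈ Subgroup.zpowers g' from h1)
  exact ⟨c, s, hs.symm⟩

theorem not_isBeauvilleGroup_of_alternatingGroup_five {G : Type*} [Group G] (e : G ≃* A₅) :
    ¬ IsBeauvilleGroup G := by
  rintro ⟨-, l₁, m₁, n₁, l₂, m₂, n₂, f₁, f₂, h₁, h₂, ⟨-, a₁, b₁, c₁⟩, ⟨-, a₂, b₂, c₂⟩, hsig⟩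
  have hG : Nat.card G = 60 := by rw [Nat.card_congr e.toEquiv, natCard_alternatingGroup_five]
  obtain ⟨g, hg, hg5⟩ := h₁.exists_five e a₁ b₁ c₁
  obtain ⟨g', hg', hg5'⟩ := h₂.exists_five e a₂ b₂ c₂
  obtain ⟨c, s, hc⟩ := exists_conj_eq_zpow_of_orderOf_eq_five hG hg5 hg5'
  have hmem : c * g * c⁻¹ ∈ TriangleGroup.sigma f₁ ∩ TriangleGroup.sigma f₂ :=
    ⟨⟨g, hg, 1, by rw [zpow_one, isConj_iff]; exact ⟨c, rfl⟩⟩, ⟨g', hg', s, by rw [hc]⟩⟩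
  rw [hsig, Set.mem_singleton_iff, conj_eq_one_iff] at hmem
  rw [hmem, orderOf_one] at hg5
  omega

/-- A simple group of order `60` with an elementary abelian subgroup of order `4` normalized by an
element of order `3` is isomorphic to `A₅`. -/
theorem nonempty_mulEquiv_alternatingGroup_five {G : Type*} [Group G] [IsSimpleGroup G]
    (hG : Nat.card G = 60) (V : Subgroup G) (hV : Nat.card V = 4) {g : G} (hg3 : orderOf g = 3)
    (hg : ∀ v ∈ V, g * v * g⁻¹ ∈ V) : Nonempty (G ≃* A₅) := by
  have hfin : Finite G := Nat.finite_of_card_ne_zero (by omega)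
  have : Finite V := inferInstance
  set N := Subgroup.normalizer (V : Set G) with hN
  have hgN : g ∈ N := by
    have := Fintype.ofFinite V
    exact Subgroup.mem_normalizer_fintype hg
  have h3 : 3 ∣ Nat.card N := hg3 ▸ N.orderOf_dvd_natCard hgN
  have h4 : 4 ∣ Nat.card N := hV ▸ Subgroup.card_dvd_of_le Subgroup.le_normalizer
  obtain ⟨m, hm⟩ := Nat.Coprime.mul_dvd_of_dvd_of_dvd (by norm_num) h3 h4
  have hidx := N.card_mul_index
  rw [hG, hm] at hidx
  have hidx5 : m * N.index = 5 := by linarith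
  -- Index 1 would make `V` normal in a simple group.
  have hN5 : N.index = 5 := by
    rcases (Nat.dvd_prime Nat.prime_five).1 ⟨m, by linarith⟩ with h | h
    · have hnorm : V.Normal := Subgroup.normalizer_eq_top_iff.1 (Subgroup.index_eq_one.1 h)
      rcases hnorm.eq_bot_or_eq_top with h' | h'
      · simp [h'] at hV
      · rw [h', Subgroup.card_top, hG] at hV
        omega
    · exact h
  have hcard : Nat.card (G ⧸ N) = 5 := hN5
  have : Finite (G ⧸ N) := Nat.finite_of_card_ne_zero (by omega)
  let ε : G ⧸ N ≃ Fin 5 := Finite.equivFinOfCardEq hcard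
  -- The action on the five cosets of the normalizer is faithful by simplicity, and its image has
  -- index 2 in `S₅`.
  let f : G →* Equiv.Perm (Fin 5) :=
    ε.permCongrHom.toMonoidHom.comp (MulAction.toPermHom G (G ⧸ N))
  have hf : Function.Injective f := by
    refine ε.permCongrHom.injective.comp ?_
    rw [← MonoidHom.ker_eq_bot_iff]
    refine (MonoidHom.normal_ker _).eq_bot_or_eq_top.resolve_right fun h => ?_
    have : Nat.card (G ⧸ N) ≤ 1 := by
      rw [Finite.card_le_one_iff_subsingleton]
      refine ⟨fun a b => ?_⟩
      obtain ⟨c, rfl⟩ := MulAction.exists_smul_eq G a b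
      have hc : MulAction.toPermHom G (G ⧸ N) c = 1 := by
        rw [← MonoidHom.mem_ker, h]
        exact Subgroup.mem_top c
      exact (congrArg (fun σ : Equiv.Perm (G ⧸ N) => σ a) hc).symm
    omega
  have hrange : f.range = A₅ := by
    apply Equiv.Perm.eq_alternatingGroup_of_index_eq_two
    have h := f.range.card_mul_index
    rw [← Nat.card_congr (MonoidHom.ofInjective hf).toEquiv, hG, Nat.card_perm, Nat.card_fin] at h
    simp [Nat.factorial] at h
    omega
  exact ⟨(MonoidHom.ofInjective hf).trans (MulEquiv.subgroupCongr hrange)⟩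

end AlternatingFive

open Matrix SpecialLinearGroup
open scoped MatrixGroups

/-! ### Matrix calculus in `SL(2, F)`. -/

section SL2

variable {F : Type*} [Field F]

namespace Matrix.SpecialLinearGroup

/-- The matrix with given entries. -/
def ofEntries (a b c d : F) (h : a * d - b * c = 1) : SL(2, F) :=
  ⟨!![a, b; c, d], by rw [Matrix.det_fin_two_of, h]⟩

@[simp] theorem ofEntries_apply (a b c d : F) (h : a * d - b * c = 1) :
    ofEntries a b c d h 0 0 = a ∧ ofEntries a b c d h 0 1 = b ∧
    ofEntries a b c d h 1 0 = c ∧ ofEntries a b c d h 1 1 = d := ⟨rfl, rfl, rfl, rfl⟩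

/-- Upper unipotent matrices. -/
def up (x : F) : SL(2, F) := ofEntries 1 x 0 1 (by ring)

/-- Lower unipotent matrices. -/
def lo (x : F) : SL(2, F) := ofEntries 1 0 x 1 (by ring)

/-- Diagonal matrices. -/
def dg (a : Fˣ) : SL(2, F) := ofEntries a 0 0 (a : F)⁻¹ (by simp)

theorem det_eq (g : SL(2, F)) : g 0 0 * g 1 1 - g 0 1 * g 1 0 = 1 := by
  rw [← Matrix.det_fin_two]; exact g.2

theorem ext_two {g h : SL(2, F)} (h00 : g 0 0 = h 0 0) (h01 : g 0 1 = h 0 1) (h10 : g 1 0 = h 1 0)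
    (h11 : g 1 1 = h 1 1) : g = h := by
  ext i j
  fin_cases i <;> fin_cases j <;> assumption

theorem mul_apply_two (g h : SL(2, F)) (i j : Fin 2) :
    (g * h) i j = g i 0 * h 0 j + g i 1 * h 1 j := by
  rw [coe_mul, Matrix.mul_apply, Fin.sum_univ_two]

theorem inv_apply_two (g : SL(2, F)) : (g⁻¹) 0 0 = g 1 1 ∧ (g⁻¹) 0 1 = - g 0 1 ∧
    (g⁻¹) 1 0 = - g 1 0 ∧ (g⁻¹) 1 1 = g 0 0 := by
  rw [SL2_inv_expl]
  exact ⟨rfl, rfl, rfl, rfl⟩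

@[simp] theorem up_apply (x : F) : up x 0 0 = 1 ∧ up x 0 1 = x ∧ up x 1 0 = 0 ∧ up x 1 1 = 1 :=
  ⟨rfl, rfl, rfl, rfl⟩

@[simp] theorem lo_apply (x : F) : lo x 0 0 = 1 ∧ lo x 0 1 = 0 ∧ lo x 1 0 = x ∧ lo x 1 1 = 1 :=
  ⟨rfl, rfl, rfl, rfl⟩

@[simp] theorem dg_apply (a : Fˣ) : dg a 0 0 = a ∧ dg a 0 1 = 0 ∧ dg a 1 0 = 0 ∧
    dg a 1 1 = (a : F)⁻¹ := ⟨rfl, rfl, rfl, rfl⟩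

theorem up_add (x y : F) : up (x + y) = up x * up y := by
  apply ext_two <;> simp [mul_apply_two, add_comm]

theorem up_neg (x : F) : up (-x) = (up x)⁻¹ := by
  rw [eq_inv_iff_mul_eq_one, ← up_add, neg_add_cancel]
  apply ext_two <;> simp

theorem dg_mul (a b : Fˣ) : dg (a * b) = dg a * dg b := by
  apply ext_two <;> simp [mul_apply_two, mul_comm]

theorem dg_inv (a : Fˣ) : dg a⁻¹ = (dg a)⁻¹ := by
  rw [eq_inv_iff_mul_eq_one, ← dg_mul, inv_mul_cancel]
  apply ext_two <;> simp

theorem dg_pow (a : Fˣ) (m : ℕ) : dg (a ^ m) = dg a ^ m := by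
  induction m with
  | zero => rw [pow_zero, pow_zero]; apply ext_two <;> simp
  | succ m ih => rw [pow_succ, pow_succ, dg_mul, ih]

theorem dg_mul_up_mul (a : Fˣ) (x : F) : dg a * up x * (dg a)⁻¹ = up ((a : F) ^ 2 * x) := by
  rw [← dg_inv]
  apply ext_two <;> simp [mul_apply_two]
  ring

theorem eq_top_of_up_of_lo {K : Subgroup SL(2, F)} (hup : ∀ x, up x ∈ K) (hlo : ∀ x, lo x ∈ K) :
    K = ⊤ := by
  refine (Subgroup.eq_top_iff' K).2 fun g => ?_
  refine SL2.transvection_induction (· ∈ K) (fun i j hij c => ?_) (fun _ _ => K.mul_mem) g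
  fin_cases i <;> fin_cases j
  · exact absurd rfl hij
  · convert hup c using 1
    apply ext_two <;> simp [SpecialLinearGroup.transvection, Matrix.transvection]
  · convert hlo c using 1
    apply ext_two <;> simp [SpecialLinearGroup.transvection, Matrix.transvection]
  · exact absurd rfl hij

/-- Multiplying `g` on both sides by upper unipotents clears its diagonal; conjugation by the
resulting antidiagonal matrix exchanges the two root subgroups. -/
theorem eq_top_of_up {K : Subgroup SL(2, F)} (hup : ∀ x, up x ∈ K) {g : SL(2, F)} (hg : g ∈ K)
    (hc : g 1 0 ≠ 0) : K = ⊤ := by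
  set c := g 1 0 with hcdef
  have hw : up (-(g 0 0 / c)) * g * up (-(g 1 1 / c)) ∈ K :=
    K.mul_mem (K.mul_mem (hup _) hg) (hup _)
  refine eq_top_of_up_of_lo hup fun x => ?_
  have := K.mul_mem (K.mul_mem hw (hup (-(x / c ^ 2)))) (K.inv_mem hw)
  convert this using 1
  have hdet := det_eq g
  have h01 : g 0 1 = (g 0 0 * g 1 1 - 1) / c := by
    rw [eq_div_iff hc, hcdef]; linear_combination -hdet
  have hwe : up (-(g 0 0 / c)) * g * up (-(g 1 1 / c)) =
      ofEntries 0 (-1 / c) c 0 (by field_simp; ring) := by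
    apply ext_two <;> simp [mul_apply_two, h01, ← hcdef] <;> field_simp <;> ring
  rw [hwe]
  apply ext_two <;> simp [mul_apply_two, inv_apply_two, hc] <;> field_simp

theorem eq_top_of_lo {K : Subgroup SL(2, F)} (hlo : ∀ x, lo x ∈ K) {g : SL(2, F)} (hg : g ∈ K)
    (hb : g 0 1 ≠ 0) : K = ⊤ := by
  set b := g 0 1 with hbdef
  have hw : lo (-(g 1 1 / b)) * g * lo (-(g 0 0 / b)) ∈ K :=
    K.mul_mem (K.mul_mem (hlo _) hg) (hlo _)
  refine eq_top_of_up_of_lo (fun x => ?_) hlo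
  have := K.mul_mem (K.mul_mem hw (hlo (-(x / b ^ 2)))) (K.inv_mem hw)
  convert this using 1
  have hdet := det_eq g
  have h10 : g 1 0 = (g 0 0 * g 1 1 - 1) / b := by
    rw [eq_div_iff hb, hbdef]; linear_combination -hdet
  have hwe : lo (-(g 1 1 / b)) * g * lo (-(g 0 0 / b)) =
      ofEntries 0 b (-1 / b) 0 (by field_simp; ring) := by
    apply ext_two <;> simp [mul_apply_two, h10, ← hbdef] <;> field_simp <;> ring
  rw [hwe]
  apply ext_two <;> simp [mul_apply_two, inv_apply_two, hb] <;> field_simp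

theorem mem_center_two {g : SL(2, F)} :
    g ∈ Subgroup.center SL(2, F) ↔ g 0 1 = 0 ∧ g 1 0 = 0 ∧ g 0 0 = g 1 1 := by
  rw [SpecialLinearGroup.mem_center_iff]
  constructor
  · rintro ⟨r, -, h⟩
    rw [← h]
    simp
  · rintro ⟨h01, h10, h⟩
    have hdet := det_eq g
    refine ⟨g 0 0, ?_, ?_⟩
    · rw [Fintype.card_fin]
      linear_combination hdet + g 0 1 * h10 + g 0 0 * h
    · ext i j
      fin_cases i <;> fin_cases j <;> simp [h01, h10, h]

end Matrix.SpecialLinearGroup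

end SL2

/-! ### Orders modulo the center, from eigenvalues. -/

section Orders

variable {F : Type*} [Field F]

local notation "mk₂" => QuotientGroup.mk' (Subgroup.center SL(2, F))

theorem SL2.mk_pow_eq_one_iff (g : SL(2, F)) (m : ℕ) :
    (mk₂ g) ^ m = 1 ↔ g ^ m ∈ Subgroup.center SL(2, F) := by
  rw [← map_pow]
  exact QuotientGroup.eq_one_iff _

/-- Being scalar can be tested over an extension, where the eigenvalues live. -/
theorem SL2.pow_mem_center_iff {E : Type*} [Field E] (f : F →+* E) (g : SL(2, F)) (m : ℕ) :
    g ^ m ∈ Subgroup.center SL(2, F) ↔ ∃ c : E, (f.mapMatrix g.1) ^ m = scalar (Fin 2) c := by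
  rw [SpecialLinearGroup.mem_center_two]
  have e : ∀ i j, (f.mapMatrix g.1 ^ m) i j = f ((g ^ m) i j) := by
    intro i j
    rw [← map_pow, ← Matrix.SpecialLinearGroup.coe_pow]
    rfl
  constructor
  · rintro ⟨h01, h10, h⟩
    refine ⟨f ((g ^ m) 0 0), ?_⟩
    ext i j
    rw [e]
    fin_cases i <;> fin_cases j <;> simp [h01, h10, h]
  · rintro ⟨c, hc⟩
    rw [hc] at e
    refine ⟨?_, ?_, ?_⟩
    · exact f.injective (by rw [← e]; simp)
    · exact f.injective (by rw [← e]; simp)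
    · exact f.injective (by rw [← e, ← e]; simp)

/-- The order in `PSL(2, F)` of a matrix with distinct eigenvalues `ζ` and `ζ⁻¹` is the order
of `ζ ^ 2`. -/
theorem SL2.orderOf_mk {E : Type*} [Field E] (f : F →+* E) {g : SL(2, F)} {ζ : E} (h0 : ζ ≠ 0)
    (htr : ζ + ζ⁻¹ = f (g 0 0 + g 1 1)) (h2 : ζ ^ 2 ≠ 1) : orderOf (mk₂ g) = orderOf (ζ ^ 2) := by
  set M := f.mapMatrix g.1 with hM
  have hMe : ∀ i j, M i j = f (g i j) := fun i j => rfl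
  have hdet : M 0 0 * M 1 1 - M 0 1 * M 1 0 = 1 := by
    rw [hMe, hMe, hMe, hMe, ← map_mul, ← map_mul, ← map_sub, SpecialLinearGroup.det_eq, map_one]
  have htr' : M 0 0 + M 1 1 = ζ + ζ⁻¹ := by rw [htr, map_add]; rfl
  -- By Cayley–Hamilton `(M - v) * (M - u) = 0`, so the columns of `M - u` are eigenvectors for `v`.
  have hchar : ∀ u v : E, u * v = 1 → u + v = ζ + ζ⁻¹ →
      M * (M - scalar (Fin 2) u) = v • (M - scalar (Fin 2) u) := by
    intro u v huv hsum
    rw [← htr'] at hsum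
    ext i j
    fin_cases i <;> fin_cases j <;>
      simp only [Matrix.mul_apply, Fin.sum_univ_two, Matrix.sub_apply, Matrix.smul_apply,
        smul_eq_mul, scalar_apply, diagonal_apply, Fin.zero_eta, Fin.mk_one, Fin.isValue, if_true,
        zero_ne_one, one_ne_zero, if_false, sub_zero]
    · linear_combination (-M 0 0) * hsum - hdet + huv
    · linear_combination (-M 0 1) * hsum
    · linear_combination (-M 1 0) * hsum
    · linear_combination (-M 1 1) * hsum - hdet + huv
  have hpow : ∀ u v : E, u * v = 1 → u + v = ζ + ζ⁻¹ → ∀ m : ℕ,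
      M ^ m * (M - scalar (Fin 2) u) = v ^ m • (M - scalar (Fin 2) u) := by
    intro u v huv hsum m
    induction m with
    | zero => simp
    | succ m ih => rw [pow_succ, mul_assoc, hchar u v huv hsum, mul_smul_comm, ih, smul_smul,
        pow_succ, mul_comm]
  have hP := hpow ζ⁻¹ ζ (inv_mul_cancel₀ h0) (add_comm _ _)
  have hQ := hpow ζ ζ⁻¹ (mul_inv_cancel₀ h0) rfl
  have hdist : ζ ≠ ζ⁻¹ := by
    intro h
    apply h2
    rw [pow_two]
    nth_rewrite 2 [h]
    exact mul_inv_cancel₀ h0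
  have hne : ∀ u v : E, u + v = ζ + ζ⁻¹ → u ≠ v → M - scalar (Fin 2) u ≠ 0 := by
    intro u v hsum huv h
    rw [sub_eq_zero] at h
    have h00 : M 0 0 = u := by rw [h]; simp
    have h11 : M 1 1 = u := by rw [h]; simp
    rw [h00, h11, ← hsum] at htr'
    exact huv (add_left_cancel htr')
  refine orderOf_eq_orderOf_iff.2 fun m => ?_
  rw [SL2.mk_pow_eq_one_iff, SL2.pow_mem_center_iff f, ← pow_mul, mul_comm, pow_mul]
  have hiff : (ζ ^ m) ^ 2 = 1 ↔ ζ ^ m = ζ⁻¹ ^ m := by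
    rw [inv_pow, pow_two, mul_eq_one_iff_eq_inv₀ (pow_ne_zero m h0)]
  rw [hiff]
  constructor
  · rintro ⟨c, hc⟩
    have key : ∀ N : Matrix (Fin 2) (Fin 2) E, ∀ d : E, N ≠ 0 → M ^ m * N = d • N → d = c := by
      intro N d hN h
      rw [hc] at h
      by_contra hdc
      apply hN
      have : (c - d) • N = 0 := by
        rw [sub_smul, ← h, scalar_apply, ← smul_one_eq_diagonal, smul_mul_assoc, one_mul, sub_self]
      exact (smul_eq_zero.1 this).resolve_left (sub_ne_zero.2 (Ne.symm hdc))
    rw [key _ _ (hne ζ⁻¹ ζ (add_comm _ _) hdist.symm) (hP m),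
      key _ _ (hne ζ ζ⁻¹ rfl hdist) (hQ m)]
  · intro h
    refine ⟨ζ ^ m, ?_⟩
    -- The difference of `M - ζ⁻¹` and `M - ζ` is an invertible scalar, and `M ^ m` acts on both by
    -- `ζ ^ m`.
    have h3 : M ^ m * scalar (Fin 2) (ζ - ζ⁻¹) = ζ ^ m • scalar (Fin 2) (ζ - ζ⁻¹) := by
      have : scalar (Fin 2) (ζ - ζ⁻¹) = (M - scalar (Fin 2) ζ⁻¹) - (M - scalar (Fin 2) ζ) := by
        rw [map_sub]; abel
      rw [this, mul_sub, hP m, hQ m, ← h, ← smul_sub]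
    rw [scalar_apply, ← smul_one_eq_diagonal, mul_smul_comm, mul_one, smul_comm] at h3
    have h4 := smul_right_injective _ (sub_ne_zero.2 hdist) h3
    rw [h4, scalar_apply, ← smul_one_eq_diagonal]

/-- The `p`-th power of a matrix with a double eigenvalue is scalar in characteristic `p`. -/
theorem SL2.mk_pow_char_eq_one {p : ℕ} [Fact p.Prime] [CharP F p] {g : SL(2, F)} {ε : F}
    (hε : ε ^ 2 = 1) (htr : g 0 0 + g 1 1 = 2 * ε) : (mk₂ g) ^ p = 1 := by
  rw [SL2.mk_pow_eq_one_iff, SL2.pow_mem_center_iff (RingHom.id F)]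
  refine ⟨ε ^ p, ?_⟩
  have hdet := SpecialLinearGroup.det_eq g
  -- Cayley–Hamilton with double eigenvalue `ε`; the `p`-th power of the difference then expands by
  -- Frobenius.
  have hsq : (g.1 - scalar (Fin 2) ε) ^ 2 = 0 := by
    rw [pow_two]
    ext i j
    fin_cases i <;> fin_cases j <;>
      simp only [Matrix.mul_apply, Fin.sum_univ_two, Matrix.sub_apply,
        scalar_apply, diagonal_apply, Fin.zero_eta, Fin.mk_one, Fin.isValue, if_true,
        zero_ne_one, one_ne_zero, if_false, sub_zero, Matrix.zero_apply]
    · linear_combination (g.1 0 0) * htr - hdet + hε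
    · linear_combination (g.1 0 1) * htr
    · linear_combination (g.1 1 0) * htr
    · linear_combination (g.1 1 1) * htr - hdet + hε
  have hp : (g.1 - scalar (Fin 2) ε) ^ p = 0 := by
    rw [← Nat.add_sub_of_le (Fact.out : p.Prime).two_le, pow_add, hsq, zero_mul]
  have hcomm : Commute g.1 (scalar (Fin 2) ε) := (scalar_commute ε (fun r => Commute.all _ _) _).symm
  rw [sub_pow_char_of_commute _ hcomm, sub_eq_zero] at hp
  rw [map_pow, ← hp]
  congr 1

end Orders

/-! ### Traces, torus orders and the Frobenius map. -/

section Traces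

variable {F : Type*} [Field F]

local notation "F̄" => AlgebraicClosure F
local notation "mk₂" => QuotientGroup.mk' (Subgroup.center SL(2, F))

theorem eq_or_eq_inv_of_add_inv_eq {E : Type*} [Field E] {u v : E} (hu : u ≠ 0) (hv : v ≠ 0)
    (h : u + u⁻¹ = v + v⁻¹) : u = v ∨ u = v⁻¹ := by
  have h1 : (u - v) * (u * v - 1) = 0 := by
    field_simp at h
    linear_combination h
  rcases mul_eq_zero.1 h1 with h1 | h1
  · exact Or.inl (sub_eq_zero.1 h1)
  · exact Or.inr (eq_inv_of_mul_eq_one_left (sub_eq_zero.1 h1))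

theorem exists_add_inv_eq (τ : F) : ∃ ζ : F̄, ζ ≠ 0 ∧ ζ + ζ⁻¹ = algebraMap F F̄ τ := by
  obtain ⟨ζ, hζ⟩ : ∃ ζ : F̄, ζ ^ 2 - algebraMap F F̄ τ * ζ + 1 = 0 := by
    obtain ⟨ζ, hζ⟩ := IsAlgClosed.exists_root (Polynomial.X ^ 2 -
      Polynomial.C (algebraMap F F̄ τ) * Polynomial.X + 1 : Polynomial F̄) (by
        rw [show (1 : Polynomial F̄) = Polynomial.C 1 from rfl]
        have : (Polynomial.X ^ 2 - Polynomial.C (algebraMap F F̄ τ) * Polynomial.X +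
          Polynomial.C 1 : Polynomial F̄).degree = 2 := by compute_degree!
        rw [this]
        norm_num)
    exact ⟨ζ, by simpa [Polynomial.IsRoot] using hζ⟩
  have h0 : ζ ≠ 0 := by
    rintro rfl
    simp at hζ
  refine ⟨ζ, h0, ?_⟩
  field_simp
  linear_combination hζ

/-- Non-scalar elements of `SL(2, F)` of trace `τ` have distinct eigenvalues and order `N` modulo
the center. -/
def TraceOrder (τ : F) (N : ℕ) : Prop :=
  ∃ ζ : F̄, ζ ≠ 0 ∧ ζ ^ 2 ≠ 1 ∧ orderOf (ζ ^ 2) = N ∧ ζ + ζ⁻¹ = algebraMap F F̄ τ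

theorem TraceOrder.orderOf_mk {τ : F} {N : ℕ} (h : TraceOrder τ N) {g : SL(2, F)}
    (hg : g 0 0 + g 1 1 = τ) : orderOf (mk₂ g) = N := by
  obtain ⟨ζ, h0, h2, rfl, htr⟩ := h
  exact SL2.orderOf_mk (algebraMap F F̄) h0 (by rw [hg, htr]) h2

theorem TraceOrder.neg {τ : F} {N : ℕ} (h : TraceOrder τ N) : TraceOrder (-τ) N := by
  obtain ⟨ζ, h0, h2, h3, h4⟩ := h
  refine ⟨-ζ, neg_ne_zero.2 h0, by rwa [neg_sq], by rwa [neg_sq], ?_⟩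
  rw [map_neg, ← h4, inv_neg]
  ring

theorem TraceOrder.ne_zero {τ : F} {N : ℕ} (h : TraceOrder τ N) (hN : 2 < N) : τ ≠ 0 := by
  rintro rfl
  obtain ⟨ζ, h0, h2, h3, h4⟩ := h
  rw [map_zero] at h4
  have h5 : ζ ^ 2 = -1 := by
    field_simp at h4
    linear_combination h4
  have : orderOf (ζ ^ 2) ≤ 2 := orderOf_le_of_pow_eq_one (by norm_num) (by rw [h5]; norm_num)
  omega

theorem TraceOrder.of_unit {a : Fˣ} (ha : a ^ 2 ≠ 1) :
    TraceOrder ((a : F) + (a : F)⁻¹) (orderOf (a ^ 2)) := by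
  have hinj : Function.Injective ((algebraMap F F̄ : F →* F̄).comp (Units.coeHom F)) :=
    (algebraMap F F̄).injective.comp Units.val_injective
  have hmap : (algebraMap F F̄ (a : F)) ^ 2 =
      ((algebraMap F F̄ : F →* F̄).comp (Units.coeHom F)) (a ^ 2) := by simp
  refine ⟨algebraMap F F̄ a, by simp, ?_, ?_, by simp⟩
  · rw [hmap, Ne, map_eq_one_iff _ hinj]
    exact ha
  · rw [hmap, orderOf_injective _ hinj]

/-- The order in `PSL(2, q)` of a generator of a nonsplit torus. -/
def nonsplitOrder (q : ℕ) : ℕ := (q + 1) / (q + 1).gcd 2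

/-- The order in `PSL(2, q)` of a generator of a split torus. -/
def splitOrder (q : ℕ) : ℕ := (q - 1) / (q - 1).gcd 2

theorem nonsplitOrder_of_odd {q : ℕ} (h : Odd q) : nonsplitOrder q = (q + 1) / 2 := by
  rw [nonsplitOrder, Nat.gcd_eq_right (even_iff_two_dvd.1 h.add_one)]

theorem splitOrder_of_odd {q : ℕ} (h : Odd q) : splitOrder q = (q - 1) / 2 := by
  obtain ⟨m, rfl⟩ := h
  rw [splitOrder, Nat.gcd_eq_right ⟨m, by simp⟩]

theorem nonsplitOrder_of_even {q : ℕ} (h : Even q) : nonsplitOrder q = q + 1 := by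
  rw [nonsplitOrder, Nat.Coprime.gcd_eq_one, Nat.div_one]
  exact Nat.coprime_two_right.2 h.add_one

theorem splitOrder_of_even {q : ℕ} (h : Even q) (hq : q ≠ 0) : splitOrder q = q - 1 := by
  rw [splitOrder, Nat.Coprime.gcd_eq_one, Nat.div_one]
  exact Nat.coprime_two_right.2 (Nat.Even.sub_odd (by omega) h odd_one)

theorem nonsplitOrder_dvd (q : ℕ) : nonsplitOrder q ∣ q + 1 :=
  Nat.div_dvd_of_dvd (Nat.gcd_dvd_left _ _)

theorem splitOrder_dvd (q : ℕ) : splitOrder q ∣ q - 1 := Nat.div_dvd_of_dvd (Nat.gcd_dvd_left _ _)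

/-- For even `q` these are odd numbers differing by 2; for odd `q` they are consecutive. -/
theorem coprime_splitOrder {q : ℕ} (hq : 4 ≤ q) : (nonsplitOrder q).Coprime (splitOrder q) := by
  rcases Nat.even_or_odd q with h | h
  · rw [nonsplitOrder_of_even h, splitOrder_of_even h (by omega)]
    obtain ⟨m, rfl⟩ := h
    have h1 : m + m + 1 = (m + m - 1) + 2 := by omega
    rw [h1, Nat.coprime_self_add_left, Nat.coprime_two_left]
    exact Nat.Even.sub_odd (by omega) ⟨m, rfl⟩ odd_one
  · rw [nonsplitOrder_of_odd h, splitOrder_of_odd h]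
    obtain ⟨m, rfl⟩ := h
    have h1 : (2 * m + 1 + 1) / 2 = m + 1 := by omega
    have h2 : (2 * m + 1 - 1) / 2 = m := by omega
    rw [h1, h2]
    simp

theorem lt_nonsplitOrder {q : ℕ} (hq : 4 ≤ q) : 2 < nonsplitOrder q := by
  rcases Nat.even_or_odd q with h | h
  · rw [nonsplitOrder_of_even h]; omega
  · rw [nonsplitOrder_of_odd h]
    obtain ⟨m, rfl⟩ := h
    omega

variable [Finite F]

theorem pow_natCard (a : F) : a ^ Nat.card F = a := by
  have := Fintype.ofFinite F
  rw [Nat.card_eq_fintype_card, FiniteField.pow_card]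

theorem add_pow_natCard (x y : F̄) : (x + y) ^ Nat.card F = x ^ Nat.card F + y ^ Nat.card F := by
  have := Fintype.ofFinite F
  rw [Nat.card_eq_fintype_card]
  exact map_add (FiniteField.frobeniusAlgHom F F̄) x y

/-- The polynomial `X ^ q - X` has at most `q` roots, and the elements of `F` account for all of
them. -/
theorem mem_range_of_pow_natCard {x : F̄} (hx : x ^ Nat.card F = x) :
    x ∈ Set.range (algebraMap F F̄) := by
  classical
  have := Fintype.ofFinite F
  have hq : 1 < Nat.card F := Finite.one_lt_card
  let P : Polynomial F̄ := Polynomial.X ^ Nat.card F - Polynomial.X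
  have hP : P ≠ 0 := FiniteField.X_pow_card_sub_X_ne_zero _ hq
  have hmem : ∀ y, y ^ Nat.card F = y → y ∈ P.roots.toFinset := fun y hy => by
    rw [Multiset.mem_toFinset, Polynomial.mem_roots hP]
    simp only [P, Polynomial.IsRoot, Polynomial.eval_sub, Polynomial.eval_pow, Polynomial.eval_X,
      hy, sub_self]
  have hsub : Finset.univ.image (algebraMap F F̄) ⊆ P.roots.toFinset := by
    intro y hy
    obtain ⟨a, -, rfl⟩ := Finset.mem_image.1 hy
    exact hmem _ (by rw [← map_pow, pow_natCard])
  have heq := Finset.eq_of_subset_of_card_le hsub (by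
    rw [Finset.card_image_of_injective _ (algebraMap F F̄).injective, Finset.card_univ,
      ← Nat.card_eq_fintype_card, ← FiniteField.X_pow_card_sub_X_natDegree_eq F̄ hq]
    exact (Multiset.toFinset_card_le _).trans (Polynomial.card_roots' _))
  have := hmem x hx
  rw [← heq] at this
  obtain ⟨a, -, rfl⟩ := Finset.mem_image.1 this
  exact ⟨a, rfl⟩

/-- Each element of `PSL(2, q)` has order dividing `nonsplitOrder q`, `splitOrder q` or `p`. -/
theorem PSL2.pow_eq_one {p : ℕ} [Fact p.Prime] [CharP F p]
    (h : ProjectiveSpecialLinearGroup (Fin 2) F) : h ^ nonsplitOrder (Nat.card F) = 1 ∨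
      h ^ splitOrder (Nat.card F) = 1 ∨ h ^ p = 1 := by
  obtain ⟨g, rfl⟩ := QuotientGroup.mk'_surjective (Subgroup.center SL(2, F)) h
  have hq : 1 < Nat.card F := Finite.one_lt_card
  obtain ⟨ζ, h0, htr⟩ := exists_add_inv_eq (g 0 0 + g 1 1)
  by_cases h2 : ζ ^ 2 = 1
  · right; right
    rcases sq_eq_sq_iff_eq_or_eq_neg.1 (h2.trans (one_pow 2).symm) with rfl | rfl
    · refine SL2.mk_pow_char_eq_one (ε := 1) (by norm_num) ((algebraMap F F̄).injective ?_)
      rw [← htr]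
      norm_num
      exact (map_ofNat _ 2).symm
    · refine SL2.mk_pow_char_eq_one (ε := -1) (by norm_num) ((algebraMap F F̄).injective ?_)
      rw [← htr]
      norm_num
      exact (map_ofNat _ 2).symm
  · have ho := SL2.orderOf_mk (algebraMap F F̄) h0 htr h2
    -- Frobenius fixes the trace, so it sends `ζ` to `ζ` or to `ζ⁻¹`; accordingly `ζ` has order
    -- dividing `q - 1` or `q + 1`. The `gcd` with 2 enters because the order modulo the center is
    -- that of `ζ ^ 2`.
    have hfr : ζ ^ Nat.card F + (ζ ^ Nat.card F)⁻¹ = ζ + ζ⁻¹ := by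
      rw [← inv_pow, ← add_pow_natCard, htr, ← map_pow, pow_natCard]
    have hdvd : ∀ m, ζ ^ m = 1 → (mk₂ g) ^ (m / m.gcd 2) = 1 := by
      intro m hm
      rw [← orderOf_dvd_iff_pow_eq_one, ho, orderOf_dvd_iff_pow_eq_one, ← pow_mul]
      obtain ⟨c, hc⟩ := Nat.gcd_dvd_right m 2
      obtain ⟨d, hd⟩ := Nat.gcd_dvd_left m 2
      have hpos : 0 < m.gcd 2 := Nat.gcd_pos_of_pos_right _ two_pos
      have : 2 * (m / m.gcd 2) = m * c := by
        calc 2 * (m / m.gcd 2) = m.gcd 2 * c * (m / m.gcd 2) := by rw [← hc]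
          _ = m.gcd 2 * (m / m.gcd 2) * c := by ring
          _ = m * c := by rw [Nat.mul_div_cancel' (Nat.gcd_dvd_left m 2)]
      rw [this, pow_mul, hm, one_pow]
    rcases eq_or_eq_inv_of_add_inv_eq (pow_ne_zero _ h0) h0 hfr with h | h
    · right; left
      apply hdvd
      apply mul_right_cancel₀ h0
      rw [← pow_succ, Nat.sub_add_cancel hq.le, h, one_mul]
    · left
      apply hdvd
      rw [pow_succ, h, inv_mul_cancel₀ h0]

/-- A trace of elements of order `N` not dividing `splitOrder q` has no eigenvalues in `F`. -/
theorem TraceOrder.no_root {τ : F} {N : ℕ} (h : TraceOrder τ N)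
    (hN : ¬ N ∣ Nat.card F - 1) {s v : F} (hsv : s * v = 1) : s + v ≠ τ := by
  rintro rfl
  obtain ⟨ζ, h0, h2, rfl, htr⟩ := h
  have hs : s ≠ 0 := left_ne_zero_of_mul_eq_one hsv
  have hv : v = s⁻¹ := eq_inv_of_mul_eq_one_right hsv
  have hq : 1 < Nat.card F := Finite.one_lt_card
  have hs1 : s ^ (Nat.card F - 1) = 1 := by
    apply mul_right_cancel₀ hs
    rw [← pow_succ, Nat.sub_add_cancel hq.le, pow_natCard, one_mul]
  apply hN
  rw [orderOf_dvd_iff_pow_eq_one]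
  have hs' : algebraMap F F̄ s ≠ 0 := by simpa using hs
  rw [hv, map_add, map_inv₀] at htr
  rcases eq_or_eq_inv_of_add_inv_eq h0 hs' htr with h | h
  · rw [h, ← map_pow, ← map_pow, ← pow_mul, mul_comm, pow_mul, hs1]
    simp
  · rw [h, inv_pow, inv_pow, ← map_pow, ← map_pow, ← pow_mul, mul_comm 2, pow_mul, hs1]
    simp

/-- Take a primitive `(q + 1)`-th root of unity: Frobenius inverts it, so its trace lies in `F`. -/
theorem exists_nonsplit_root (hq : 4 ≤ Nat.card F) : ∃ (ζ : F̄) (α : F), ζ ≠ 0 ∧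
    orderOf ζ = Nat.card F + 1 ∧ ζ + ζ⁻¹ = algebraMap F F̄ α ∧
    TraceOrder α (nonsplitOrder (Nat.card F)) := by
  have hne : NeZero (((Nat.card F + 1 : ℕ)) : F) := by
    have := Fintype.ofFinite F
    refine ⟨?_⟩
    rw [Nat.card_eq_fintype_card, Nat.cast_add, FiniteField.cast_card_eq_zero]
    simp
  obtain ⟨ζ, hζ⟩ := HasEnoughRootsOfUnity.exists_primitiveRoot F̄ (Nat.card F + 1)
  have ho : orderOf ζ = Nat.card F + 1 := hζ.eq_orderOf.symm
  have h0 : ζ ≠ 0 := hζ.ne_zero (by omega)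
  have hq1 : ζ ^ Nat.card F = ζ⁻¹ := by
    apply eq_inv_of_mul_eq_one_left
    rw [← pow_succ, hζ.pow_eq_one]
  obtain ⟨α, hα⟩ := mem_range_of_pow_natCard (F := F) (x := ζ + ζ⁻¹) (by
    rw [add_pow_natCard, inv_pow, hq1, inv_inv, add_comm])
  have ho2 : orderOf (ζ ^ 2) = nonsplitOrder (Nat.card F) := by
    rw [orderOf_pow' ζ two_ne_zero, ho, nonsplitOrder]
  refine ⟨ζ, α, h0, ho, hα.symm, ζ, h0, ?_, ho2, hα.symm⟩
  intro h
  have := lt_nonsplitOrder hq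
  rw [← ho2, h, orderOf_one] at this
  omega

theorem exists_split_unit : ∃ a : Fˣ, orderOf a = Nat.card F - 1 ∧ (∀ b : Fˣ, ∃ m : ℕ, a ^ m = b) ∧
    orderOf (a ^ 2) = splitOrder (Nat.card F) := by
  obtain ⟨a, ha⟩ := IsCyclic.exists_generator (α := Fˣ)
  have ho : orderOf a = Nat.card F - 1 := by
    rw [orderOf_eq_card_of_forall_mem_zpowers ha, Nat.card_units]
  refine ⟨a, ho, fun b => ?_, by rw [orderOf_pow' a two_ne_zero, ho, splitOrder]⟩
  exact (mem_powers_iff_mem_zpowers.2 (ha b) : _)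

end Traces

/-! ### Subgroups containing the split torus. -/

section SplitTorus

variable {F : Type*} [Field F] [Finite F]

theorem isSquare_mul_of_not_isSquare {a b : F} (ha : ¬ IsSquare a) (hb : ¬ IsSquare b) :
    IsSquare (a * b) := by
  classical
  have := Fintype.ofFinite F
  by_cases hF : ringChar F = 2
  · exact FiniteField.isSquare_of_char_two hF _
  have h1 := (quadraticChar_neg_one_iff_not_isSquare (F := F)).2 ha
  have h2 := (quadraticChar_neg_one_iff_not_isSquare (F := F)).2 hb
  by_cases h0 : a * b = 0
  · rw [h0]; exact IsSquare.zero
  · rw [← quadraticChar_one_iff_isSquare h0, map_mul, h1, h2]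
    norm_num

/-- An additive subgroup of a finite field which is nonzero and stable under squares is everything. -/
theorem AddSubgroup.eq_top_of_sq_mul_mem (Λ : AddSubgroup F) {x : F} (hx : x ∈ Λ) (hx0 : x ≠ 0)
    (hsq : ∀ (a : Fˣ), ∀ y ∈ Λ, (a : F) ^ 2 * y ∈ Λ) : Λ = ⊤ := by
  have hsq' : ∀ a : F, ∀ y ∈ Λ, a ^ 2 * y ∈ Λ := by
    intro a y hy
    by_cases h : a = 0
    · simp [h]
    · exact hsq (Units.mk0 a h) y hy
  have hmul : ∀ a : F, ∀ y ∈ Λ, a * y ∈ Λ := by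
    intro a y hy
    have := Fintype.ofFinite F
    by_cases hF : ringChar F = 2
    · obtain ⟨b, rfl⟩ := FiniteField.isSquare_of_char_two hF a
      rw [← pow_two]
      exact hsq' b y hy
    · have h2 : (2 : F) ≠ 0 := Ring.two_ne_zero hF
      -- In odd characteristic every element is a difference of two squares.
      have : a * y = ((a + 1) / 2) ^ 2 * y - ((a - 1) / 2) ^ 2 * y := by field_simp; ring
      rw [this]
      exact Λ.sub_mem (hsq' _ _ hy) (hsq' _ _ hy)
  refine (AddSubgroup.eq_top_iff' Λ).2 fun z => ?_
  have := hmul (z / x) x hx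
  rwa [div_mul_cancel₀ _ hx0] at this

/-- The root subgroup of upper unipotent matrices in `K`. -/
def upSubgroup {F : Type*} [Field F] (K : Subgroup SL(2, F)) : AddSubgroup F where
  carrier := {x | up x ∈ K}
  add_mem' {a b} ha hb := by
    change up (a + b) ∈ K
    rw [up_add]
    exact K.mul_mem ha hb
  zero_mem' := by
    change up 0 ∈ K
    convert K.one_mem
    apply ext_two <;> simp
  neg_mem' {a} ha := by
    change up (-a) ∈ K
    rw [up_neg]
    exact K.inv_mem ha

theorem mem_upSubgroup {F : Type*} [Field F] {K : Subgroup SL(2, F)} {x : F} :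
    x ∈ upSubgroup K ↔ up x ∈ K := Iff.rfl

/-- Removing the diagonal part leaves a nontrivial unipotent, and conjugation by the torus scales
its entry by all squares. -/
theorem SL2.up_mem_of_triangular {K : Subgroup SL(2, F)} (hD : ∀ a : Fˣ, dg a ∈ K)
    {g : SL(2, F)} (hg : g ∈ K) (h10 : g 1 0 = 0) (h01 : g 0 1 ≠ 0) (x : F) : up x ∈ K := by
  have hdet := det_eq g
  rw [h10, mul_zero, sub_zero] at hdet
  have ha : g 0 0 ≠ 0 := left_ne_zero_of_mul_eq_one hdet
  have hmem : g 0 1 / g 0 0 ∈ upSubgroup K := by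
    change up _ ∈ K
    have := K.mul_mem (K.inv_mem (hD (Units.mk0 _ ha))) hg
    convert this using 1
    rw [← dg_inv]
    apply ext_two <;> simp [mul_apply_two, h10, ha, hdet]
    field_simp
  have htop := (upSubgroup K).eq_top_of_sq_mul_mem hmem (div_ne_zero h01 ha) (fun a y hy => by
    change up _ ∈ K
    rw [← dg_mul_up_mul]
    exact K.mul_mem (K.mul_mem (hD a) hy) (K.inv_mem (hD a)))
  exact mem_upSubgroup.1 (htop ▸ AddSubgroup.mem_top x)

theorem SL2.lo_mem_of_triangular {K : Subgroup SL(2, F)} (hD : ∀ a : Fˣ, dg a ∈ K)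
    {g : SL(2, F)} (hg : g ∈ K) (h01 : g 0 1 = 0) (h10 : g 1 0 ≠ 0) (x : F) : lo x ∈ K := by
  have key : ∀ h : SL(2, F), h ∈ K.comap (MulAut.conj (ofEntries 0 1 (-1) 0 (by ring))).toMonoidHom ↔
      ofEntries 0 1 (-1) 0 (by ring) * h * (ofEntries 0 1 (-1) 0 (by ring))⁻¹ ∈ K := fun h => Iff.rfl
  have := SL2.up_mem_of_triangular
    (K := K.comap (MulAut.conj (ofEntries 0 1 (-1) 0 (by ring))).toMonoidHom)
    (g := (ofEntries 0 1 (-1) 0 (by ring))⁻¹ * g * ofEntries 0 1 (-1) 0 (by ring)) (fun a => by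
      rw [key]
      convert hD a⁻¹ using 1
      apply ext_two <;> simp [mul_apply_two, inv_apply_two]) (by
      rw [key]
      convert hg using 1
      group) (by simp [mul_apply_two, inv_apply_two, h01])
      (by simpa [mul_apply_two, inv_apply_two] using h10) (-x)
  rw [key] at this
  convert this using 1
  apply ext_two <;> simp [mul_apply_two, inv_apply_two]

/-- A subgroup of `SL(2, q)` which contains the diagonal matrices and is neither contained in a
Borel subgroup nor in the normalizer of the torus is everything, if there are at least six nonzero
squares. -/
theorem SL2.eq_top_of_dg_mem {K : Subgroup SL(2, F)} (hD : ∀ a : Fˣ, dg a ∈ K)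
    (hsq : 6 ≤ splitOrder (Nat.card F))
    {y : SL(2, F)} (hy : y ∈ K) (hy01 : y 0 1 ≠ 0) (hy10 : y 1 0 ≠ 0)
    (hydiag : y 0 0 ≠ 0 ∨ y 1 1 ≠ 0) : K = ⊤ := by
  classical
  have := Fintype.ofFinite F
  by_contra hK
  have hU : ∀ g ∈ K, g 1 0 = 0 → g 0 1 = 0 := fun g hg h => by
    by_contra h'
    exact hK (eq_top_of_up (SL2.up_mem_of_triangular hD hg h h') hy hy10)
  have hL : ∀ g ∈ K, g 0 1 = 0 → g 1 0 = 0 := fun g hg h => by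
    by_contra h'
    exact hK (eq_top_of_lo (SL2.lo_mem_of_triangular hD hg h h') hy hy01)
  obtain ⟨t, ht⟩ : ∃ t : Fˣ, (t : F) ^ 2 ≠ 1 := by
    obtain ⟨a, -, -, ha⟩ := exists_split_unit (F := F)
    refine ⟨a, fun h => ?_⟩
    rw [show a ^ 2 = 1 from Units.ext (by simpa using h), orderOf_one] at ha
    omega
  have htt : (t : F) - (t : F)⁻¹ ≠ 0 := by
    intro h
    apply ht
    field_simp at h
    linear_combination h
  -- If exactly one diagonal entry vanished, conjugating a torus element by `g` or its inverse would
  -- give a triangular nondiagonal matrix, excluded by `hU`.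
  have hG : ∀ g ∈ K, g 0 1 ≠ 0 → (g 0 0 = 0 ↔ g 1 1 = 0) := by
    intro g hg h01
    constructor
    · intro h
      by_contra h'
      have := hU (g⁻¹ * dg t * g) (K.mul_mem (K.mul_mem (K.inv_mem hg) (hD t)) hg)
        (by simp [mul_apply_two, inv_apply_two, h])
      rw [mul_apply_two, mul_apply_two, mul_apply_two] at this
      simp [inv_apply_two] at this
      exact mul_ne_zero (mul_ne_zero h01 h') htt (by linear_combination this)
    · intro h
      by_contra h'
      have := hU (g * dg t * g⁻¹) (K.mul_mem (K.mul_mem hg (hD t)) (K.inv_mem hg))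
        (by simp [mul_apply_two, inv_apply_two, h])
      rw [mul_apply_two, mul_apply_two, mul_apply_two] at this
      simp [inv_apply_two] at this
      exact mul_ne_zero (mul_ne_zero h01 h') htt (by linear_combination -this)
  let V : Finset F := Finset.univ.filter fun δ =>
    ∃ g ∈ K, g 0 1 ≠ 0 ∧ g 0 0 ≠ 0 ∧ g 0 0 * g 1 1 = δ
  have hVmem : ∀ δ, δ ∈ V ↔ ∃ g ∈ K, g 0 1 ≠ 0 ∧ g 0 0 ≠ 0 ∧ g 0 0 * g 1 1 = δ := by
    intro δ; simp [V]
  -- The invariant `g 0 0 * g 1 1` depends only on the square class of `g 0 0 / g 1 0`: for equal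
  -- classes some `g⁻¹ * dg s * h` is triangular, hence diagonal. With at most two square classes,
  -- `V` has at most two elements.
  have hsame : ∀ g ∈ K, ∀ h ∈ K, g 0 1 ≠ 0 → h 0 1 ≠ 0 → g 0 0 ≠ 0 → h 0 0 ≠ 0 →
      IsSquare ((g 0 0 / g 1 0) / (h 0 0 / h 1 0)) → g 0 0 * g 1 1 = h 0 0 * h 1 1 := by
    intro g hg h hh hg01 hh01 hg00 hh00 ⟨s, hs⟩
    have hg10 : g 1 0 ≠ 0 := fun h => hg01 (hU g hg h)
    have hh10 : h 1 0 ≠ 0 := fun h' => hh01 (hU h hh h')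
    have hs0 : s ≠ 0 := by
      rintro rfl
      rw [mul_zero] at hs
      exact div_ne_zero (div_ne_zero hg00 hg10) (div_ne_zero hh00 hh10) hs
    have hs' : g 0 0 * h 1 0 = s ^ 2 * (h 0 0 * g 1 0) := by
      field_simp at hs
      linear_combination hs
    have hm := K.mul_mem (K.inv_mem hg) (K.mul_mem (hD (Units.mk0 s hs0)) hh)
    have h1 := hU _ hm (by
      simp [mul_apply_two, inv_apply_two]
      field_simp
      linear_combination hs')
    simp [mul_apply_two, inv_apply_two] at h1
    field_simp at h1
    have hdg := det_eq g
    have hdh := det_eq h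
    have h2 : g 1 1 * h 0 1 * s ^ 2 = g 0 1 * h 1 1 := by linear_combination h1
    have h3 : s ^ 2 * (g 1 0 * h 0 0) * (h 0 0 * h 1 1 - g 0 0 * g 1 1) = 0 := by
      have h5 : h 1 0 * h 1 1 = s ^ 2 * (g 1 0 * g 1 1) := by
        linear_combination (-(h 1 0 * h 1 1)) * hdg + g 1 1 * h 1 1 * hs' + g 1 0 * h 1 0 * h2 +
          s ^ 2 * (g 1 0 * g 1 1) * hdh
      linear_combination g 0 0 * h 0 0 * h5 - h 0 0 * h 1 1 * hs'
    have h4 := (mul_eq_zero.1 h3).resolve_left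
      (mul_ne_zero (pow_ne_zero _ hs0) (mul_ne_zero hg10 hh00))
    linear_combination -h4
  have hV2 : V.card ≤ 2 := by
    by_contra! hlt
    obtain ⟨a, ha, b, hb, c, hc, hab, hac, hbc⟩ := Finset.two_lt_card.1 hlt
    obtain ⟨g₁, hg₁, h₁, k₁, rfl⟩ := (hVmem a).1 ha
    obtain ⟨g₂, hg₂, h₂, k₂, rfl⟩ := (hVmem b).1 hb
    obtain ⟨g₃, hg₃, h₃, k₃, rfl⟩ := (hVmem c).1 hc
    have n₁ := mt (hsame g₁ hg₁ g₂ hg₂ h₁ h₂ k₁ k₂) hab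
    have n₂ := mt (hsame g₂ hg₂ g₃ hg₃ h₂ h₃ k₂ k₃) hbc
    have n₃ := isSquare_mul_of_not_isSquare n₁ n₂
    rw [div_mul_div_cancel₀ (div_ne_zero k₂ fun h => h₂ (hU g₂ hg₂ h))] at n₃
    exact hac (hsame g₁ hg₁ g₃ hg₃ h₁ h₃ k₁ k₃ n₃)
  have hy00 : y 0 0 ≠ 0 := fun h => hydiag.elim (fun h' => h' h) fun h' => h' ((hG y hy hy01).1 h)
  have hdy := det_eq y
  set δ := y 0 0 * y 1 1 with hδ
  have hδV : δ ∈ V := (hVmem δ).2 ⟨y, hy, hy01, hy00, rfl⟩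
  have hδ0 : δ ≠ 0 := mul_ne_zero hy00 (mt (hG y hy hy01).2 hy00)
  have hδ1 : δ - 1 ≠ 0 := by
    intro h
    exact mul_ne_zero hy01 hy10 (by linear_combination h - hdy)
  let S : Finset F := Finset.univ.image fun a : Fˣ => (a : F) ^ 2
  have hS : S.card = splitOrder (Nat.card F) := by
    have h1 := IsCyclic.card_powMonoidHom_range (G := Fˣ) 2
    rw [Nat.card_units] at h1
    have h2 : (S : Set F) = Units.val '' ((powMonoidHom 2 : Fˣ →* Fˣ).range : Set Fˣ) := by
      ext z
      simp [S]
    rw [splitOrder, ← h1, ← Set.ncard_coe_finset, h2,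
      Set.ncard_image_of_injective _ Units.val_injective]
    rfl
  -- This is the invariant of `y * dg u * y⁻¹` for `s = u ^ 2`. It takes each value at most twice,
  -- so the squares other than `1` number at most `2 * V.card ≤ 4`, against the hypothesis. Only `s
  -- = -1` can fail, by giving an antidiagonal matrix.
  let ψ : F → F := fun s => δ ^ 2 + (δ - 1) ^ 2 - δ * (δ - 1) * (s + s⁻¹)
  have hψ : ∀ s ∈ S, s ≠ 1 → ψ s ∈ V ∨ (s = -1 ∧ 2 * δ = 1 ∧
      ∃ w ∈ K, w 0 0 = 0 ∧ w 1 1 = 0 ∧ w 0 1 ≠ 0) := by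
    intro s hs hs1
    obtain ⟨u, -, rfl⟩ := Finset.mem_image.1 hs
    have he := K.mul_mem (K.mul_mem hy (hD u)) (K.inv_mem hy)
    set e := y * dg u * y⁻¹ with hedef
    have hu : (u : F) ≠ 0 := u.ne_zero
    have e00 : e 0 0 = δ * u - (δ - 1) * (u : F)⁻¹ := by
      rw [hedef, hδ]
      simp [mul_apply_two, inv_apply_two]
      linear_combination (u : F)⁻¹ * hdy
    have e11 : e 1 1 = δ * (u : F)⁻¹ - (δ - 1) * u := by
      rw [hedef, hδ]
      simp [mul_apply_two, inv_apply_two]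
      linear_combination (u : F) * hdy
    have e01 : e 0 1 ≠ 0 := by
      have : e 0 1 = y 0 0 * y 0 1 * ((u : F)⁻¹ - u) := by
        rw [hedef]
        simp [mul_apply_two, inv_apply_two]
        ring
      rw [this]
      refine mul_ne_zero (mul_ne_zero hy00 hy01) fun h => hs1 ?_
      field_simp at h
      linear_combination -h
    by_cases h00 : e 0 0 = 0
    · right
      have h11 := (hG e he e01).1 h00
      have hu2 : (u : F) ^ 2 = -1 := by
        rw [e00] at h00
        rw [e11] at h11
        field_simp at h00 h11
        linear_combination h00 + h11
      refine ⟨hu2, ?_, e, he, h00, h11, e01⟩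
      rw [e00] at h00
      field_simp at h00
      rw [hu2] at h00
      linear_combination -h00
    · left
      refine (hVmem _).2 ⟨e, he, e01, h00, ?_⟩
      rw [e00, e11]
      simp only [ψ]
      field_simp
      ring
  have hfiber : ∀ v ∈ V, ((S.erase 1).filter fun s => ψ s = v).card ≤ 2 := by
    intro v _
    by_cases hne : ∃ s₀ ∈ (S.erase 1), ψ s₀ = v
    · obtain ⟨s₀, hs₀, rfl⟩ := hne
      refine (Finset.card_le_card (t := {s₀, s₀⁻¹}) fun s hs => ?_).trans Finset.card_le_two
      obtain ⟨hs, hψs⟩ := Finset.mem_filter.1 hs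
      have hnz : ∀ s ∈ S.erase 1, s ≠ 0 := by
        intro s hs
        obtain ⟨u, -, rfl⟩ := Finset.mem_image.1 (Finset.mem_of_mem_erase hs)
        exact pow_ne_zero _ u.ne_zero
      have h1 : s + s⁻¹ = s₀ + s₀⁻¹ := by
        apply mul_left_cancel₀ (mul_ne_zero hδ0 hδ1)
        simp only [ψ] at hψs
        linear_combination -hψs
      rw [Finset.mem_insert, Finset.mem_singleton]
      exact eq_or_eq_inv_of_add_inv_eq (hnz s hs) (hnz s₀ hs₀) h1
    · rw [Finset.card_eq_zero.2]
      · omega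
      · rw [Finset.filter_eq_empty_iff]
        exact fun s hs h => hne ⟨s, hs, h⟩
  have h1S : (1 : F) ∈ S := Finset.mem_image.2 ⟨1, Finset.mem_univ _, by simp⟩
  have hcardS := Finset.card_erase_of_mem h1S
  by_cases hw : 2 * δ = 1 ∧ ∃ w ∈ K, w 0 0 = 0 ∧ w 1 1 = 0 ∧ w 0 1 ≠ 0
  · obtain ⟨h2δ, w, hwK, hw00, hw11, hw01⟩ := hw
    -- Multiplication by the antidiagonal `w` sends the invariant `v` to `1 - v`, whose fixed point
    -- is `δ = 1 / 2`. Any other value would give three elements of `V`. One value leaves at most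
    -- two squares besides `1` and `-1`.
    have hV1 : V ⊆ {δ} := by
      intro v hv
      rw [Finset.mem_singleton]
      by_contra hvδ
      have hv' : 1 - v ∈ V := by
        obtain ⟨g, hg, h01, h00, rfl⟩ := (hVmem v).1 hv
        have hdw := det_eq w
        have hdg := det_eq g
        have h10 : g 1 0 ≠ 0 := fun h => h01 (hU g hg h)
        have h11 : g 1 1 ≠ 0 := fun h => h00 ((hG g hg h01).2 h)
        refine (hVmem _).2 ⟨w * g, K.mul_mem hwK hg, ?_, ?_, ?_⟩
        · rw [mul_apply_two, hw00, zero_mul, zero_add]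
          exact mul_ne_zero hw01 h11
        · rw [mul_apply_two, hw00, zero_mul, zero_add]
          exact mul_ne_zero hw01 h10
        · rw [mul_apply_two, mul_apply_two, hw00, hw11]
          rw [hw00] at hdw
          linear_combination (-(g 1 0 * g 0 1)) * hdw + hdg
      have h20 : (2 : F) ≠ 0 := left_ne_zero_of_mul_eq_one h2δ
      have : ({v, 1 - v, δ} : Finset F).card = 3 := by
        refine Finset.card_eq_three.2 ⟨_, _, _, fun h => hvδ ?_, hvδ, fun h => hvδ ?_, rfl⟩
        · apply mul_left_cancel₀ h20
          linear_combination h - h2δ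
        · linear_combination -h - h2δ
      have h3 := Finset.card_le_card (s := {v, 1 - v, δ}) (t := V) (by
        intro z hz
        simp only [Finset.mem_insert, Finset.mem_singleton] at hz
        rcases hz with rfl | rfl | rfl <;> assumption)
      omega
    have hle := Finset.card_le_mul_card_image_of_maps_to (s := (S.erase 1).erase (-1)) (t := V)
      (f := ψ) (fun s hs => by
        rw [Finset.mem_erase, Finset.mem_erase] at hs
        exact (hψ s hs.2.2 hs.2.1).resolve_right fun h => hs.1 h.1) 2 (fun v hv =>
          (Finset.card_le_card (Finset.filter_subset_filter _ (Finset.erase_subset _ _))).trans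
            (hfiber v hv))
    have h4 := Finset.card_le_card hV1
    rw [Finset.card_singleton] at h4
    have h5 := Finset.pred_card_le_card_erase (s := S.erase 1) (a := -1)
    omega
  · have hle := Finset.card_le_mul_card_image_of_maps_to (s := S.erase 1) (t := V)
      (f := ψ) (fun s hs => by
        rw [Finset.mem_erase] at hs
        exact (hψ s hs.2 hs.1).resolve_right fun h => hw h.2) 2 hfiber
    omega

end SplitTorus

/-! ### Generating triples involving the split torus. -/

section Realization

theorem not_nonsplitOrder_dvd {q : ℕ} (hq : 4 ≤ q) : ¬ nonsplitOrder q ∣ q - 1 := by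
  intro h
  have h1 := Nat.dvd_sub (nonsplitOrder_dvd q) h
  have h2 : q + 1 - (q - 1) = 2 := by omega
  rw [h2] at h1
  have := Nat.le_of_dvd two_pos h1
  have := lt_nonsplitOrder hq
  omega

theorem seven_le_of_le_splitOrder {q : ℕ} (hq : 6 ≤ splitOrder q) : 7 ≤ q := by
  have := Nat.div_le_self (q - 1) ((q - 1).gcd 2)
  rw [← splitOrder] at this
  omega

variable {F : Type*} [Field F]

local notation "mk₂" => QuotientGroup.mk' (Subgroup.center SL(2, F))

/-- Non-scalar elements of `SL(2, F)` of trace `τ` have order `N` modulo the center. -/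
def ForcesOrder (τ : F) (N : ℕ) : Prop :=
  ∀ g : SL(2, F), g ∉ Subgroup.center SL(2, F) → g 0 0 + g 1 1 = τ → orderOf (mk₂ g) = N

theorem TraceOrder.forcesOrder {τ : F} {N : ℕ} (h : TraceOrder τ N) : ForcesOrder τ N :=
  fun _ _ hg => h.orderOf_mk hg

theorem forcesOrder_two_mul {p : ℕ} [Fact p.Prime] [CharP F p] {ε : F} (hε : ε ^ 2 = 1) :
    ForcesOrder (2 * ε) p := fun _ hc hg =>
  orderOf_eq_prime (SL2.mk_pow_char_eq_one hε hg) fun h => hc ((QuotientGroup.eq_one_iff _).1 h)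

theorem forcesOrder_two {p : ℕ} [Fact p.Prime] [CharP F p] : ForcesOrder (2 : F) p := by
  simpa using forcesOrder_two_mul (F := F) (p := p) (ε := 1) (one_pow 2)

/-- Ensures that `x`, `y` and `x * y` are not central, so that their traces force their orders. -/
theorem SL2.mul_ne_mul_of_closure_eq_top {x y : SL(2, F)} (h : Subgroup.closure {x, y} = ⊤) :
    x * y ≠ y * x := by
  intro hxy
  have h1 : Subgroup.closure {x, y} ≤ Subgroup.centralizer {x, y} := by
    rw [Subgroup.closure_le]
    rintro _ (rfl | rfl) <;> rw [SetLike.mem_coe, Subgroup.mem_centralizer_iff] <;>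
      rintro _ (rfl | rfl) <;> first | rfl | exact hxy | exact hxy.symm
  rw [h, top_le_iff, Subgroup.centralizer_eq_top_iff_subset] at h1
  have h2 : Subgroup.closure {x, y} ≤ Subgroup.center SL(2, F) := (Subgroup.closure_le _).2 h1
  rw [h] at h2
  have := (mem_center_two.1 (h2 (Subgroup.mem_top (up 1)))).1
  simp at this

/-- Generating pairs of `SL(2, F)` with suitable traces give triples of generators of
`PSL(2, F)`. -/
theorem realizes_of_closure_eq_top {n : Fin 3 → ℕ} {x y : SL(2, F)}
    (h : Subgroup.closure {x, y} = ⊤) {t₀ t₁ t₂ : Fin 3}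
    (h₀ : ForcesOrder (x 0 0 + x 1 1) (n t₀)) (h₁ : ForcesOrder (y 0 0 + y 1 1) (n t₁))
    (h₂ : ForcesOrder ((x * y) 0 0 + (x * y) 1 1) (n t₂)) :
    Realizes (ProjectiveSpecialLinearGroup (Fin 2) F) n ![t₀, t₁, t₂] := by
  have hxy := SL2.mul_ne_mul_of_closure_eq_top h
  refine Realizes.of_pair (x := mk₂ x) (y := mk₂ y) ?_ (h₀ x ?_ rfl) (h₁ y ?_ rfl) ?_
  · rw [IsGeneratingPair, ← Set.image_pair, ← MonoidHom.map_closure, h,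
      Subgroup.map_top_of_surjective _ (QuotientGroup.mk'_surjective _)]
  · exact fun hc => hxy (Subgroup.mem_center_iff.1 hc y).symm
  · exact fun hc => hxy (Subgroup.mem_center_iff.1 hc x)
  · rw [← map_mul]
    refine h₂ _ (fun hc => hxy ?_) rfl
    have := Subgroup.mem_center_iff.1 hc x
    rw [mul_assoc] at this
    exact mul_left_cancel this

/-- A nonsingular linear system for the diagonal entries of `y`, given the traces of `y` and `dg a *
y`. -/
theorem exists_add_eq_mul_add_inv_mul {a : F} (ha : a ≠ 0) (ha2 : a ^ 2 ≠ 1) (β γ : F) :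
    ∃ s v, s + v = β ∧ a * s + a⁻¹ * v = γ := by
  have h : a ^ 2 - 1 ≠ 0 := sub_ne_zero.2 ha2
  refine ⟨(a * γ - β) / (a ^ 2 - 1), (a ^ 2 * β - a * γ) / (a ^ 2 - 1), ?_, ?_⟩
  · field_simp
    ring
  · field_simp
    ring

variable [Finite F]

/-- Triples in which the first element is diagonal. -/
theorem realizes_of_dg {n : Fin 3 → ℕ} {a : Fˣ} (ha : ∀ b : Fˣ, ∃ m : ℕ, a ^ m = b)
    (hsq : 6 ≤ splitOrder (Nat.card F)) {s v : F} (hsv : s * v ≠ 1) (h0 : s ≠ 0 ∨ v ≠ 0)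
    {t₀ t₁ t₂ : Fin 3} (h₀ : ForcesOrder ((a : F) + (a : F)⁻¹) (n t₀))
    (h₁ : ForcesOrder (s + v) (n t₁)) (h₂ : ForcesOrder (a * s + (a : F)⁻¹ * v) (n t₂)) :
    Realizes (ProjectiveSpecialLinearGroup (Fin 2) F) n ![t₀, t₁, t₂] := by
  -- The lower left entry `s * v - 1` is nonzero by `hsv`, so `y` is not triangular, and `h0` keeps
  -- it from being antidiagonal.
  refine realizes_of_closure_eq_top (x := dg a)
    (y := ofEntries s 1 (s * v - 1) v (by ring)) ?_ (by simpa using h₀) (by simpa using h₁)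
    (by simpa [mul_apply_two] using h₂)
  refine SL2.eq_top_of_dg_mem (fun b => ?_) hsq
    (Subgroup.subset_closure (Set.mem_insert_of_mem _ rfl)) (by simp)
    (by simpa [sub_eq_zero] using hsv) (by simpa using h0)
  obtain ⟨m, rfl⟩ := ha b
  rw [dg_pow]
  exact pow_mem (Subgroup.subset_closure (Set.mem_insert _ _)) m

theorem realizes_generic_mixed {p : ℕ} [Fact p.Prime] [CharP F p]
    (hsq : 6 ≤ splitOrder (Nat.card F)) {α : F} (hα : TraceOrder α (nonsplitOrder (Nat.card F))) :
    let n := ![nonsplitOrder (Nat.card F), splitOrder (Nat.card F), p]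
    Realizes (ProjectiveSpecialLinearGroup (Fin 2) F) n ![0, 1, 2] ∧
    Realizes (ProjectiveSpecialLinearGroup (Fin 2) F) n ![1, 0, 2] := by
  intro n
  obtain ⟨a, -, ha, ha2⟩ := exists_split_unit (F := F)
  have ha1 : a ^ 2 ≠ 1 := by
    intro h
    rw [h, orderOf_one] at ha2
    omega
  have hax : (a : F) ^ 2 ≠ 1 := fun h => ha1 (Units.ext (by simpa using h))
  have hsplit : ForcesOrder ((a : F) + (a : F)⁻¹) (n 1) := by
    have := (TraceOrder.of_unit ha1).forcesOrder
    rwa [ha2] at this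
  have hns : ForcesOrder α (n 0) := hα.forcesOrder
  have hp : ForcesOrder (2 : F) (n 2) := forcesOrder_two (p := p)
  have h4 : 4 ≤ Nat.card F := by linarith [seven_le_of_le_splitOrder hsq]
  have hα0 : α ≠ 0 := by
    exact hα.ne_zero (lt_nonsplitOrder h4)
  have hnd := not_nonsplitOrder_dvd h4
  constructor
  · obtain ⟨s, v, hs, hv⟩ := exists_add_eq_mul_add_inv_mul a.ne_zero hax 2 α
    refine (realizes_of_dg (t₀ := 1) (t₁ := 2) (t₂ := 0) ha hsq (s := s) (v := v) ?_ ?_ hsplit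
      (by rwa [hs]) (by rwa [hv])).rotate.rotate
    -- A triangular `y` would make `a * s` and `a⁻¹ * v` inverse to each other with sum `α`, but `α`
    -- has no eigenvalues in `F`.
    · intro h
      refine hα.no_root hnd (s := a * s) (v := (a : F)⁻¹ * v) ?_ hv
      field_simp
      exact h
    · by_contra! h0
      apply hα0
      rw [← hv, h0.1, h0.2]
      simp
  · obtain ⟨s, v, hs, hv⟩ := exists_add_eq_mul_add_inv_mul a.ne_zero hax α 2
    refine realizes_of_dg (t₀ := 1) (t₁ := 0) (t₂ := 2) ha hsq (s := s) (v := v) ?_ ?_ hsplit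
      (by rwa [hs]) (by rwa [hv])
    · exact fun h => hα.no_root hnd h hs
    · by_contra! h0
      apply hα0
      rw [← hs, h0.1, h0.2, add_zero]

theorem realizes_generic_split (hsq : 6 ≤ splitOrder (Nat.card F)) {N p : ℕ} :
    Realizes (ProjectiveSpecialLinearGroup (Fin 2) F) ![N, splitOrder (Nat.card F), p]
      ![1, 1, 1] := by
  obtain ⟨a, hao, ha, ha2⟩ := exists_split_unit (F := F)
  have hpow : ∀ m, 0 < m → m ≤ 5 → a ^ m ≠ 1 := by
    intro m hm hm5 h
    have := Nat.le_of_dvd hm (orderOf_dvd_of_pow_eq_one h)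
    have := seven_le_of_le_splitOrder hsq
    omega
  have hpow' : ∀ m, 0 < m → m ≤ 5 → (a : F) ^ m - 1 ≠ 0 := by
    intro m hm hm5 h
    exact hpow m hm hm5 (Units.ext (by simpa [sub_eq_zero] using h))
  have hsplit : ForcesOrder ((a : F) + (a : F)⁻¹) (splitOrder (Nat.card F)) := by
    have := (TraceOrder.of_unit (hpow 2 (by norm_num) (by norm_num))).forcesOrder
    rwa [ha2] at this
  have hax : (a : F) ^ 2 ≠ 1 := sub_ne_zero.1 (hpow' 2 (by norm_num) (by norm_num))
  have h0 := a.ne_zero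
  have h1 : (a : F) ^ 2 - 1 ≠ 0 := sub_ne_zero.2 hax
  have h4 : (a : F) + (a : F)⁻¹ ≠ 0 := by
    intro h
    field_simp at h
    apply hpow' 4 (by norm_num) (by norm_num)
    linear_combination ((a : F) ^ 2 - 1) * h
  obtain ⟨s, v, hs, hv⟩ := exists_add_eq_mul_add_inv_mul h0 hax ((a : F) + (a : F)⁻¹)
    ((a : F) + (a : F)⁻¹)
  refine realizes_of_dg ha hsq (s := s) (v := v) (t₀ := 1) (t₁ := 1) (t₂ := 1) ?_ ?_ hsplit
    (by rwa [hs]) (by rwa [hv])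
  · intro h
    have e1 : (a : F) * (s + v) = a ^ 2 + 1 := by rw [hs]; field_simp
    have e2 : (a : F) ^ 2 * s + v = a ^ 2 + 1 := by
      field_simp at hv
      linear_combination hv
    have e3 : s * ((a : F) * (a + 1)) * (a - 1) = (a ^ 2 + 1) * (a - 1) := by
      linear_combination (a : F) * e2 - e1
    have e4 : s * ((a : F) * (a + 1)) = a ^ 2 + 1 :=
      mul_right_cancel₀ (fun h => h1 (by linear_combination (a + 1 : F) * h)) e3
    have e5 : v * ((a : F) + 1) = a ^ 2 + 1 := by
      linear_combination ((a : F) + 1) * e2 - a * e4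
    -- With all three traces equal to `a + a⁻¹`, a triangular `y` forces `a ^ 3 = 1` or `a = 1`,
    -- impossible for a generator of the multiplicative group here.
    have e6 : ((a : F) ^ 3 - 1) * (a - 1) = 0 := by
      linear_combination (-(v * ((a : F) + 1))) * e4 - (a ^ 2 + 1) * e5 + a * (a + 1) ^ 2 * h
    rcases mul_eq_zero.1 e6 with h | h
    · exact hpow' 3 (by norm_num) (by norm_num) h
    · exact hpow' 1 (by norm_num) (by norm_num) (by rwa [pow_one])
  · by_contra! h0
    apply h4
    rw [← hs, h0.1, h0.2, add_zero]

end Realization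

/-! ### Subgroups containing a nonsplit torus and a transvection. -/

section NonsplitTorus

variable {F : Type*} [Field F]

local notation "F̄" => AlgebraicClosure F

namespace Matrix.SpecialLinearGroup

/-- The transvection `w ↦ w + ε ⟨v, w⟩ v` for the vector `v = (a, b)` and the symplectic form. -/
def trv (a b ε : F) : SL(2, F) :=
  ofEntries (1 - ε * a * b) (ε * a ^ 2) (-(ε * b ^ 2)) (1 + ε * a * b) (by ring)

theorem trv_one_zero (ε : F) : trv 1 0 ε = up ε := by
  apply ext_two <;> simp [trv]

theorem trv_mul_mul (a b c ε : F) : trv (c * a) (c * b) ε = trv a b (c ^ 2 * ε) := by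
  apply ext_two <;> simp [trv] <;> ring

/-- Conjugation by `h` moves the vector of a transvection and keeps `ε`, because `h` preserves the
symplectic form. -/
theorem mul_trv (h : SL(2, F)) (a b ε : F) :
    h * trv a b ε = trv (h 0 0 * a + h 0 1 * b) (h 1 0 * a + h 1 1 * b) ε * h := by
  have hd := det_eq h
  apply ext_two <;> simp [mul_apply_two, trv]
  · linear_combination (ε * b * (h 0 0 * a + h 0 1 * b)) * hd
  · linear_combination (-(ε * a) * (h 0 0 * a + h 0 1 * b)) * hd
  · linear_combination (ε * b * (h 1 0 * a + h 1 1 * b)) * hd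
  · linear_combination (-(ε * a) * (h 1 0 * a + h 1 1 * b)) * hd

theorem trv_mem_iff {K : Subgroup SL(2, F)} {h : SL(2, F)} (hh : h ∈ K) (a b ε : F) :
    trv a b ε ∈ K ↔ trv (h 0 0 * a + h 0 1 * b) (h 1 0 * a + h 1 1 * b) ε ∈ K := by
  rw [← K.mul_mem_cancel_left hh, mul_trv, K.mul_mem_cancel_right hh]

/-- The companion matrix of `X ^ 2 - α X + 1`. -/
def companion (α : F) : SL(2, F) := ofEntries 0 (-1) 1 α (by ring)

variable [Finite F]

/-- If the roots of `X ^ 2 - α X + 1` have order `q + 1`, then the powers of the companion matrix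
are all matrices of determinant one in the algebra that it generates. -/
theorem mem_of_companion_mem {ζ : F̄} {α : F} (h0 : ζ ≠ 0) (ho : orderOf ζ = Nat.card F + 1)
    (hα : ζ + ζ⁻¹ = algebraMap F F̄ α) {K : Subgroup SL(2, F)} (hx : companion α ∈ K) {r s : F}
    (h : r ^ 2 + α * r * s + s ^ 2 = 1) :
    ofEntries r (-s) s (r + α * s) (by linear_combination h) ∈ K := by
  have hq : 1 < Nat.card F := Finite.one_lt_card
  have hpow : ∀ m : ℕ, ∃ g ∈ K, g 0 1 = -g 1 0 ∧ g 1 1 = g 0 0 + α * g 1 0 ∧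
      ζ ^ m = algebraMap F F̄ (g 0 0) + algebraMap F F̄ (g 1 0) * ζ := by
    intro m
    induction m with
    | zero => exact ⟨1, K.one_mem, by simp, by simp, by simp⟩
    | succ m ih =>
      obtain ⟨g, hg, h01, h11, hζ⟩ := ih
      refine ⟨companion α * g, K.mul_mem hx hg, ?_, ?_, ?_⟩
      · simp [mul_apply_two, companion, h01, h11]
      · simp [mul_apply_two, companion, h01, h11]
      · rw [pow_succ, hζ]
        simp only [mul_apply_two, companion, ofEntries_apply, zero_mul, zero_add, neg_mul, one_mul,
          map_add, map_mul, map_neg, ← hα]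
        field_simp
        ring
  have hζq : ζ ^ Nat.card F = ζ⁻¹ := by
    apply eq_inv_of_mul_eq_one_left
    rw [← pow_succ, ← ho, pow_orderOf_eq_one]
  have hind : ∀ r s : F, algebraMap F F̄ r + algebraMap F F̄ s * ζ = 0 → r = 0 ∧ s = 0 := by
    intro r s h
    by_cases hs : s = 0
    · subst hs
      simpa using h
    · exfalso
      have hs' : algebraMap F F̄ s ≠ 0 := by simpa using hs
      have hz : ζ = algebraMap F F̄ (-r / s) := by
        rw [map_div₀, map_neg]
        field_simp
        linear_combination h
      have h1 : ζ ^ 2 = 1 := by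
        rw [pow_two]
        nth_rewrite 1 [hz]
        rw [← pow_natCard (-r / s), map_pow, ← hz, hζq, inv_mul_cancel₀ h0]
      have := Nat.le_of_dvd two_pos (orderOf_dvd_of_pow_eq_one h1)
      omega
  -- The `(q + 1)`-th power is the norm, here `r ^ 2 + α * r * s + s ^ 2`; elements of norm one are
  -- powers of `ζ`.
  have hz : (algebraMap F F̄ r + algebraMap F F̄ s * ζ) ^ (Nat.card F + 1) = 1 := by
    rw [pow_succ, add_pow_natCard, mul_pow, hζq, ← map_pow, ← map_pow, pow_natCard, pow_natCard]
    have := congrArg (algebraMap F F̄) h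
    simp only [map_add, map_mul, map_pow, map_one, ← hα] at this
    rw [← this]
    field_simp
    ring
  have hprim : IsPrimitiveRoot ζ (Nat.card F + 1) := ho ▸ IsPrimitiveRoot.orderOf ζ
  obtain ⟨m, -, hm⟩ := hprim.eq_pow_of_pow_eq_one hz
  obtain ⟨g, hg, h01, h11, hζ⟩ := hpow m
  obtain ⟨hr, hs⟩ := hind (r - g 0 0) (s - g 1 0) (by
    rw [map_sub, map_sub]
    linear_combination hζ - hm)
  rw [sub_eq_zero] at hr hs
  convert hg using 1
  apply ext_two <;> simp [h01, h11, hr, hs]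

end Matrix.SpecialLinearGroup

variable [Finite F]

/-- The multipliers of an additive subgroup of a finite field form a subfield. -/
def AddSubgroup.multipliers (Λ : AddSubgroup F) : Subfield F where
  carrier := {m | ∀ x ∈ Λ, m * x ∈ Λ}
  mul_mem' {a b} ha hb x hx := by rw [mul_assoc]; exact ha _ (hb _ hx)
  one_mem' x hx := by rwa [one_mul]
  add_mem' {a b} ha hb x hx := by rw [add_mul]; exact Λ.add_mem (ha x hx) (hb x hx)
  zero_mem' x hx := by rw [zero_mul]; exact Λ.zero_mem
  neg_mem' {a} ha x hx := by rw [neg_mul]; exact Λ.neg_mem (ha x hx)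
  inv_mem' a ha x hx := by
    by_cases h : a = 0
    · rw [h, _root_.inv_zero, zero_mul]; exact Λ.zero_mem
    have hpow : ∀ n : ℕ, a ^ n * x ∈ Λ := fun n => by
      induction n with
      | zero => simpa using hx
      | succ n ih => rw [pow_succ', mul_assoc]; exact ha _ ih
    have hq : 1 < Nat.card F := Finite.one_lt_card
    have : a⁻¹ = a ^ (Nat.card F - 2) := by
      refine inv_eq_of_mul_eq_one_left (mul_right_cancel₀ h ?_)
      rw [← pow_succ, ← pow_succ, one_mul]
      exact (congrArg (a ^ ·) (by omega)).trans (pow_natCard a)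
    rw [this]
    exact hpow _

theorem AddSubgroup.mem_multipliers {Λ : AddSubgroup F} {m : F} :
    m ∈ Λ.multipliers ↔ ∀ x ∈ Λ, m * x ∈ Λ := Iff.rfl

theorem Subfield.exists_card_eq_pow {k : Subfield F} (hk : k ≠ ⊤) :
    ∃ d, 2 ≤ d ∧ Nat.card F = Nat.card k ^ d := by
  refine ⟨Module.finrank k F, ?_, Module.natCard_eq_pow_finrank⟩
  by_contra! h
  have hc : Nat.card F ≤ Nat.card k := by
    rw [Module.natCard_eq_pow_finrank (K := k) (V := F)]
    calc _ ≤ Nat.card k ^ 1 := Nat.pow_le_pow_right Nat.card_pos (by omega)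
      _ = _ := pow_one _
  apply hk
  apply SetLike.coe_injective
  rw [Subfield.coe_top]
  refine Set.eq_of_subset_of_ncard_le (Set.subset_univ _) ?_ Set.finite_univ
  rw [Set.ncard_univ]
  exact hc

/-- An element of `F` satisfies `r ^ q = r`, so `r ^ (q + 1) = 1` would give `r ^ 2 = 1`. -/
theorem algebraMap_ne_of_orderOf_eq {ζ : F̄} (ho : orderOf ζ = Nat.card F + 1) (r : F) :
    algebraMap F F̄ r ≠ ζ := by
  rintro rfl
  have hq : 1 < Nat.card F := Finite.one_lt_card
  have h1 : algebraMap F F̄ r ^ 2 = 1 := by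
    rw [← pow_orderOf_eq_one (algebraMap F F̄ r), ho, pow_succ _ (Nat.card F),
      ← map_pow _ r (Nat.card F), pow_natCard, pow_two]
  have := Nat.le_of_dvd two_pos (orderOf_dvd_of_pow_eq_one h1)
  omega

/-- A subgroup of `SL(2, q)` containing a cyclic group of order `q + 1` and a nontrivial upper
unipotent matrix is everything, if `q ≠ 9` and the unipotent matrix is not inverted by an involution
normalizing the cyclic group. -/
theorem SL2.eq_top_of_companion_mem {ζ : F̄} {α : F} (h0 : ζ ≠ 0)
    (ho : orderOf ζ = Nat.card F + 1) (hα : ζ + ζ⁻¹ = algebraMap F F̄ α) {K : Subgroup SL(2, F)}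
    (hx : companion α ∈ K) {f : F} (hf : f ≠ 0) (hu : up f ∈ K) (h2f : (2 : F) ≠ 0 ∨ f + α ≠ 0)
    (hq9 : Nat.card F ≠ 9) : K = ⊤ := by
  classical
  have := Fintype.ofFinite F
  set Λ := upSubgroup K with hΛ
  suffices hk : Λ.multipliers = ⊤ by
    refine eq_top_of_up (fun z => ?_) hx (by simp [companion])
    have h1 : z / f ∈ Λ.multipliers := hk ▸ Subfield.mem_top _
    have h2 := AddSubgroup.mem_multipliers.1 h1 f hu
    rwa [div_mul_cancel₀ _ hf] at h2
  by_contra hk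
  obtain ⟨d, hd, hcard⟩ := Subfield.exists_card_eq_pow hk
  set k := Λ.multipliers
  -- The norm form, which the torus preserves, at the vector `(r, 1)`; it is anisotropic. In `P`
  -- below, transvections along `(r, 1)` are normalized by this value, so that `P r` depends only on
  -- the square class of `g r` (`hB`), while `up f` moves `r` to `r + f` at the cost of the factor
  -- `ρ r` (`hA`).
  set g : F → F := fun r => r ^ 2 + α * r + 1 with hg
  have hg0 : ∀ r, g r ≠ 0 := by
    intro r h
    have h1 := congrArg (algebraMap F F̄) h
    simp only [hg, map_add, map_mul, map_pow, map_one, map_zero, ← hα] at h1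
    have h2 : (algebraMap F F̄ r + ζ) * (algebraMap F F̄ r + ζ⁻¹) = 0 := by
      rw [← h1]
      field_simp
      ring
    rcases mul_eq_zero.1 h2 with h3 | h3
    · refine algebraMap_ne_of_orderOf_eq ho (-r) ?_
      rw [map_neg]
      linear_combination -h3
    · refine algebraMap_ne_of_orderOf_eq (ζ := ζ⁻¹) (by
        rw [← ho]
        exact orderOf_eq_orderOf_iff.2 fun n => by rw [inv_pow, inv_eq_one]) (-r) ?_
      rw [map_neg]
      linear_combination -h3
  let ρ : F → F := fun r => g (r + f) / g r
  have hρ0 : ∀ r, ρ r ≠ 0 := fun r => div_ne_zero (hg0 _) (hg0 _)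
  let P : F → F → Prop := fun r δ => trv r 1 (δ / g r) ∈ K
  have hA : ∀ r δ, P r δ ↔ P (r + f) (ρ r * δ) := by
    intro r δ
    have h1 := trv_mem_iff hu r 1 (δ / g r)
    have h2 : ρ r * δ / g (r + f) = δ / g r := by
      have := hg0 r
      have := hg0 (r + f)
      simp only [ρ]
      field_simp
    simp only [P]
    rw [h1, h2]
    simp
  have hB : ∀ r r' δ, (IsSquare (g r) ↔ IsSquare (g r')) → (P r δ ↔ P r' δ) := by
    intro r r' δ h
    have hn := hg0 r'
    obtain ⟨t, ht⟩ : IsSquare (g r * g r') := by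
      by_cases hs : IsSquare (g r)
      · exact hs.mul (h.1 hs)
      · exact isSquare_mul_of_not_isSquare hs (mt h.2 hs)
    have ht0 : t ≠ 0 := by
      rintro rfl
      rw [mul_zero] at ht
      exact mul_ne_zero (hg0 r) hn ht
    set c := t / g r' with hc
    have hc0 : c ≠ 0 := div_ne_zero ht0 hn
    have hc2 : g r = c ^ 2 * g r' := by
      rw [hc]
      field_simp
      linear_combination ht
    have hmem := mem_of_companion_mem h0 ho hα hx (r := (r * (r' + α) + 1) / (c * g r'))
      (s := (r' - r) / (c * g r')) (by
        field_simp
        refine Eq.trans ?_ (show g r * g r' = c ^ 2 * g r' ^ 2 by rw [hc2]; ring)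
        simp only [hg]
        ring)
    have h1 := trv_mem_iff hmem r' 1 (δ / g r')
    have e1 : (r * (r' + α) + 1) / (c * g r') * r' + -((r' - r) / (c * g r')) * 1 = c⁻¹ * r := by
      field_simp
      simp only [hg]
      ring
    have e2 : (r' - r) / (c * g r') * r' +
        ((r * (r' + α) + 1) / (c * g r') + α * ((r' - r) / (c * g r'))) * 1 = c⁻¹ * 1 := by
      field_simp
      simp only [hg]
      ring
    simp only [ofEntries_apply] at h1
    rw [e1, e2, trv_mul_mul] at h1
    simp only [P]
    rw [h1, hc2]
    have : δ / (c ^ 2 * g r') = c⁻¹ ^ 2 * (δ / g r') := by field_simp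
    rw [this]
  have hP0 : ∀ r δ, IsSquare (g r) → (P r δ ↔ δ ∈ Λ) := by
    intro r δ hr
    have hg00 : g 0 = 1 := by simp [hg]
    rw [hB r 0 δ (iff_of_true hr (by rw [hg00]; exact IsSquare.one)), hΛ, mem_upSubgroup,
      ← trv_one_zero, trv_mem_iff hx 1 0 δ]
    simp [P, companion, hg00]
  have hsq : ∀ r, IsSquare (g r) → IsSquare (g (r + f)) → ρ r ∈ k := by
    intro r h1 h2 δ hδ
    rw [← hP0 _ _ h2, ← hA, hP0 _ _ h1]
    exact hδ
  -- The equation `ρ r = ρ r₀` is quadratic in `r` with known root `r₀`. Hypothesis `h2f` excludes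
  -- the degenerate case of characteristic 2 and `f = α`, where `ρ` is constant.
  have hfib : ∀ z, (Finset.univ.filter fun r => ρ r = z).card ≤ 2 := by
    intro z
    by_cases hne : ∃ r₀, ρ r₀ = z
    · obtain ⟨r₀, rfl⟩ := hne
      refine (Finset.card_le_card
        (t := {r₀, (2 - (f + α) * r₀ - (f + α) * α) / (2 * r₀ + (f + α))}) fun r hr => ?_).trans
          Finset.card_le_two
      have h1 : ρ r = ρ r₀ := (Finset.mem_filter.1 hr).2
      simp only [ρ] at h1
      rw [div_eq_div_iff (hg0 _) (hg0 _)] at h1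
      have h3 : f * ((2 * r + (f + α)) * g r₀ - (2 * r₀ + (f + α)) * g r) = 0 := by
        simp only [hg] at h1 ⊢
        linear_combination h1
      have h3 := (mul_eq_zero.1 h3).resolve_left hf
      rw [Finset.mem_insert, Finset.mem_singleton]
      by_cases h4 : 2 * r₀ + (f + α) = 0
      · left
        rw [h4, zero_mul, sub_zero] at h3
        have h5 := (mul_eq_zero.1 h3).resolve_right (hg0 _)
        have h20 : (2 : F) ≠ 0 := by
          rcases h2f with h | h
          · exact h
          · intro h'
            rw [h', zero_mul, zero_add] at h4
            exact h h4
        apply mul_left_cancel₀ h20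
        linear_combination h5 - h4
      · have h5 : (r - r₀) * (r * (2 * r₀ + (f + α)) - (2 - (f + α) * r₀ - (f + α) * α)) = 0 := by
          simp only [hg] at h3
          linear_combination -h3
        rcases mul_eq_zero.1 h5 with h6 | h6
        · exact Or.inl (sub_eq_zero.1 h6)
        · right
          rw [eq_div_iff h4]
          exact sub_eq_zero.1 h6
    · rw [Finset.card_eq_zero.2]
      · omega
      · rw [Finset.filter_eq_empty_iff]
        exact fun r _ h => hne ⟨r, h⟩
  have hcount : ∀ S V : Finset F, (∀ r ∈ S, ρ r ∈ V) → S.card ≤ 2 * V.card := fun S V h =>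
    Finset.card_le_mul_card_image_of_maps_to h 2 fun v _ =>
      (Finset.card_le_card (Finset.filter_subset_filter _ (Finset.subset_univ _))).trans (hfib v)
  let U : Finset F := (Finset.univ.filter (· ∈ k)).erase 0
  have hU : U.card + 1 = Nat.card k := by
    rw [Finset.card_erase_add_one (by simp [k.zero_mem]), ← Set.ncard_coe_finset]
    simp only [Finset.coe_filter, Finset.mem_univ, true_and]
    rfl
  have hmemU : ∀ z, z ≠ 0 → z ∈ k → z ∈ U := fun z h1 h2 => by simp [U, h1, h2]
  have hqc : Nat.card k ^ 2 ≤ Nat.card F := by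
    rw [hcard]
    exact Nat.pow_le_pow_right Nat.card_pos hd
  have hFc : (Finset.univ : Finset F).card = Nat.card F := by rw [Finset.card_univ, Nat.card_eq_fintype_card]
  by_cases h2 : (2 : F) = 0
  · have hall : ∀ z : F, IsSquare z := fun z => by
      refine FiniteField.isSquare_of_char_two ?_ z
      have : CharP F 2 := CharTwo.of_one_ne_zero_of_two_eq_zero one_ne_zero h2
      exact ringChar.eq F 2
    have h3 := hcount Finset.univ U fun r _ => hmemU _ (hρ0 r) (hsq r (hall _) (hall _))
    rw [hFc] at h3
    nlinarith
  · have hle : Nat.card F ≤ 6 * U.card := by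
      by_cases htr : ∀ r, IsSquare (g r) → IsSquare (g (r + f))
      · let S : Finset F := Finset.univ.filter fun r => IsSquare (g r)
        have h3 := hcount S U fun r hr =>
          hmemU _ (hρ0 r) (hsq r (Finset.mem_filter.1 hr).2 (htr r (Finset.mem_filter.1 hr).2))
        -- A rational parametrization of the conic `g r = w ^ 2`: it is at most two-to-one on
        -- nonzero `t`, so `g` is a square at least `(q - 1) / 2` times.
        let φ : F → F := fun t => ((1 - α ^ 2 / 4) / t - t - α) / 2
        have h40 : (4 : F) ≠ 0 := by
          rw [show (4 : F) = 2 * 2 by norm_num]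
          exact mul_ne_zero h2 h2
        have h4 : (Finset.univ.erase (0 : F)).card ≤ 2 * S.card := by
          refine Finset.card_le_mul_card_image_of_maps_to (f := φ) (fun t ht => ?_) 2 fun r _ => ?_
          · have ht0 := Finset.ne_of_mem_erase ht
            refine Finset.mem_filter.2 ⟨Finset.mem_univ _, (t + (1 - α ^ 2 / 4) / t) / 2, ?_⟩
            simp only [hg, φ]
            field_simp
            ring
          · by_cases hne : ∃ t₀ ∈ Finset.univ.erase (0 : F), φ t₀ = r
            · obtain ⟨t₀, ht₀, rfl⟩ := hne
              have ht₀ := Finset.ne_of_mem_erase ht₀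
              refine (Finset.card_le_card (t := {t₀, -(1 - α ^ 2 / 4) / t₀}) fun t ht => ?_).trans
                Finset.card_le_two
              obtain ⟨ht, htφ⟩ := Finset.mem_filter.1 ht
              have ht0 := Finset.ne_of_mem_erase ht
              have h5 : (t - t₀) * (t * t₀ + (1 - α ^ 2 / 4)) = 0 := by
                simp only [φ] at htφ
                field_simp at htφ ⊢
                linear_combination -htφ
              rw [Finset.mem_insert, Finset.mem_singleton]
              rcases mul_eq_zero.1 h5 with h6 | h6
              · exact Or.inl (sub_eq_zero.1 h6)
              · right
                rw [eq_div_iff ht₀]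
                linear_combination h6
            · rw [Finset.card_eq_zero.2]
              · omega
              · rw [Finset.filter_eq_empty_iff]
                exact fun t ht h => hne ⟨t, ht, h⟩
        rw [Finset.card_erase_of_mem (Finset.mem_univ _), hFc] at h4
        have : 1 < Nat.card k := Finite.one_lt_card
        omega
      · push Not at htr
        obtain ⟨r₀, hr₀, hr₀'⟩ := htr
        set m := ρ r₀ with hm
        have hm0 : m ≠ 0 := hρ0 r₀
        have hP1 : ∀ r η, ¬ IsSquare (g r) → (P r η ↔ m⁻¹ * η ∈ Λ) := by
          intro r η hr
          rw [hB r (r₀ + f) η (iff_of_false hr hr₀'), ← hP0 r₀ _ hr₀, hA r₀, ← hm,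
            mul_inv_cancel_left₀ hm0]
        -- The nonsquare class belongs to the group `m * Λ`, so each `ρ r` is in `k`, `m * k` or
        -- `m⁻¹ * k`, according to the classes of `g r` and `g (r + f)`.
        have h3 := hcount Finset.univ (U ∪ U.image (m * ·) ∪ U.image (m⁻¹ * ·)) fun r _ => by
          simp only [Finset.mem_union, Finset.mem_image]
          by_cases h1 : IsSquare (g r) <;> by_cases h2 : IsSquare (g (r + f))
          · exact Or.inl (Or.inl (hmemU _ (hρ0 r) (hsq r h1 h2)))
          · refine Or.inl (Or.inr ⟨m⁻¹ * ρ r, hmemU _ (mul_ne_zero (inv_ne_zero hm0) (hρ0 r)) ?_,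
              mul_inv_cancel_left₀ hm0 _⟩)
            intro δ hδ
            rw [mul_assoc, ← hP1 _ _ h2, ← hA, hP0 _ _ h1]
            exact hδ
          · refine Or.inr ⟨m * ρ r, hmemU _ (mul_ne_zero hm0 (hρ0 r)) ?_,
              inv_mul_cancel_left₀ hm0 _⟩
            intro δ hδ
            rw [mul_right_comm, mul_comm, ← hP0 _ _ h2, ← hA, hP1 _ _ h1,
              inv_mul_cancel_left₀ hm0]
            exact hδ
          · refine Or.inl (Or.inl (hmemU _ (hρ0 r) ?_))
            intro δ hδ
            have h4 := (hA r (m * δ)).1 ((hP1 r _ h1).2 (by rwa [inv_mul_cancel_left₀ hm0]))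
            rw [hP1 _ _ h2] at h4
            convert h4 using 1
            field_simp
        have h4 := Finset.card_union_le (U ∪ U.image (m * ·)) (U.image (m⁻¹ * ·))
        have h5 := Finset.card_union_le U (U.image (m * ·))
        have h6 : (U.image (m * ·)).card ≤ U.card := Finset.card_image_le
        have h7 : (U.image (m⁻¹ * ·)).card ≤ U.card := Finset.card_image_le
        omega
    have hodd : Nat.card F % 2 = 1 := by
      rw [Nat.card_eq_fintype_card]
      exact FiniteField.odd_card_of_char_ne_two fun h => h2 (by
        have : CharP F 2 := ringChar.of_eq h
        exact CharTwo.two_eq_zero)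
    set c := Nat.card k
    -- From `c ^ 2 ≤ q ≤ 6 * (c - 1)`. With `q` odd only `c = 3` survives, and then `q = 9`, which
    -- is excluded.
    have hc4 : c ≤ 4 := by
      by_contra! h
      nlinarith
    have hc1 : 1 < c := Finite.one_lt_card
    have hc3 : c = 3 := by
      interval_cases c
      · rw [hcard, Nat.pow_mod, Nat.mod_self, zero_pow (by omega)] at hodd
        omega
      · rfl
      · rw [hcard, Nat.pow_mod, show 4 % 2 = 0 from rfl, zero_pow (by omega)] at hodd
        omega
    rw [hc3] at hcard hqc hU
    rcases Nat.lt_or_ge 2 d with h | h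
    · have := Nat.pow_le_pow_right (n := 3) (by norm_num) h
      omega
    · obtain rfl : d = 2 := by omega
      omega

/-- The product `up f * companion α` has trace `f + α`. In odd characteristic `f = -2 * α` makes
this `-α`; in characteristic 2, `f = α ^ 2 - α` makes it the trace of `ζ ^ 2`, which still has order
`q + 1` because that number is odd. -/
theorem realizes_nonsplit {p : ℕ} [Fact p.Prime] [CharP F p] (hq : 7 ≤ Nat.card F)
    (hq9 : Nat.card F ≠ 9) {N : ℕ} :
    Realizes (ProjectiveSpecialLinearGroup (Fin 2) F) ![nonsplitOrder (Nat.card F), N, p]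
      ![0, 0, 2] := by
  obtain ⟨ζ, α, h0, ho, hα, htr⟩ := exists_nonsplit_root (F := F) (by omega)
  have hns := lt_nonsplitOrder (q := Nat.card F) (by omega)
  have hα0 := htr.ne_zero hns
  obtain ⟨f, hf, h2f, hord⟩ : ∃ f : F, f ≠ 0 ∧ ((2 : F) ≠ 0 ∨ f + α ≠ 0) ∧
      ForcesOrder (f + α) (nonsplitOrder (Nat.card F)) := by
    by_cases h2 : (2 : F) = 0
    · have hodd : Odd (Nat.card F + 1) := by
        refine Even.add_one ?_
        have : CharP F 2 := CharTwo.of_one_ne_zero_of_two_eq_zero one_ne_zero h2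
        have := Fintype.ofFinite F
        rw [Nat.card_eq_fintype_card]
        exact Nat.even_iff.2 (FiniteField.even_card_of_char_two (ringChar.eq F 2))
      have h2' : (2 : F̄) = 0 := by
        rw [← map_ofNat (algebraMap F F̄) 2, h2, map_zero]
      have h4 : orderOf (ζ ^ 4) = Nat.card F + 1 := by
        rw [orderOf_pow' ζ (by norm_num), ho, Nat.Coprime.gcd_eq_one, Nat.div_one]
        exact Nat.Coprime.pow_right 2 (Nat.coprime_two_right.2 hodd)
      have hne : nonsplitOrder (Nat.card F) = Nat.card F + 1 :=
        nonsplitOrder_of_even (Nat.not_odd_iff_even.1 fun h => by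
          have := h.add_one
          exact Nat.not_even_iff_odd.2 hodd this)
      refine ⟨α ^ 2 - α, ?_, Or.inr (by rw [sub_add_cancel]; exact pow_ne_zero _ hα0), ?_⟩
      · intro h
        have h1 : α = 1 := by
          apply mul_left_cancel₀ hα0
          linear_combination h
        rw [h1, map_one] at hα
        have h3 : ζ ^ 3 = 1 := by
          field_simp at hα
          linear_combination (ζ + 1) * hα - h2'
        have := Nat.le_of_dvd (by norm_num) (orderOf_dvd_of_pow_eq_one h3)
        omega
      · rw [sub_add_cancel]
        refine TraceOrder.forcesOrder ⟨ζ ^ 2, pow_ne_zero _ h0, ?_, ?_, ?_⟩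
        · rw [← pow_mul]
          intro h
          have := Nat.le_of_dvd (by norm_num) (orderOf_dvd_of_pow_eq_one h)
          omega
        · rw [← pow_mul, h4, hne]
        · rw [map_pow, ← hα]
          field_simp
          linear_combination (-(ζ ^ 2)) * h2'
    · refine ⟨-2 * α, mul_ne_zero (neg_ne_zero.2 h2) hα0, Or.inl h2, ?_⟩
      rw [show -2 * α + α = -α by ring]
      exact htr.neg.forcesOrder
  refine (realizes_of_closure_eq_top (x := up f) (y := companion α) (t₀ := 2) (t₁ := 0) (t₂ := 0)
    ?_ ?_ ?_ ?_).rotate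
  · exact SL2.eq_top_of_companion_mem h0 ho hα
      (Subgroup.subset_closure (Set.mem_insert_of_mem _ rfl)) hf
      (Subgroup.subset_closure (Set.mem_insert _ _)) h2f hq9
  · simpa [one_add_one_eq_two] using forcesOrder_two (F := F) (p := p)
  · simpa [companion] using htr.forcesOrder
  · simpa [companion, mul_apply_two] using hord

end NonsplitTorus

/-! ### Explicit triples over the fields with 7, 9 and 11 elements. -/

section SmallFields

variable {F : Type*} [Field F]

local notation "F̄" => AlgebraicClosure F

theorem natCast_algebraicClosure_ne_zero {m : ℕ} (h : (m : F) ≠ 0) : (m : F̄) ≠ 0 := by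
  rw [← map_natCast (algebraMap F F̄)]
  exact (map_ne_zero _).2 h

/-- Since `τ ^ 2 - 2 = ζ ^ 2 + ζ⁻¹ ^ 2`, the condition on `τ` is a cyclotomic equation for `ζ ^ 2`;
the next lemmas work in the same way. -/
theorem traceOrder_three {τ : F} (h : τ ^ 2 = 1) (h3 : ((3 : ℕ) : F) ≠ 0) : TraceOrder τ 3 := by
  obtain ⟨ζ, h0, hζ⟩ := exists_add_inv_eq τ
  have h := congrArg (algebraMap F F̄) h
  rw [map_pow, ← hζ, map_one] at h
  have e : ζ ^ 4 + ζ ^ 2 + 1 = 0 := by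
    field_simp at h
    linear_combination h
  have hne : ζ ^ 2 ≠ 1 := fun h1 => natCast_algebraicClosure_ne_zero h3 (by
    push_cast
    linear_combination e - (ζ ^ 2 + 2) * h1)
  exact ⟨ζ, h0, hne, orderOf_eq_prime (by linear_combination (ζ ^ 2 - 1) * e) hne, hζ⟩

theorem traceOrder_four {τ : F} (h : τ ^ 2 = 2) (h2 : ((2 : ℕ) : F) ≠ 0) : TraceOrder τ 4 := by
  obtain ⟨ζ, h0, hζ⟩ := exists_add_inv_eq τ
  have h := congrArg (algebraMap F F̄) h
  rw [map_pow, ← hζ, map_ofNat] at h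
  have e : ζ ^ 4 + 1 = 0 := by
    field_simp at h
    linear_combination h
  have h2 := natCast_algebraicClosure_ne_zero h2
  push_cast at h2
  refine ⟨ζ, h0, fun h1 => h2 ?_, ?_, hζ⟩
  · linear_combination e - (ζ ^ 2 + 1) * h1
  · refine orderOf_eq_prime_pow (p := 2) (n := 1) (fun h1 => h2 ?_) ?_
    · linear_combination e - h1
    · linear_combination (ζ ^ 4 - 1) * e

theorem traceOrder_five {τ : F} (h : (τ ^ 2 - 2) ^ 2 + (τ ^ 2 - 2) = 1) (h5 : ((5 : ℕ) : F) ≠ 0) :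
    TraceOrder τ 5 := by
  obtain ⟨ζ, h0, hζ⟩ := exists_add_inv_eq τ
  have h := congrArg (algebraMap F F̄) h
  rw [map_add, map_pow, map_sub, map_pow, ← hζ, map_one, map_ofNat] at h
  have e : ζ ^ 8 + ζ ^ 6 + ζ ^ 4 + ζ ^ 2 + 1 = 0 := by
    field_simp at h
    linear_combination h
  have hne : ζ ^ 2 ≠ 1 := fun h1 => natCast_algebraicClosure_ne_zero h5 (by
    push_cast
    linear_combination e - (ζ ^ 6 + 2 * ζ ^ 4 + 3 * ζ ^ 2 + 4) * h1)
  have : Fact (Nat.Prime 5) := ⟨by norm_num⟩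
  exact ⟨ζ, h0, hne, orderOf_eq_prime (by linear_combination (ζ ^ 2 - 1) * e) hne, hζ⟩

theorem traceOrder_six {τ : F} (h : τ ^ 2 = 3) (h2 : ((2 : ℕ) : F) ≠ 0) (h3 : ((3 : ℕ) : F) ≠ 0) :
    TraceOrder τ 6 := by
  obtain ⟨ζ, h0, hζ⟩ := exists_add_inv_eq τ
  have h := congrArg (algebraMap F F̄) h
  rw [map_pow, ← hζ, map_ofNat] at h
  have e : ζ ^ 4 - ζ ^ 2 + 1 = 0 := by
    field_simp at h
    linear_combination h
  have h2 := natCast_algebraicClosure_ne_zero h2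
  have h3 := natCast_algebraicClosure_ne_zero h3
  push_cast at h2 h3
  refine ⟨ζ, h0, fun h1 => one_ne_zero (α := F̄) ?_, ?_, hζ⟩
  · linear_combination e - ζ ^ 2 * h1
  · refine orderOf_eq_of_pow_and_pow_div_prime (by norm_num) ?_ fun p hp hp6 => ?_
    · linear_combination (ζ ^ 2 + 1) * (ζ ^ 6 - 1) * e
    · have hle := Nat.le_of_dvd (by norm_num) hp6
      interval_cases p
      · exact absurd hp (by norm_num)
      · exact absurd hp (by norm_num)
      · rw [show 6 / 2 = 3 from rfl]
        exact fun h1 => h2 (by linear_combination (ζ ^ 2 + 1) * e - h1)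
      · rw [show 6 / 3 = 2 from rfl]
        exact fun h1 => h3 (by linear_combination (2 + ζ ^ 2) * (e - h1) + h1)
      · exact absurd hp (by norm_num)
      · omega
      · exact absurd hp (by norm_num)


local notation "PSL₂" => ProjectiveSpecialLinearGroup (Fin 2) F

/-- The pair of generators `up f` and a matrix of trace `τ` whose product has trace `γ`. -/
theorem realizes_of_up {n : Fin 3 → ℕ} {t₀ t₁ t₂ : Fin 3} {f b c τ : F}
    (hbc : 0 * τ - b * c = 1) (h : Subgroup.closure {up f, ofEntries 0 b c τ hbc} = ⊤)
    (h₀ : ForcesOrder (2 : F) (n t₀)) (h₁ : ForcesOrder τ (n t₁))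
    (h₂ : ForcesOrder (f * c + τ) (n t₂)) : Realizes PSL₂ n ![t₀, t₁, t₂] :=
  realizes_of_closure_eq_top h (by simpa [one_add_one_eq_two] using h₀) (by simpa using h₁)
    (by simpa [mul_apply_two] using h₂)

section PrimeField

variable {p : ℕ} [Fact p.Prime] [CharP F p]

/-- Over a prime field the powers of `up 1` are the whole root subgroup. -/
theorem SL2.eq_top_of_up_one_mem (hp : Nat.card F = p) {K : Subgroup SL(2, F)} (hu : up 1 ∈ K)
    {g : SL(2, F)} (hg : g ∈ K) (h10 : g 1 0 ≠ 0) : K = ⊤ := by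
  refine eq_top_of_up (fun z => ?_) hg h10
  have : Finite F := Nat.finite_of_card_ne_zero (hp ▸ (Fact.out : p.Prime).ne_zero)
  have := Fintype.ofFinite F
  obtain ⟨m, rfl⟩ := (ZMod.castHom_bijective F (n := p)
    (by rw [← hp, Nat.card_eq_fintype_card])).surjective z
  have h1 : ((ZMod.castHom (dvd_refl p) F) m) = m.val • (1 : F) := by simp
  rw [h1]
  exact AddSubgroup.nsmul_mem (upSubgroup K) hu _

theorem realizes_prime (hp : Nat.card F = p) {n : Fin 3 → ℕ} {t₀ t₁ t₂ : Fin 3} (τ γ : F)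
    (hne : γ - τ ≠ 0) (h₀ : n t₀ = p) (h₁ : ForcesOrder τ (n t₁))
    (h₂ : ForcesOrder γ (n t₂)) : Realizes PSL₂ n ![t₀, t₁, t₂] := by
  refine realizes_of_up (f := 1) (b := -(γ - τ)⁻¹) (c := γ - τ) (by simp [hne]) (SL2.eq_top_of_up_one_mem hp
    (Subgroup.subset_closure (Set.mem_insert _ _))
    (Subgroup.subset_closure (Set.mem_insert_of_mem _ rfl)) (by simpa using hne)) ?_ h₁ (by simpa)
  rw [h₀]
  exact forcesOrder_two

/-- Triples containing no unipotent elements. -/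
theorem realizes_prime' (hp : Nat.card F = p) {n : Fin 3 → ℕ} {t₀ t₁ t₂ : Fin 3} (τ γ : F)
    (hne : γ - τ ≠ 0) (h₀ : ForcesOrder γ (n t₀)) (h₁ : ForcesOrder τ (n t₁))
    (h₂ : ForcesOrder (τ * γ - 2) (n t₂)) : Realizes PSL₂ n ![t₀, t₁, t₂] := by
  have hdet : 0 * τ - -(γ - τ)⁻¹ * (γ - τ) = 1 := by field_simp; ring
  set y : SL(2, F) := ofEntries 0 (-(γ - τ)⁻¹) (γ - τ) τ hdet with hy
  have hymem : y ∈ Subgroup.closure {up 1 * y, y} :=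
    Subgroup.subset_closure (Set.mem_insert_of_mem _ rfl)
  have humem : up 1 ∈ Subgroup.closure {up 1 * y, y} := by
    have := Subgroup.mul_mem _ (Subgroup.subset_closure (Set.mem_insert _ _))
      (Subgroup.inv_mem _ hymem)
    rwa [mul_inv_cancel_right] at this
  refine realizes_of_closure_eq_top (x := up 1 * y) (y := y)
    (SL2.eq_top_of_up_one_mem hp humem hymem (by simpa [hy] using hne)) ?_ (by simpa [hy]) ?_
  · simpa [mul_apply_two, hy]
  -- With `u = up 1`, Cayley–Hamilton for `y` gives that `u * y * y` has trace `τ * γ - 2`.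
  · convert h₂ using 1
    simp [mul_apply_two, hy]
    field_simp
    ring

end PrimeField

/-- Here the split order 3 comes first and the nonsplit order 4 second, so that the type `(1, 1, 1)`
is hyperbolic. -/
theorem realizes_seven [CharP F 7] (hq : Nat.card F = 7) :
    let n := ![3, 4, 7]
    Realizes PSL₂ n ![0, 1, 2] ∧ Realizes PSL₂ n ![1, 0, 2] ∧ Realizes PSL₂ n ![0, 0, 2] ∧
      Realizes PSL₂ n ![1, 1, 1] := by
  intro n
  have : Fact (Nat.Prime 7) := ⟨by norm_num⟩
  have hne : ∀ m : ℕ, ¬ 7 ∣ m → (m : F) ≠ 0 := fun m => mt (CharP.cast_eq_zero_iff F 7 m).1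
  have h7 : (7 : F) = 0 := by exact_mod_cast CharP.cast_eq_zero F 7
  have h1 : ForcesOrder (1 : F) (n 0) :=
    (traceOrder_three (by ring) (hne 3 (by norm_num))).forcesOrder
  have h1' : ForcesOrder (-1 : F) (n 0) :=
    (traceOrder_three (by ring) (hne 3 (by norm_num))).forcesOrder
  have h3 : ForcesOrder (3 : F) (n 1) :=
    (traceOrder_four (by linear_combination h7) (hne 2 (by norm_num))).forcesOrder
  have h4 : ForcesOrder (4 : F) (n 1) :=
    (traceOrder_four (by linear_combination 2 * h7) (hne 2 (by norm_num))).forcesOrder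
  have h2 := hne 2 (by norm_num)
  push_cast at h2
  refine ⟨(realizes_prime (t₀ := 2) (t₁ := 0) (t₂ := 1) hq 1 3 ?_ rfl h1 h3).rotate,
    (realizes_prime (t₀ := 2) (t₁ := 1) (t₂ := 0) hq 3 1 ?_ rfl h3 h1).rotate,
    (realizes_prime (t₀ := 2) (t₁ := 0) (t₂ := 0) hq 1 (-1) ?_ rfl h1 h1').rotate,
    realizes_prime' (t₀ := 1) (t₁ := 1) (t₂ := 1) hq 3 4 ?_ h4 h3 ?_⟩
  · exact fun h => h2 (by linear_combination h)
  · exact fun h => h2 (by linear_combination -h)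
  · exact fun h => h2 (by linear_combination -h)
  · norm_num
  · rwa [show (3 * 4 - 2 : F) = 3 by linear_combination h7]

theorem realizes_eleven [CharP F 11] (hq : Nat.card F = 11) :
    let n := ![6, 5, 11]
    Realizes PSL₂ n ![0, 1, 2] ∧ Realizes PSL₂ n ![1, 0, 2] ∧ Realizes PSL₂ n ![0, 0, 2] ∧
      Realizes PSL₂ n ![1, 1, 1] := by
  intro n
  have : Fact (Nat.Prime 11) := ⟨by norm_num⟩
  have hne : ∀ m : ℕ, ¬ 11 ∣ m → (m : F) ≠ 0 := fun m => mt (CharP.cast_eq_zero_iff F 11 m).1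
  have h11 : (11 : F) = 0 := by exact_mod_cast CharP.cast_eq_zero F 11
  have h5 : ForcesOrder (5 : F) (n 0) := (traceOrder_six (by linear_combination 2 * h11)
    (hne 2 (by norm_num)) (hne 3 (by norm_num))).forcesOrder
  have h6 : ForcesOrder (6 : F) (n 0) := (traceOrder_six (by linear_combination 3 * h11)
    (hne 2 (by norm_num)) (hne 3 (by norm_num))).forcesOrder
  have h4 : ForcesOrder (4 : F) (n 1) :=
    (traceOrder_five (by linear_combination 19 * h11) (hne 5 (by norm_num))).forcesOrder
  have h8 : ForcesOrder (8 : F) (n 1) :=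
    (traceOrder_five (by linear_combination 355 * h11) (hne 5 (by norm_num))).forcesOrder
  have h4' := hne 4 (by norm_num)
  push_cast at h4'
  refine ⟨(realizes_prime (t₀ := 2) (t₁ := 0) (t₂ := 1) hq 5 4 ?_ rfl h5 h4).rotate,
    (realizes_prime (t₀ := 2) (t₁ := 1) (t₂ := 0) hq 4 5 ?_ rfl h4 h5).rotate,
    (realizes_prime (t₀ := 2) (t₁ := 0) (t₂ := 0) hq 5 6 ?_ rfl h5 h6).rotate,
    realizes_prime' (t₀ := 1) (t₁ := 1) (t₂ := 1) hq 4 8 ?_ h8 h4 ?_⟩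
  · norm_num
  · norm_num
  · norm_num
  · exact fun h => h4' (by linear_combination h)
  · rwa [show (4 * 8 - 2 : F) = 8 by linear_combination 2 * h11]

/-- A criterion for subgroups of `SL(2, 9)`. -/
theorem SL2.eq_top_of_card_nine [CharP F 3] (hq : Nat.card F = 9) {K : Subgroup SL(2, F)} {f : F}
    (hf : f ≠ 0) (hu : up f ∈ K) {g : SL(2, F)} (hg : g ∈ K) (hg10 : g 1 0 = 0)
    (hg4 : g 0 0 ^ 4 = -1) {h : SL(2, F)} (hh : h ∈ K) (h10 : h 1 0 ≠ 0) : K = ⊤ := by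
  have : Finite F := Nat.finite_of_card_ne_zero (by omega)
  have h3 : (3 : F) = 0 := by exact_mod_cast CharP.cast_eq_zero F 3
  have hd := det_eq g
  rw [hg10, mul_zero, sub_zero] at hd
  have hmem : g 0 0 ^ 2 ∈ (upSubgroup K).multipliers := by
    intro z hz
    have := K.mul_mem (K.mul_mem hg hz) (K.inv_mem hg)
    rw [mem_upSubgroup]
    convert this using 1
    apply ext_two <;> simp [mul_apply_two, inv_apply_two, hg10]
    · linear_combination -hd
    · ring
    · linear_combination -hd
  -- A proper subfield has three elements, but the multiplier `g 0 0 ^ 2` squares to `-1`, hence is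
  -- not in it.
  have htop : (upSubgroup K).multipliers = ⊤ := by
    by_contra hne
    obtain ⟨d, hd2, hcard⟩ := Subfield.exists_card_eq_pow hne
    set k := (upSubgroup K).multipliers
    have hc : Nat.card k = 3 := by
      have hle : Nat.card k ^ 2 ≤ 9 := by
        rw [← hq, hcard]
        exact Nat.pow_le_pow_right Nat.card_pos hd2
      have h1 : 1 < Nat.card k := Finite.one_lt_card
      have h4 : Nat.card k < 4 := by nlinarith
      have h2 : Nat.card k ≠ 2 := by
        intro h
        have := congrArg (· % 2) hcard
        simp only [hq, h, Nat.pow_mod, Nat.mod_self, zero_pow (show d ≠ 0 by omega)] at this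
        omega
      omega
    have h1 := congrArg Subtype.val (pow_natCard (⟨_, hmem⟩ : k))
    rw [hc, SubmonoidClass.coe_pow] at h1
    have h2 : (g 0 0 ^ 2) * (g 0 0 ^ 4 - 1) = 0 := by linear_combination h1
    rw [hg4] at h2
    have h4 : g 0 0 ≠ 0 := left_ne_zero_of_mul_eq_one hd
    apply pow_ne_zero 2 h4
    linear_combination h2 + g 0 0 ^ 2 * h3
  refine eq_top_of_up (fun z => ?_) hh h10
  have h1 : z / f ∈ (upSubgroup K).multipliers := htop ▸ Subfield.mem_top _
  have h2 := AddSubgroup.mem_multipliers.1 h1 f hu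
  rwa [div_mul_cancel₀ _ hf] at h2

theorem realizes_nine [CharP F 3] (hq : Nat.card F = 9) :
    let n := ![5, 4, 3]
    Realizes PSL₂ n ![0, 1, 2] ∧ Realizes PSL₂ n ![1, 0, 2] ∧ Realizes PSL₂ n ![0, 0, 2] ∧
      Realizes PSL₂ n ![1, 1, 1] := by
  intro n
  have : Finite F := Nat.finite_of_card_ne_zero (by omega)
  have := Fintype.ofFinite F
  have : Fact (Nat.Prime 3) := ⟨by norm_num⟩
  have hne : ∀ m : ℕ, ¬ 3 ∣ m → (m : F) ≠ 0 := fun m => mt (CharP.cast_eq_zero_iff F 3 m).1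
  have h3 : (3 : F) = 0 := by exact_mod_cast CharP.cast_eq_zero F 3
  obtain ⟨i, hi⟩ : ∃ i : F, i ^ 2 = -1 := by
    obtain ⟨i, hi⟩ := FiniteField.isSquare_neg_one_iff.2
      (show Fintype.card F % 4 ≠ 3 by rw [← Nat.card_eq_fintype_card, hq]; norm_num)
    exact ⟨i, by rw [pow_two, hi]⟩
  have hp : ForcesOrder (2 : F) (n 2) := forcesOrder_two (p := 3)
  have o4 : ∀ τ : F, τ ^ 2 = -1 → ForcesOrder τ (n 1) := fun τ h =>
    (traceOrder_four (by linear_combination h - h3) (hne 2 (by norm_num))).forcesOrder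
  have o5 : ∀ τ : F, τ ^ 4 = -1 → ForcesOrder τ (n 0) := fun τ h =>
    (traceOrder_five (by linear_combination h - τ ^ 2 * h3) (hne 5 (by norm_num))).forcesOrder
  have hnz : ∀ z : F, z ^ 4 = -1 → z ≠ 0 := by
    rintro _ h rfl
    norm_num at h
  -- As traces, elements with fourth power `-1` force order 5 and square roots of `-1` force order
  -- 4. The words in the generators used below are upper triangular with diagonal entry of fourth
  -- power `-1`, as `SL2.eq_top_of_card_nine` requires.
  have r1 : (1 + i) ^ 4 = -1 := by grind
  have r2 : (1 + 2 * i) ^ 4 = -1 := by grind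
  have r3 : (2 + i) ^ 4 = -1 := by grind
  have r4 : (2 + 2 * i) ^ 4 = -1 := by grind
  have ri : (2 * i) ^ 2 = -1 := by grind
  refine ⟨(realizes_of_up (t₀ := 2) (t₁ := 0) (t₂ := 1) (f := i) (b := 1 + i) (c := 1 + 2 * i)
      (τ := 2 + i) (by grind) ?_ hp (o5 _ r3) (o4 _ ?_)).rotate,
    (realizes_of_up (t₀ := 2) (t₁ := 1) (t₂ := 0) (f := 1 + 2 * i) (b := 2 + i) (c := 2 + 2 * i)
      (τ := 2 * i) (by grind) ?_ hp (o4 _ ri) (o5 _ ?_)).rotate,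
    (realizes_of_up (t₀ := 2) (t₁ := 0) (t₂ := 0) (f := 1) (b := 1) (c := 2)
      (τ := 2 + 2 * i) (by grind) ?_ hp (o5 _ r4) (o5 _ ?_)).rotate, ?_⟩
  · set y : SL(2, F) := ofEntries 0 (1 + i) (1 + 2 * i) (2 + i) _
    have hx := Subgroup.subset_closure (Set.mem_insert (up i) {y})
    have hy := Subgroup.subset_closure (Set.mem_insert_of_mem (up i) (Set.mem_singleton y))
    refine SL2.eq_top_of_card_nine hq (by grind) hx
      (mul_mem (mul_mem (mul_mem (inv_mem hy) (inv_mem hy)) (inv_mem hx)) hy) ?_ ?_ hy (hnz _ r2) <;>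
    · simp [mul_apply_two, inv_apply_two, y]
      grind
  · grind
  · set y : SL(2, F) := ofEntries 0 (2 + i) (2 + 2 * i) (2 * i) _
    have hx := Subgroup.subset_closure (Set.mem_insert (up (1 + 2 * i)) {y})
    have hy := Subgroup.subset_closure
      (Set.mem_insert_of_mem (up (1 + 2 * i)) (Set.mem_singleton y))
    refine SL2.eq_top_of_card_nine hq (hnz _ r2) hx (mul_mem (mul_mem (mul_mem (mul_mem (inv_mem hy)
      (inv_mem hx)) (inv_mem hy)) hx) (inv_mem hy)) ?_ ?_ hy (hnz _ r4) <;>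
    · simp [mul_apply_two, inv_apply_two, y]
      grind
  · grind
  · set y : SL(2, F) := ofEntries 0 1 2 (2 + 2 * i) _
    have hx := Subgroup.subset_closure (Set.mem_insert (up 1) {y})
    have hy := Subgroup.subset_closure (Set.mem_insert_of_mem (up 1) (Set.mem_singleton y))
    refine SL2.eq_top_of_card_nine hq one_ne_zero hx (mul_mem (mul_mem (mul_mem (inv_mem hy)
      (inv_mem hx)) (inv_mem hy)) (inv_mem hy)) ?_ ?_ hy (by simpa [y] using hne 2) <;>
    · simp [mul_apply_two, inv_apply_two, y]
      grind
  · grind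
  · set x : SL(2, F) := ofEntries (1 + i) 0 0 (2 + i) (by grind) with hxdef
    set y : SL(2, F) := ofEntries (2 + i) i (1 + 2 * i) 1 (by grind) with hydef
    have hx := Subgroup.subset_closure (Set.mem_insert x {y})
    have hy := Subgroup.subset_closure (Set.mem_insert_of_mem x (Set.mem_singleton y))
    have hg := mul_mem (mul_mem (mul_mem (inv_mem hy) (inv_mem hy)) (inv_mem hx)) hy
    have hu : up (1 + 2 * i) ∈ Subgroup.closure {x, y} := by
      have := mul_mem (mul_mem (mul_mem (inv_mem hx) (inv_mem hx)) (inv_mem hx)) hg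
      convert this using 1
      apply ext_two <;> simp [mul_apply_two, inv_apply_two, x, y] <;> grind
    refine realizes_of_closure_eq_top (x := x) (y := y)
      (SL2.eq_top_of_card_nine hq (hnz _ r2) hu hx (by simp [x]) (by simpa [x]) hy (hnz _ r2))
      (o4 _ ?_) (o4 _ ?_) (o4 _ ?_) <;>
    · simp [mul_apply_two, x, y]
      grind

end SmallFields

/-! ### The isomorphisms with `A₅` for four and five elements. -/

section CardSixty

local notation "A₅" => alternatingGroup (Fin 5)

/-- Conjugation by `g` permutes `a`, `b = g * a * g⁻¹` and `a * b` cyclically, so these three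
involutions form with `1` a Klein four-group normalized by `g`. -/
theorem nonempty_mulEquiv_alternatingGroup_five_of_conj {G : Type*} [Group G] [IsSimpleGroup G]
    (hG : Nat.card G = 60) {a g : G} (ha2 : a * a = 1) (ha1 : a ≠ 1) (hg3 : orderOf g = 3)
    (hga : g * (g * a * g⁻¹) * g⁻¹ = a * (g * a * g⁻¹)) : Nonempty (G ≃* A₅) := by
  set b := g * a * g⁻¹ with hb
  have hb2 : b * b = 1 := by
    rw [hb, conj_mul, ha2, mul_one, mul_inv_cancel]
  have hab2 : (a * b) * (a * b) = 1 := by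
    rw [← hga, conj_mul, hb2, mul_one, mul_inv_cancel]
  have hcomm : b * a = a * b := by
    calc b * a = a * ((a * b) * (a * b)) * b := by
          rw [hab2, mul_one, ← mul_one (b * a), ← hab2]
          simp only [← mul_assoc]
          rw [mul_assoc b a a, ha2, mul_one, hb2, one_mul]
      _ = a * b := by rw [hab2, mul_one]
  have hb1 : b ≠ 1 := by
    rw [hb, Ne, conj_eq_one_iff]
    exact ha1
  have hab1 : a * b ≠ 1 := by
    rw [← hga, Ne, conj_eq_one_iff]
    exact hb1
  have hab : a ≠ b := fun h => hab1 (by rw [← h, ha2])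
  have hab3 : g * (a * b) * g⁻¹ = a := by
    rw [← conj_mul, hga, ← hb, ← mul_assoc, hcomm, mul_assoc, hb2, mul_one]
  let V : Subgroup G :=
    { carrier := {1, a, b, a * b}
      mul_mem' := by
        have e1 : a * (a * b) = b := by rw [← mul_assoc, ha2, one_mul]
        have e2 : b * (a * b) = a := by rw [← mul_assoc, hcomm, mul_assoc, hb2, mul_one]
        have e3 : a * b * a = b := by rw [mul_assoc, hcomm, e1]
        have e4 : a * b * b = a := by rw [mul_assoc, hb2, mul_one]
        rintro x y (rfl | rfl | rfl | rfl) (rfl | rfl | rfl | rfl) <;>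
          simp [ha2, hb2, hcomm, hab2, e1, e2, e3, e4]
      one_mem' := Or.inl rfl
      inv_mem' := by
        have e1 : a⁻¹ = a := inv_eq_of_mul_eq_one_left ha2
        have e2 : b⁻¹ = b := inv_eq_of_mul_eq_one_left hb2
        rintro x (rfl | rfl | rfl | rfl) <;> simp [e1, e2, hcomm] }
  refine nonempty_mulEquiv_alternatingGroup_five hG V ?_ hg3 ?_
  · have : Nat.card V = Set.ncard ({1, a, b, a * b} : Set G) := rfl
    rw [this, Set.ncard_eq_succ (Set.toFinite _)]
    refine ⟨1, {a, b, a * b}, ?_, rfl, ?_⟩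
    · simp [ha1.symm, hb1.symm, hab1.symm]
    · rw [Set.ncard_eq_three]
      refine ⟨a, b, a * b, hab, ?_, ?_, rfl⟩
      · exact fun h => hb1 (mul_left_cancel (a := a) (by rw [← h, mul_one]))
      · exact fun h => ha1 (mul_right_cancel (b := b) (by rw [← h, one_mul]))
  · rintro v (rfl | rfl | rfl | rfl)
    · exact Or.inl (by simp)
    · exact Or.inr (Or.inr (Or.inl rfl))
    · exact Or.inr (Or.inr (Or.inr hga))
    · exact Or.inr (Or.inl hab3)

variable {F : Type*} [Field F]

local notation "mk₂" => QuotientGroup.mk' (Subgroup.center SL(2, F))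
local notation "PSL₂" => ProjectiveSpecialLinearGroup (Fin 2) F

/-- The group is the kernel of the surjective determinant on `GL (Fin 2) F`. -/
theorem natCard_specialLinearGroup_two [Finite F] :
    Nat.card SL(2, F) = Nat.card F * (Nat.card F ^ 2 - 1) := by
  classical
  have := Fintype.ofFinite F
  have hq : 1 < Nat.card F := Finite.one_lt_card
  have hdet : Function.Surjective (GeneralLinearGroup.det : GL (Fin 2) F →* Fˣ) := by
    intro u
    refine ⟨GeneralLinearGroup.mkOfDetNeZero !![(u : F), 0; 0, 1] (by simp), Units.ext ?_⟩
    simp [GeneralLinearGroup.mkOfDetNeZero]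
  have hinj : Function.Injective (toGL : SL(2, F) →* GL (Fin 2) F) := by
    intro g h hgh
    apply Subtype.ext
    exact congrArg Units.val hgh
  have hrange : (toGL : SL(2, F) →* GL (Fin 2) F).range = GeneralLinearGroup.det.ker := by
    ext g
    rw [MonoidHom.mem_range, MonoidHom.mem_ker]
    constructor
    · rintro ⟨h, rfl⟩
      exact Units.ext h.2
    · intro h
      exact ⟨⟨g.1, congrArg Units.val h⟩, Units.ext rfl⟩
  have h1 := (GeneralLinearGroup.det : GL (Fin 2) F →* Fˣ).ker.card_mul_index
  rw [Subgroup.index_ker, MonoidHom.range_eq_top.2 hdet, Subgroup.card_top, ← hrange,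
    ← Nat.card_congr (MonoidHom.ofInjective hinj).toEquiv, Matrix.card_GL_field, Nat.card_units,
    Fin.prod_univ_two, ← Nat.card_eq_fintype_card] at h1
  have h2 : Nat.card F ^ 2 - Nat.card F ^ ((1 : Fin 2) : ℕ) = Nat.card F * (Nat.card F - 1) := by
    rw [Fin.val_one, pow_one, Nat.mul_sub, mul_one, pow_two]
  rw [h2, Fin.val_zero, pow_zero, mul_comm (Nat.card F), ← mul_assoc,
    mul_right_comm] at h1
  rw [Nat.eq_of_mul_eq_mul_right (by omega) h1, mul_comm]

theorem nonempty_mulEquiv_of_card_four (hq : Nat.card F = 4) : Nonempty (PSL₂ ≃* A₅) := by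
  have : Finite F := Nat.finite_of_card_ne_zero (by omega)
  have := Matrix.ProjectiveSpecialLinearGroup.rank_two_simple (F := F) hq.ge
  have h2 : (2 : F) = 0 := by
    have := Fintype.ofFinite F
    have h1 := FiniteField.cast_card_eq_zero F
    rw [← Nat.card_eq_fintype_card, hq] at h1
    push_cast at h1
    exact pow_eq_zero_iff two_ne_zero |>.1 (show (2 : F) ^ 2 = 0 by linear_combination h1)
  obtain ⟨a, hao, -, -⟩ := exists_split_unit (F := F)
  rw [hq] at hao
  have ha3 : a ^ 3 = 1 := orderOf_dvd_iff_pow_eq_one.1 (by rw [hao])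
  have ha1 : (a : F) - 1 ≠ 0 := by
    intro h
    have : a = 1 := Units.ext (sub_eq_zero.1 h)
    rw [this, orderOf_one] at hao
    omega
  have hax : (a : F) ^ 3 = 1 := by rw [← Units.val_pow_eq_pow_val, ha3, Units.val_one]
  have hsum : (a : F) ^ 2 + a + 1 = 0 := by
    refine (mul_eq_zero.1 (show ((a : F) - 1) * (a ^ 2 + a + 1) = 0 from ?_)).resolve_left ha1
    linear_combination hax
  have hcard : Nat.card PSL₂ = 60 := by
    have h1 := Subgroup.card_eq_card_quotient_mul_card_subgroup (Subgroup.center SL(2, F))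
    have h3 : Subgroup.center SL(2, F) = ⊥ := by
      rw [Subgroup.eq_bot_iff_forall]
      intro g hg
      obtain ⟨h01, h10, h00⟩ := mem_center_two.1 hg
      have hd := det_eq g
      have h4 : g 1 1 - 1 = 0 := by
        refine pow_eq_zero_iff two_ne_zero |>.1 ?_
        linear_combination hd + g 1 0 * h01 - g 1 1 * h00 + (1 - g 1 1) * h2
      apply ext_two <;> simp [h01, h10, h00, sub_eq_zero.1 h4]
    have h4 : Nat.card (Subgroup.center SL(2, F)) = 1 := by rw [h3, Subgroup.card_bot]
    rw [natCard_specialLinearGroup_two, hq, h4] at h1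
    change Nat.card (SL(2, F) ⧸ Subgroup.center SL(2, F)) = 60
    omega
  refine nonempty_mulEquiv_alternatingGroup_five_of_conj hcard (a := mk₂ (up 1)) (g := mk₂ (dg a))
    ?_ ?_ ?_ ?_
  · rw [← map_mul, ← up_add, one_add_one_eq_two, h2]
    convert map_one mk₂
    apply ext_two <;> simp
  · intro h
    have := (mem_center_two.1 ((QuotientGroup.eq_one_iff _).1 h)).1
    simp at this
  · refine orderOf_eq_prime ?_ fun h => ?_
    · rw [← map_pow, ← dg_pow, ha3]
      convert map_one mk₂
      apply ext_two <;> simp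
    · have h5 := (mem_center_two.1 ((QuotientGroup.eq_one_iff _).1 h)).2.2
      simp at h5
      field_simp at h5
      exact ha1 (by linear_combination hax - (a : F) * h5)
  · rw [← map_inv, ← map_mul, ← map_mul, dg_mul_up_mul, ← map_mul, ← map_mul, ← map_mul,
      dg_mul_up_mul, ← up_add]
    congr 2
    -- The relation needed is `a ^ 4 = 1 + a ^ 2`, which is `a ^ 2 + a + 1 = 0` in characteristic 2.
    linear_combination (a : F) * hax + hsum - ((a : F) ^ 2 + 1) * h2

theorem nonempty_mulEquiv_of_card_five (hq : Nat.card F = 5) : Nonempty (PSL₂ ≃* A₅) := by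
  have : Finite F := Nat.finite_of_card_ne_zero (by omega)
  have := Matrix.ProjectiveSpecialLinearGroup.rank_two_simple (F := F) (by omega)
  have h5 : (5 : F) = 0 := by
    have := Fintype.ofFinite F
    have h1 := FiniteField.cast_card_eq_zero F
    rw [← Nat.card_eq_fintype_card, hq] at h1
    exact_mod_cast h1
  have h2 : (2 : F) ≠ 0 := fun h => one_ne_zero (α := F) (by linear_combination h5 - 2 * h)
  have hcard : Nat.card PSL₂ = 60 := by
    have h1 := Subgroup.card_eq_card_quotient_mul_card_subgroup (Subgroup.center SL(2, F))
    have h3 : (Subgroup.center SL(2, F) : Set SL(2, F)) = {1, -1} := by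
      ext g
      rw [SetLike.mem_coe, mem_center_two]
      constructor
      · rintro ⟨h01, h10, h00⟩
        have hd := det_eq g
        have h4 : (g 1 1 - 1) * (g 1 1 + 1) = 0 := by
          linear_combination hd + g 1 0 * h01 - g 1 1 * h00
        rcases mul_eq_zero.1 h4 with h4 | h4
        · left
          apply ext_two <;> simp [h01, h10, h00, sub_eq_zero.1 h4]
        · right
          apply ext_two <;> simp [h01, h10, h00, eq_neg_of_add_eq_zero_left h4]
      · rintro (rfl | rfl) <;> simp
    have h4 : Nat.card (Subgroup.center SL(2, F)) = 2 := by
      have : Nat.card (Subgroup.center SL(2, F)) =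
        (Subgroup.center SL(2, F) : Set SL(2, F)).ncard := rfl
      rw [this, h3, Set.ncard_pair]
      intro h
      have := congrArg (fun g : SL(2, F) => g 0 0) h
      simp at this
      exact h2 (by linear_combination this)
    rw [natCard_specialLinearGroup_two, hq, h4] at h1
    change Nat.card (SL(2, F) ⧸ Subgroup.center SL(2, F)) = 60
    omega
  -- Modulo 5, `x` squares to `-1` and `g` has trace `1`, so they have orders 2 and 3 modulo the
  -- center.
  set x : SL(2, F) := ofEntries 2 0 0 (-2) (by linear_combination -h5) with hx
  set g : SL(2, F) := ofEntries 4 4 3 2 (by linear_combination -h5) with hg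
  refine nonempty_mulEquiv_alternatingGroup_five_of_conj hcard (a := mk₂ x) (g := mk₂ g) ?_ ?_ ?_ ?_
  · rw [← map_mul]
    refine (QuotientGroup.eq_one_iff _).2 (mem_center_two.2 ⟨?_, ?_, ?_⟩) <;>
      simp [mul_apply_two, x]
  · intro h
    have := (mem_center_two.1 ((QuotientGroup.eq_one_iff _).1 h)).2.2
    simp [x] at this
    exact one_ne_zero (α := F) (by linear_combination h5 - this)
  · refine (traceOrder_three (τ := 1) (by ring) ?_).orderOf_mk (g := g) ?_
    · intro h
      push_cast at h
      exact one_ne_zero (α := F) (by linear_combination 2 * h - h5)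
    · simp [g]
      linear_combination h5
  · rw [← map_inv, ← map_mul, ← map_mul, ← map_mul, ← map_mul, ← map_mul]
    congr 1
    apply ext_two <;> simp [mul_apply_two, inv_apply_two, x, g]
    all_goals grind

end CardSixty

/-! ### Assembling the cases. -/

section Main

variable {F : Type*} [Field F]

local notation "PSL₂" => ProjectiveSpecialLinearGroup (Fin 2) F

theorem PSL2.exists_mul_ne_mul : ∃ a b : PSL₂, a * b ≠ b * a := by
  refine ⟨QuotientGroup.mk (up 1), QuotientGroup.mk (lo 1), fun h => ?_⟩
  have := (mem_center_two.1 (QuotientGroup.eq.1 h)).1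
  simp [mul_apply_two, inv_apply_two] at this

/-- The three numbers may come in any order, which lets the small fields choose which torus plays
the role of type 1. -/
theorem isBeauvilleGroup_pi_of_realizes_main [Finite F] {p : ℕ} [Fact p.Prime] [CharP F p]
    (hq : 7 ≤ Nat.card F) {a b c : ℕ} (hab : a.Coprime b) (hac : a.Coprime c) (hbc : b.Coprime c)
    (hcov : (∃ j, ![a, b, c] j = nonsplitOrder (Nat.card F)) ∧
      (∃ j, ![a, b, c] j = splitOrder (Nat.card F)) ∧ ∃ j, ![a, b, c] j = p)
    (ha : a ≠ 1) (hb : 4 ≤ b) (hc : c ≠ 1) (hyp : TriangleGroup.IsHyperbolic a a c)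
    (hr : Realizes PSL₂ ![a, b, c] ![0, 1, 2] ∧ Realizes PSL₂ ![a, b, c] ![1, 0, 2] ∧
      Realizes PSL₂ ![a, b, c] ![0, 0, 2] ∧ Realizes PSL₂ ![a, b, c] ![1, 1, 1])
    {k : ℕ} (hk : k ≤ dTwo PSL₂) (hk1 : 1 ≤ k) : IsBeauvilleGroup (Fin k → PSL₂) := by
  have := Matrix.ProjectiveSpecialLinearGroup.rank_two_simple (F := F) (by omega)
  refine isBeauvilleGroup_pi_of_main_types PSL2.exists_mul_ne_mul ?_ ?_ ?_ hb hyp hr.1 hr.2.1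
    hr.2.2.1 hr.2.2.2 hk hk1
  · intro i j hij
    fin_cases i <;> fin_cases j
    exacts [absurd rfl hij, hab, hac, hab.symm, absurd rfl hij, hbc, hac.symm, hbc.symm,
      absurd rfl hij]
  · intro j
    fin_cases j
    exacts [ha, fun h : b = 1 => by omega, hc]
  · intro h
    obtain ⟨⟨i, hi⟩, ⟨j, hj⟩, ⟨l, hl⟩⟩ := hcov
    rcases PSL2.pow_eq_one (p := p) h with h | h | h
    exacts [⟨i, by rw [hi, h]⟩, ⟨j, by rw [hj, h]⟩, ⟨l, by rw [hl, h]⟩]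

theorem exists_eq_pow_of_natCard [Finite F] : ∃ p m : ℕ, p.Prime ∧ CharP F p ∧
    Nat.card F = p ^ m ∧ m ≠ 0 := by
  have := Fintype.ofFinite F
  obtain ⟨p, hp⟩ := CharP.exists F
  obtain ⟨m, hp1, hm⟩ := FiniteField.card F p
  exact ⟨p, m, hp1, hp, by rw [Nat.card_eq_fintype_card, hm], m.ne_zero⟩

theorem isBeauvilleGroup_pi_of_seven_le (hq : 7 ≤ Nat.card F) {k : ℕ} (hk : k ≤ dTwo PSL₂)
    (hk1 : 1 ≤ k) : IsBeauvilleGroup (Fin k → PSL₂) := by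
  have : Finite F := Nat.finite_of_card_ne_zero (by omega)
  obtain ⟨p, m, hp, hchar, hcard, hm⟩ := exists_eq_pow_of_natCard (F := F)
  have hpF : Fact p.Prime := ⟨hp⟩
  have hchar_of : ∀ r s : ℕ, r.Prime → Nat.card F = r ^ s → p = r := fun r s hr h =>
    (Nat.prime_dvd_prime_iff_eq hp hr).1 (hp.dvd_of_dvd_pow (h ▸ hcard ▸ dvd_pow_self p hm))
  by_cases h7 : Nat.card F = 7
  · obtain rfl := hchar_of 7 1 (by norm_num) h7
    refine isBeauvilleGroup_pi_of_realizes_main (p := 7) hq (a := 3) (b := 4) (c := 7)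
      (by norm_num) (by norm_num) (by norm_num) ?_ (by norm_num) (by norm_num) (by norm_num)
      ⟨by norm_num, by norm_num, by norm_num, by norm_num⟩ (realizes_seven h7) hk hk1
    rw [h7]
    exact ⟨⟨1, rfl⟩, ⟨0, rfl⟩, ⟨2, rfl⟩⟩
  by_cases h9 : Nat.card F = 9
  · obtain rfl := hchar_of 3 2 (by norm_num) h9
    refine isBeauvilleGroup_pi_of_realizes_main (p := 3) hq (a := 5) (b := 4) (c := 3)
      (by norm_num) (by norm_num) (by norm_num) ?_ (by norm_num) (by norm_num) (by norm_num)
      ⟨by norm_num, by norm_num, by norm_num, by norm_num⟩ (realizes_nine h9) hk hk1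
    rw [h9]
    exact ⟨⟨0, rfl⟩, ⟨1, rfl⟩, ⟨2, rfl⟩⟩
  by_cases h11 : Nat.card F = 11
  · obtain rfl := hchar_of 11 1 (by norm_num) h11
    refine isBeauvilleGroup_pi_of_realizes_main (p := 11) hq (a := 6) (b := 5) (c := 11)
      (by norm_num) (by norm_num) (by norm_num) ?_ (by norm_num) (by norm_num) (by norm_num)
      ⟨by norm_num, by norm_num, by norm_num, by norm_num⟩ (realizes_eleven h11) hk hk1
    rw [h11]
    exact ⟨⟨0, rfl⟩, ⟨1, rfl⟩, ⟨2, rfl⟩⟩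
  -- With 7, 9 and 11 removed, an even `q` is at least 8 and an odd `q` at least 13.
  obtain ⟨hsp, hns⟩ : 6 ≤ splitOrder (Nat.card F) ∧ 5 ≤ nonsplitOrder (Nat.card F) := by
    rcases Nat.even_or_odd (Nat.card F) with h | h
    · rw [splitOrder_of_even h (by omega), nonsplitOrder_of_even h]
      have := h.two_dvd
      omega
    · rw [splitOrder_of_odd h, nonsplitOrder_of_odd h]
      obtain ⟨c, hc⟩ := h
      omega
  obtain ⟨ζ, α, -, -, -, hα⟩ := exists_nonsplit_root (F := F) (by omega)
  have hmix := realizes_generic_mixed (p := p) hsp hα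
  have hpq : p ∣ Nat.card F := hcard ▸ dvd_pow_self p hm
  have hnsp : (nonsplitOrder (Nat.card F)).Coprime p := by
    refine Nat.Coprime.of_dvd (nonsplitOrder_dvd _) hpq ?_
    simp
  have hspp : (splitOrder (Nat.card F)).Coprime p := by
    refine Nat.Coprime.of_dvd (splitOrder_dvd _) hpq ?_
    exact (Nat.coprime_self_sub_left (by omega)).2 (Nat.coprime_one_left _)
  refine isBeauvilleGroup_pi_of_realizes_main (p := p) hq (coprime_splitOrder (by omega)) hnsp hspp
    ⟨⟨0, rfl⟩, ⟨1, rfl⟩, ⟨2, rfl⟩⟩ (by omega) (by omega) hp.ne_one ?_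
    ⟨hmix.1, hmix.2, realizes_nonsplit hq h9, realizes_generic_split hsp⟩ hk hk1
  exact TriangleGroup.IsHyperbolic.mono (l := 5) (m := 5) (n := 2)
    ⟨by norm_num, by norm_num, by norm_num, by norm_num⟩ hns hns hp.two_le

theorem nonempty_mulEquiv_of_card_le_five (hq : 4 ≤ Nat.card F) (hq5 : Nat.card F ≤ 5) :
    Nonempty (PSL₂ ≃* alternatingGroup (Fin 5)) := by
  rcases (show Nat.card F = 4 ∨ Nat.card F = 5 by omega) with h | h
  exacts [nonempty_mulEquiv_of_card_four h, nonempty_mulEquiv_of_card_five h]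

end Main

theorem theorem1p1 (F : Type*) [Field F] [Finite F] (q : ℕ) (hF : Nat.card F = q) (hq : 4 ≤ q)
    (k : ℕ) (hk : 1 ≤ k) :
    List.TFAE [
      IsBeauvilleGroup (Fin k → Matrix.ProjectiveSpecialLinearGroup (Fin 2) F),
      IsTwoGenerator (Fin k → Matrix.ProjectiveSpecialLinearGroup (Fin 2) F) ∧
        ¬ Nonempty ((Fin k → Matrix.ProjectiveSpecialLinearGroup (Fin 2) F) ≃*
          alternatingGroup (Fin 5)),
      k ≤ dTwo (Matrix.ProjectiveSpecialLinearGroup (Fin 2) F) ∧ (q ≤ 5 → 1 < k)] := by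
  subst hF
  have := Matrix.ProjectiveSpecialLinearGroup.rank_two_simple (F := F) hq
  tfae_have 1 → 2 := by
    intro h
    refine ⟨?_, fun ⟨e⟩ => not_isBeauvilleGroup_of_alternatingGroup_five e h⟩
    obtain ⟨-, l, m, n, -, -, -, f, -, -, -, ⟨hf, -⟩, -⟩ := h
    exact ⟨_, _, TriangleGroup.isGeneratingPair hf⟩
  tfae_have 2 → 3 := by
    rintro ⟨h2, hA⟩
    refine ⟨le_dTwo_of_isTwoGenerator_pi h2, fun hq5 => ?_⟩
    by_contra! hk1
    obtain rfl : k = 1 := by omega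
    obtain ⟨e⟩ := nonempty_mulEquiv_of_card_le_five hq hq5
    exact hA ⟨(MulEquiv.funUnique (Fin 1) _).trans e⟩
  tfae_have 3 → 1 := by
    rintro ⟨hk2, hq5⟩
    rcases Nat.lt_or_ge (Nat.card F) 7 with h | h
    -- No field has six elements, so below 7 only the two fields giving `A₅` remain.
    · have h6 : Nat.card F ≠ 6 := by
        intro h6
        obtain ⟨p, m, hp, -, hcard, -⟩ := exists_eq_pow_of_natCard (F := F)
        rw [h6] at hcard
        have h2 := (Nat.prime_dvd_prime_iff_eq Nat.prime_two hp).1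
          (Nat.prime_two.dvd_of_dvd_pow (hcard ▸ (by norm_num : 2 ∣ 6)))
        have h3 := (Nat.prime_dvd_prime_iff_eq Nat.prime_three hp).1
          (Nat.prime_three.dvd_of_dvd_pow (hcard ▸ (by norm_num : 3 ∣ 6)))
        omega
      obtain ⟨e⟩ := nonempty_mulEquiv_of_card_le_five hq (by omega)
      exact isBeauvilleGroup_pi_alternatingGroup_five e.symm hk2 (hq5 (by omega))
    · exact isBeauvilleGroup_pi_of_seven_le h hk2 hk
  tfae_finish
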